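/- **Conventions.** Let $R$ be one of $\mathbb Z_p$ ($p$ prime), $\mathbb Z$, or $\widehat{\mathbb Z}=\varprojlim_a \mathbb Z/a\mathbb Z$. An $n\times n$ matrix $C$ over $R$ is *alternating* if $C^{\mathsf T}=-C$ and its diagonal is zero; a matrix $X$ is *$C$-symmetric* if $X-X^{\mathsf T}=C$. Put $\operatorname{coker}(X)=R^n/XR^n$. For $\varepsilon>0$, an $R$-valued random variable $N$ is *$\varepsilon$-balanced* if $\mathbb P[N\equiv r \pmod{\mathfrak m}]\le 1-\varepsilon$ for every maximal ideal $\mathfrak m$ of $R$ with finite residue field (that is, $\mathfrak m=\ell R$ for a prime number $\ell$ that is not a unit in $R$) and every residue class $r\in R/\mathfrak m$. For a prime $p$ let $\Gamma_{CL}^{(p,0)}$ be the random finite abelian $p$-group with $$\mathbb P[\Gamma_{CL}^{(p,0)}\cong G]=\frac1{|\operatorname{Aut}(G)|}\prod_{k=1}^\infty(1-p^{-k})$$ for every finite abelian $p$-group $G$, and let $\Gamma_{CL}^{(0)}=\prod_p\Gamma_{CL}^{(p,0)}$ with independent factors. Random abelian groups $\Gamma_n$ *converge weakly* to a random abelian group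 $\Gamma$ if, for every integer $a>0$ and every finite abelian group $H$ of exponent dividing $a$, $$\lim_{n\to\infty}\mathbb P[\Gamma_n\otimes\mathbb Z/a\mathbb Z\cong H]=\mathbb P[\Gamma\otimes\mathbb Z/a\mathbb Z\cong H].$$ **Theorem.** Let $\varepsilon>0$. For each $n$, let $C_n$ be a deterministic alternating $n\times n$ matrix over $R$, and let $X_n$ be a random $C_n$-symmetric $n\times n$ matrix over $R$ whose entries on and above the diagonal are independent and $\varepsilon$-balanced. 1. Let $R=\mathbb Z_p$ and suppose $\lim_{n\to\infty}\operatorname{rank}(C_n \bmod p)=\infty$. Then for every finite abelian $p$-group $G$, $$\lim_{n\to\infty}\mathbb P[\operatorname{coker}(X_n)\cong G]=\frac1{|\operatorname{Aut}(G)|}\prod_{k=1}^\infty(1-p^{-k}).$$ 2. Let $R=\mathbb Z_p$ (respectively, $R=\mathbb Z$ or $R=\widehat{\mathbb Z}$). Suppose that $\operatorname{coker}(C_n)$ can be generated by $g_n$ elements over $R$ and that $\lim_{n\to\infty}(n-g_n)=\infty$. Then $\operatorname{coker}(X_n)$ converges weakly to $\Gamma_{CL}^{(p,0)}$ (respectively,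 to $\Gamma_{CL}^{(0)}$). -/

import Mathlib

open MeasureTheory ProbabilityTheory Filter Topology
open scoped ENNReal Matrix TensorProduct

/-! ### Matrices -/

/-- A square matrix is alternating if it is skew-symmetric with zero diagonal. -/
def Matrix.IsAlternating {R : Type*} [CommRing R] {n : ℕ}
    (C : Matrix (Fin n) (Fin n) R) : Prop :=
  Cᵀ = -C ∧ ∀ i, C i i = 0

/-- `X` is `C`-symmetric if `X - Xᵀ = C`. -/
def Matrix.IsCSymmetric {R : Type*} [CommRing R] {n : ℕ}
    (C X : Matrix (Fin n) (Fin n) R) : Prop :=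
  X - Xᵀ = C

/-- The cokernel `R ^ n / X R ^ n` of a square matrix. -/
abbrev Matrix.Coker {R : Type*} [CommRing R] {n : ℕ}
    (X : Matrix (Fin n) (Fin n) R) : Type _ :=
  (Fin n → R) ⧸ LinearMap.range X.mulVecLin

/-- The `R`-module `M` can be generated by `g` elements. -/
def GeneratedBy (R M : Type*) [CommRing R] [AddCommGroup M] [Module R M] (g : ℕ) : Prop :=
  ∃ v : Fin g → M, Submodule.span R (Set.range v) = ⊤

/-! ### Random matrices -/

/-- An `R`-valued random variable is `ε`-balanced if for every maximal ideal `𝔪` of `R` with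
finite residue field, every residue class modulo `𝔪` has probability at most `1 - ε`.
For `R = ℤ` and `R = ℤ_[p]` every maximal ideal has a finite residue field. For the profinite
integers the maximal ideals with finite residue field are those generated by a prime number
(equivalently the closed ones); the remaining ones come from nonprincipal ultrafilters
on the set of primes, and no condition is imposed at them. -/
def IsEpsBalanced {Ω R : Type*} [MeasurableSpace Ω] [CommRing R]
    (ε : ℝ) (P : Measure Ω) (N : Ω → R) : Prop :=
  ∀ 𝔪 : Ideal R, 𝔪.IsMaximal → Finite (R ⧸ 𝔪) → ∀ r : R ⧸ 𝔪,
    P.real {ω | Ideal.Quotient.mk 𝔪 (N ω) = r} ≤ 1 - ε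

/-- `X` is a random `C`-symmetric matrix whose entries on and above the diagonal are
independent `ε`-balanced random variables. -/
structure IsEpsBalancedCSymmetric {Ω R : Type*} [MeasurableSpace Ω] [CommRing R]
    [MeasurableSpace R] {n : ℕ} (ε : ℝ) (P : Measure Ω) (C : Matrix (Fin n) (Fin n) R)
    (X : Ω → Matrix (Fin n) (Fin n) R) : Prop where
  measurable_entry : ∀ i j, i ≤ j → Measurable fun ω => X ω i j
  csymmetric : ∀ᵐ ω ∂P, Matrix.IsCSymmetric C (X ω)
  indep : iIndepFun
    (fun (ij : {ij : Fin n × Fin n // ij.1 ≤ ij.2}) (ω : Ω) => X ω ij.1.1 ij.1.2) P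
  balanced : ∀ i j, i ≤ j → IsEpsBalanced ε P fun ω => X ω i j

/-! ### The profinite integers -/

/-- The ring of profinite integers, the inverse limit of the rings `ℤ / n` over `n ≥ 1` ordered
by divisibility. It carries the σ-algebra induced by the product of the discrete ones, which
is its Borel σ-algebra. -/
def ProfiniteInt : Subring (∀ n : ℕ+, ZMod (n : ℕ)) where
  carrier := {x | ∀ (m n : ℕ+) (h : (m : ℕ) ∣ (n : ℕ)), ZMod.castHom h (ZMod (m : ℕ)) (x n) = x m}
  mul_mem' := fun hx hy m n h => by
    rw [Pi.mul_apply, Pi.mul_apply, map_mul, hx m n h, hy m n h]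
  one_mem' := fun m n h => by rw [Pi.one_apply, Pi.one_apply, map_one]
  add_mem' := fun hx hy m n h => by
    rw [Pi.add_apply, Pi.add_apply, map_add, hx m n h, hy m n h]
  zero_mem' := fun m n h => by rw [Pi.zero_apply, Pi.zero_apply, map_zero]
  neg_mem' := fun hx m n h => by rw [Pi.neg_apply, Pi.neg_apply, map_neg, hx m n h]

/-! ### The Cohen–Lenstra random groups -/

/-- The Cohen–Lenstra probability `|Aut G|⁻¹ ∏_{k ≥ 1} (1 - p ^ (-k))` of the group `G`. -/
noncomputable def cohenLenstraProb (p : ℕ) (G : Type*) [AddCommGroup G] : ℝ :=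
  (Nat.card (G ≃+ G) : ℝ)⁻¹ * ∏' k : ℕ, (1 - ((p : ℝ) ^ (k + 1))⁻¹)

/-- Finite abelian `p`-groups. -/
structure FinAbPGroup (p : ℕ) where
  carrier : Type
  [addCommGroup : AddCommGroup carrier]
  card_eq : ∃ k : ℕ, Nat.card carrier = p ^ k

attribute [instance] FinAbPGroup.addCommGroup

/-- Isomorphism of finite abelian `p`-groups. -/
instance FinAbPGroup.setoid (p : ℕ) : Setoid (FinAbPGroup p) where
  r G H := Nonempty (G.carrier ≃+ H.carrier)
  iseqv := ⟨fun G => ⟨AddEquiv.refl G.carrier⟩, fun ⟨e⟩ => ⟨e.symm⟩, fun ⟨e⟩ ⟨f⟩ => ⟨e.trans f⟩⟩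

/-- Isomorphism classes of finite abelian `p`-groups. -/
def FinAbPGroupClass (p : ℕ) : Type 1 := Quotient (FinAbPGroup.setoid p)

instance FinAbPGroupClass.measurableSpace (p : ℕ) : MeasurableSpace (FinAbPGroupClass p) := ⊤

/-- A group in the given isomorphism class. -/
noncomputable def FinAbPGroupClass.group {p : ℕ} (c : FinAbPGroupClass p) : AddCommGrpCat.{0} :=
  AddCommGrpCat.of (Quotient.out c : FinAbPGroup p).carrier

/-- The law of the Cohen–Lenstra random `p`-group: the isomorphism class of `G` has
probability `|Aut G|⁻¹ ∏_{k ≥ 1} (1 - p ^ (-k))`. -/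
noncomputable def cohenLenstraLaw (p : ℕ) : Measure (FinAbPGroupClass p) :=
  Measure.sum fun c => ENNReal.ofReal (cohenLenstraProb p c.group) • Measure.dirac c

open Classical in
/-- The joint law of independent Cohen–Lenstra random `p`-groups, one for each prime `p`.
Each `cohenLenstraLaw p` has total mass one (a classical identity of Hall and of Cohen and
Lenstra), so that the first case is the one that applies; the case distinction is there only
because the product measure is defined for probability measures. -/
noncomputable def cohenLenstraProductLaw : Measure (∀ p : Nat.Primes, FinAbPGroupClass p) :=
  if h : ∀ p : Nat.Primes, IsProbabilityMeasure (cohenLenstraLaw p) then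
    haveI := h
    Measure.infinitePi fun p : Nat.Primes => cohenLenstraLaw p
  else 0

/-- The direct product over all primes `p` of groups in the given isomorphism classes. -/
noncomputable def primeProductGroup (c : ∀ p : Nat.Primes, FinAbPGroupClass p) :
    AddCommGrpCat.{0} :=
  AddCommGrpCat.of (∀ p : Nat.Primes, (c p).group)

/-! ### Weak convergence of random abelian groups -/

/-- The random abelian groups `Γ n` converge weakly to the random abelian group `Δ`:
for every integer `a > 0` and every finite abelian group `H` of exponent dividing `a`, the
probability that `Γ n ⊗ ℤ / a ≅ H` tends to the probability that `Δ ⊗ ℤ / a ≅ H`. -/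
def ConvergesWeakly {Ω : ℕ → Type*} [∀ n, MeasurableSpace (Ω n)] (P : ∀ n, Measure (Ω n))
    (Γ : ∀ n, Ω n → AddCommGrpCat) {Ω' : Type*} [MeasurableSpace Ω'] (Q : Measure Ω')
    (Δ : Ω' → AddCommGrpCat) : Prop :=
  ∀ a : ℕ, 0 < a → ∀ (H : Type) [AddCommGroup H] [Finite H], (∀ x : H, a • x = 0) →
    Tendsto (fun n => P n {ω | Nonempty ((Γ n ω ⊗[ℤ] ZMod a) ≃+ H)}) atTop
      (𝓝 (Q {ω | Nonempty ((Δ ω ⊗[ℤ] ZMod a) ≃+ H)}))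

/-! Fix `a`, reduce modulo `a`, and let `G` be a finite abelian group killed by `a`. By
orthogonality of characters, the expected number of homomorphisms from the cokernel to `G` is
`|G|^(-n)` times a sum over tuples `w` in `(G × Ĝ)^n` of Fourier coefficients of the law of the
matrix. Each coefficient factors over the entries on and above the diagonal. An off-diagonal entry
`(i, j)` contributes a factor of norm at most some `ρ < 1` unless `w i = (f, c)` and `w j = (f',
c')` satisfy `c(f') c'(f) = 1`. Hence only tuples inside an isotropic subgroup of the maximal order
`|G|` (a Lagrangian) matter: `tendsto_sum_pow_pairDefect`.

On a Lagrangian `L` the pairing `B((f, c), (f', c')) = c(f')` is skew. If `B(l, l) ≠ 1` for some `l`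
in `L`, the diagonal entries make the contribution of `L` negligible. If `B` is alternating on `L`,
the randomness cancels and a quadratic phase in `C` remains. When `B` is nontrivial, its normalized
Gauss sum has square at most `p^(-rank (C mod p))` for some prime `p` dividing `a`
(`exists_prime_norm_sum_quadPhase_sq_le`). This is where the rank hypothesis acts: with `C = 0`
every Lagrangian with alternating `B` would contribute `1`. The Lagrangians with trivial `B` are the
products `A × A^⊥`, one for each subgroup `A` of `G`, so the limiting moment is the number of
subgroups of `G` (`tendsto_moment`). Uniform square matrices without any symmetry have the same
limiting moments (`tendsto_uniform_moment`), and the law of their cokernels can be counted exactly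
(`natCard_coker_equiv_div`).

It remains to see that the moments determine the law. A finite abelian group is determined by its
numbers of homomorphisms to cyclic groups of prime power order. For one prime these numbers form a
profile whose mixed moments are homomorphism counts to `p`-groups. The subgroups of `F_p^t` number
roughly `p^(t²/4)`, while a polynomial isolating one profile among those with first coordinate at
most `p^s` has coefficients of size about `p^(-s²/2)`. The second decay beats the first growth, so
asymptotically equal moments force asymptotically equal laws (`tendsto_profile_sub`). Several primes
are handled one after another (`tendsto_moment_homProfile`).

Finally, the cokernel modulo `a` is the cokernel of the matrix modulo `a`, which gives weak
convergence over each ring. Over `ℤ_[p]`, Nakayama's lemma recognizes a group killed by `p ^ K` from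
the cokernel modulo `p ^ (K + 1)`, which gives pointwise convergence. -/

/-! ### Tuples in a finite group with an orthogonality relation: counting non-orthogonal pairs. -/

section Isotropic
open scoped Classical

/-- The number of ordered pairs of distinct positions whose values are not orthogonal, where
`P v` is the subgroup orthogonal to `v`. -/
noncomputable def pairDefect {W : Type*} [AddCommGroup W] {n : ℕ} (P : W → AddSubgroup W)
    (w : Fin n → W) : ℕ :=
  (Finset.univ.filter fun ij : Fin n × Fin n => ij.1 ≠ ij.2 ∧ w ij.2 ∉ P (w ij.1)).card

/-- The number of positions with values outside a subgroup. -/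
noncomputable def outsideCount {W : Type*} [AddCommGroup W] {n : ℕ} (L : AddSubgroup W)
    (w : Fin n → W) : ℕ :=
  (Finset.univ.filter fun i => w i ∉ L).card

/-- A subgroup is isotropic if all its elements are mutually orthogonal. -/
def IsIsotropic {W : Type*} [AddCommGroup W] (P : W → AddSubgroup W) (L : AddSubgroup W) : Prop :=
  ∀ w ∈ L, L ≤ P w

/-- An isotropic subgroup of the given order. -/
def IsLagrangian {W : Type*} [AddCommGroup W] (P : W → AddSubgroup W) (γ : ℕ)
    (L : AddSubgroup W) : Prop :=
  IsIsotropic P L ∧ Nat.card L = γ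

lemma sum_pow_outsideCount {W : Type*} [AddCommGroup W] [Fintype W] (L : AddSubgroup W) (n : ℕ)
    (z : ℝ) : ∑ w : Fin n → W, z ^ outsideCount L w =
      (Nat.card L + (Fintype.card W - Nat.card L : ℝ) * z) ^ n := by
  have h : ∀ w : Fin n → W, z ^ outsideCount L w = ∏ i, (if w i ∈ L then 1 else z) := by
    intro w
    rw [outsideCount, Finset.prod_ite, Finset.prod_const_one, one_mul, Finset.prod_const]
  simp_rw [h]
  rw [← Fintype.sum_pow (fun v : W => if v ∈ L then (1 : ℝ) else z) n, Finset.sum_ite,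
    Finset.sum_const, Finset.sum_const]
  have h1 : (Finset.univ.filter fun v : W => v ∈ L).card = Nat.card L := by
    rw [Nat.card_eq_fintype_card, Fintype.card_subtype]
  have h2 := Finset.card_filter_add_card_filter_not (s := (Finset.univ : Finset W)) (fun v => v ∈ L)
  rw [h1, Finset.card_univ] at h2
  rw [h1, ← h2]
  push_cast
  ring_nf

/-- A position with value `v` and a position with value `v'` form a defective pair unless they
coincide. The diagonal accounts for the term `n`, which is needed because `v = v'` is allowed. -/
lemma card_fiber_mul_le_pairDefect {W : Type*} [AddCommGroup W] {n : ℕ} (P : W → AddSubgroup W)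
    (w : Fin n → W) {v v' : W} (h : v' ∉ P v) :
    (Finset.univ.filter fun i => w i = v).card * (Finset.univ.filter fun i => w i = v').card ≤
      pairDefect P w + n := by
  rw [← Finset.card_product]
  have hn : n = (Finset.univ.image fun i : Fin n => (i, i)).card := by
    rw [Finset.card_image_of_injective _ (fun i j h => by simpa using h), Finset.card_univ,
      Fintype.card_fin]
  refine le_trans (le_trans (Finset.card_le_card ?_) (Finset.card_union_le _ _))
    (Nat.add_le_add_left hn.ge _)
  rintro ⟨i, j⟩ hij
  simp only [Finset.mem_product, Finset.mem_filter, Finset.mem_univ, true_and] at hij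
  simp only [Finset.mem_union, Finset.mem_filter, Finset.mem_univ, true_and, Finset.mem_image,
    Prod.mk.injEq]
  by_cases hij' : i = j
  · right; exact ⟨i, rfl, hij'⟩
  · left; refine ⟨hij', ?_⟩; rw [hij.1, hij.2]; exact h

lemma outsideCount_le {W : Type*} [AddCommGroup W] [Fintype W] {n : ℕ} (L : AddSubgroup W)
    (w : Fin n → W) (T : ℕ)
    (h : ∀ v ∉ L, (Finset.univ.filter fun i => w i = v).card ≤ T) :
    outsideCount L w ≤ Fintype.card W * T := by
  have : (Finset.univ.filter fun i => w i ∉ L) =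
      (Finset.univ.filter fun v : W => v ∉ L).biUnion
        fun v => Finset.univ.filter fun i => w i = v := by
    ext i; simp
  rw [outsideCount, this]
  refine Finset.card_biUnion_le.trans ?_
  refine (Finset.sum_le_card_nsmul _ _ T fun v hv => h v (by simpa using hv)).trans ?_
  rw [smul_eq_mul]
  exact Nat.mul_le_mul_right _ (Finset.card_le_univ _)

/-- Each position outside `L` is defective with at least `T` positions inside `L`. The two positions
differ automatically, since only one of the values lies in `L`. -/
lemma mul_outsideCount_le_pairDefect {W : Type*} [AddCommGroup W] {n : ℕ}
    (P : W → AddSubgroup W) (L : AddSubgroup W)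
    (w : Fin n → W) (T : ℕ)
    (h : ∀ u ∉ L, ∃ v ∈ L, v ∉ P u ∧ T ≤ (Finset.univ.filter fun i => w i = v).card) :
    T * outsideCount L w ≤ pairDefect P w := by
  have hsub : ((Finset.univ.filter fun i => w i ∉ L).sigma fun i =>
      Finset.univ.filter fun j => w j ∈ L ∧ w j ∉ P (w i)).map
        (Equiv.sigmaEquivProd (Fin n) (Fin n)).toEmbedding ⊆
      Finset.univ.filter fun ij : Fin n × Fin n => ij.1 ≠ ij.2 ∧ w ij.2 ∉ P (w ij.1) := by
    rintro ⟨i, j⟩ hij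
    simp only [Finset.mem_map, Finset.mem_sigma, Finset.mem_filter, Finset.mem_univ, true_and] at hij
    obtain ⟨⟨i', j'⟩, ⟨h1, h2, h3⟩, h4⟩ := hij
    simp at h4
    obtain ⟨rfl, rfl⟩ := h4
    simp only [Finset.mem_filter, Finset.mem_univ, true_and]
    refine ⟨?_, h3⟩
    rintro rfl
    exact h1 h2
  refine le_trans ?_ (Finset.card_le_card hsub)
  rw [Finset.card_map, Finset.card_sigma, mul_comm, outsideCount, ← smul_eq_mul]
  refine Finset.card_nsmul_le_sum _ _ _ fun i hi => ?_
  obtain ⟨v, hvL, hv, hT⟩ := h (w i) (by simpa using hi)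
  refine hT.trans (Finset.card_le_card fun j hj => ?_)
  simp only [Finset.mem_filter, Finset.mem_univ, true_and] at hj ⊢
  rw [hj]; exact ⟨hvL, hv⟩

/-- Let `S` be the set of values taken at least `T` times. If two of them are not orthogonal, there
are about `T²` defects. Otherwise `S` generates an isotropic subgroup `L`. If `L` has order below
`γ`, few positions lie outside it, since every value outside `L` is rare. If `L` is Lagrangian, it
is its own orthogonal, so each position outside it costs `T` defects. The three summands on the
right dominate the three cases. -/
lemma pow_pairDefect_le {W : Type*} [AddCommGroup W] [Fintype W] (P : W → AddSubgroup W)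
    (hsymm : ∀ v w, v ∈ P w → w ∈ P v) (γ : ℕ)
    (hcard : ∀ L, IsIsotropic P L → Nat.card L ≤ γ)
    (hperp : ∀ L, IsLagrangian P γ L → ∀ w, L ≤ P w → w ∈ L)
    {σ z : ℝ} (hσ : 0 < σ) (hσ1 : σ ≤ 1) (hz : 0 < z) (hz1 : z ≤ 1) {n : ℕ} (T : ℕ)
    (w : Fin n → W) (hw : ∀ L, IsLagrangian P γ L → outsideCount L w ≠ 0) :
    σ ^ pairDefect P w ≤ σ ^ (T ^ 2) / σ ^ n +
      ((∑ L : AddSubgroup W, if Nat.card L < γ then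
        z ^ outsideCount L w / z ^ (Fintype.card W * T) else 0) +
      ∑ L : AddSubgroup W, if Nat.card L = γ then
        (σ ^ T) ^ outsideCount L w - (if outsideCount L w = 0 then 1 else 0) else 0) := by
  have nn1 : 0 ≤ σ ^ (T ^ 2) / σ ^ n := by positivity
  have nn2' : ∀ L : AddSubgroup W, 0 ≤ (if Nat.card L < γ then
        z ^ outsideCount L w / z ^ (Fintype.card W * T) else 0) := by
    intro L; split_ifs <;> positivity
  have nn3' : ∀ L : AddSubgroup W, 0 ≤ (if Nat.card L = γ then
        (σ ^ T) ^ outsideCount L w - (if outsideCount L w = 0 then 1 else 0) else 0) := by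
    intro L
    split_ifs with h1 h2
    · rw [h2]; simp
    · rw [sub_zero]; positivity
    · exact le_rfl
  have nn2 := Finset.sum_nonneg fun L (_ : L ∈ Finset.univ) => nn2' L
  have nn3 := Finset.sum_nonneg fun L (_ : L ∈ Finset.univ) => nn3' L
  set S : Set W := {v | T ≤ (Finset.univ.filter fun i => w i = v).card} with hS
  by_cases h1 : ∃ v ∈ S, ∃ v' ∈ S, v' ∉ P v
  · obtain ⟨v, hv, v', hv', h⟩ := h1
    have h2 : T ^ 2 ≤ pairDefect P w + n :=
      le_trans (by rw [sq]; exact Nat.mul_le_mul hv hv') (card_fiber_mul_le_pairDefect P w h)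
    have h3 : σ ^ pairDefect P w ≤ σ ^ (T ^ 2) / σ ^ n := by
      rw [le_div_iff₀ (by positivity), ← pow_add]
      exact pow_le_pow_of_le_one hσ.le hσ1 h2
    linarith
  push Not at h1
  set L := AddSubgroup.closure S with hL
  have hLS : ∀ u, (∀ v ∈ S, v ∈ P u) → L ≤ P u := fun u hu =>
    (AddSubgroup.closure_le _).2 hu
  have hiso : IsIsotropic P L := by
    intro u hu
    refine hLS u fun v hv => hsymm _ _ ?_
    exact (hLS v fun v' hv' => h1 v hv v' hv') hu
  rcases (hcard L hiso).lt_or_eq with h2 | h2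
  · have h3 : outsideCount L w ≤ Fintype.card W * T := by
      refine outsideCount_le L w T fun v hv => ?_
      by_contra h
      exact hv (AddSubgroup.subset_closure (by simp only [hS, Set.mem_ofPred_eq]; omega))
    have h4 := Finset.single_le_sum (fun L (_ : L ∈ Finset.univ) => nn2' L) (Finset.mem_univ L)
    rw [if_pos h2] at h4
    have h5 : (1 : ℝ) ≤ z ^ outsideCount L w / z ^ (Fintype.card W * T) := by
      rw [le_div_iff₀ (by positivity), one_mul]
      exact pow_le_pow_of_le_one hz.le hz1 h3
    have h6 : σ ^ pairDefect P w ≤ 1 := pow_le_one₀ hσ.le hσ1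
    linarith
  · have hlag : IsLagrangian P γ L := ⟨hiso, h2⟩
    have h3 := mul_outsideCount_le_pairDefect P L w T (fun u hu => by
      by_contra hcon
      push Not at hcon
      refine hu (hperp L hlag u (hLS u fun v hv => ?_))
      by_contra hv2
      exact absurd (hcon v (AddSubgroup.subset_closure hv) hv2) (not_lt.2 hv))
    have h4 := Finset.single_le_sum (fun L (_ : L ∈ Finset.univ) => nn3' L) (Finset.mem_univ L)
    rw [if_pos h2, if_neg (hw L hlag), sub_zero, ← pow_mul] at h4
    have h5 : σ ^ pairDefect P w ≤ σ ^ (T * outsideCount L w) :=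
      pow_le_pow_of_le_one hσ.le hσ1 h3
    linarith

lemma outsideCount_eq_zero_iff {W : Type*} [AddCommGroup W] {n : ℕ} (L : AddSubgroup W)
    (w : Fin n → W) : outsideCount L w = 0 ↔ ∀ i, w i ∈ L := by
  simp [outsideCount, Finset.filter_eq_empty_iff]

lemma sum_outsideCount_eq_zero {W : Type*} [AddCommGroup W] [Fintype W] (L : AddSubgroup W)
    (n : ℕ) : ∑ w : Fin n → W, (if outsideCount L w = 0 then 1 else 0 : ℝ) =
      (Nat.card L : ℝ) ^ n := by
  have := sum_pow_outsideCount L n 0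
  rw [mul_zero, add_zero] at this
  rw [← this]
  refine Finset.sum_congr rfl fun w _ => ?_
  split_ifs with h
  · rw [h, pow_zero]
  · rw [zero_pow h]

/-- Each summand of the pointwise bound is a product over positions, so the sum over tuples is an
`n`-th power. Subtracting `γ ^ n` removes the tuples lying inside a Lagrangian; without this the
last term would be of the order of the main term. -/
lemma sum_pow_pairDefect_le {W : Type*} [AddCommGroup W] [Fintype W] (P : W → AddSubgroup W)
    (hsymm : ∀ v w, v ∈ P w → w ∈ P v) (γ : ℕ)
    (hcard : ∀ L, IsIsotropic P L → Nat.card L ≤ γ)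
    (hperp : ∀ L, IsLagrangian P γ L → ∀ w, L ≤ P w → w ∈ L)
    {σ z : ℝ} (hσ : 0 < σ) (hσ1 : σ ≤ 1) (hz : 0 < z) (hz1 : z ≤ 1) {n : ℕ} (T : ℕ) :
    ∑ w : Fin n → W, (if ∀ L, IsLagrangian P γ L → outsideCount L w ≠ 0 then
      σ ^ pairDefect P w else 0) ≤
      (Fintype.card W : ℝ) ^ n * (σ ^ (T ^ 2) / σ ^ n) +
      (Fintype.card (AddSubgroup W) *
        ((γ - 1 + Fintype.card W * z) ^ n / z ^ (Fintype.card W * T)) +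
      Fintype.card (AddSubgroup W) * ((γ + Fintype.card W * σ ^ T) ^ n - γ ^ n)) := by
  have nn3' : ∀ (w : Fin n → W) (L : AddSubgroup W), 0 ≤ (if Nat.card L = γ then
        (σ ^ T) ^ outsideCount L w - (if outsideCount L w = 0 then 1 else 0) else 0) := by
    intro w L
    split_ifs with h1 h2
    · rw [h2]; simp
    · rw [sub_zero]; positivity
    · exact le_rfl
  have key : ∀ w : Fin n → W, (if ∀ L, IsLagrangian P γ L → outsideCount L w ≠ 0 then
      σ ^ pairDefect P w else 0) ≤ σ ^ (T ^ 2) / σ ^ n +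
      ((∑ L : AddSubgroup W, if Nat.card L < γ then
        z ^ outsideCount L w / z ^ (Fintype.card W * T) else 0) +
      ∑ L : AddSubgroup W, if Nat.card L = γ then
        (σ ^ T) ^ outsideCount L w - (if outsideCount L w = 0 then 1 else 0) else 0) := by
    intro w
    split_ifs with h
    · exact pow_pairDefect_le P hsymm γ hcard hperp hσ hσ1 hz hz1 T w h
    · refine add_nonneg (by positivity) (add_nonneg (Finset.sum_nonneg fun L _ => ?_)
        (Finset.sum_nonneg fun L _ => nn3' w L))
      split_ifs <;> positivity
  refine (Finset.sum_le_sum fun w _ => key w).trans ?_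
  rw [Finset.sum_add_distrib, Finset.sum_add_distrib]
  have hcW : (0 : ℝ) ≤ Fintype.card W := by positivity
  refine add_le_add ?_ (add_le_add ?_ ?_)
  · rw [Finset.sum_const, Finset.card_univ, Fintype.card_fun, Fintype.card_fin]
    simp
  · rw [Finset.sum_comm, ← nsmul_eq_mul, ← Finset.card_univ]
    refine Finset.sum_le_card_nsmul _ _ _ fun L _ => ?_
    split_ifs with h
    · rw [← Finset.sum_div, sum_pow_outsideCount]
      have h' : (Nat.card L : ℝ) + 1 ≤ γ := by exact_mod_cast h
      have hL : (0 : ℝ) ≤ Nat.card L := by positivity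
      have hLW : (Nat.card L : ℝ) ≤ Fintype.card W := by
        rw [← Nat.card_eq_fintype_card]; exact_mod_cast AddSubgroup.card_le_card_addGroup L
      gcongr
      · have := mul_nonneg (sub_nonneg.2 hLW) hz.le; linarith
      · exact sub_le_self _ hL
    · simp only [Finset.sum_const_zero]
      have h1 : (0:ℝ) ≤ γ - 1 + Fintype.card W * z := by
        have : 1 ≤ γ := by
          have := hcard ⊥ (by intro w hw v hv; rw [AddSubgroup.mem_bot] at hv; rw [hv]; exact zero_mem _)
          simpa using this
        have : (1 : ℝ) ≤ γ := by exact_mod_cast this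
        have := mul_nonneg hcW hz.le
        linarith
      positivity
  · rw [Finset.sum_comm, ← nsmul_eq_mul, ← Finset.card_univ]
    refine Finset.sum_le_card_nsmul _ _ _ fun L _ => ?_
    have hg : (γ : ℝ) ≤ γ + Fintype.card W * σ ^ T := by
      have : 0 ≤ Fintype.card W * σ ^ T := by positivity
      linarith
    split_ifs with h
    · rw [Finset.sum_sub_distrib, sum_outsideCount_eq_zero, sum_pow_outsideCount, h]
      gcongr
      · have hLW : (γ : ℝ) ≤ Fintype.card W := by
          rw [← Nat.card_eq_fintype_card, ← h]; exact_mod_cast AddSubgroup.card_le_card_addGroup L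
        have := mul_nonneg (sub_nonneg.2 hLW) (by positivity : 0 ≤ σ ^ T)
        positivity
      · linarith [(Nat.cast_nonneg γ : (0 : ℝ) ≤ γ)]
    · simp only [Finset.sum_const_zero]
      rw [sub_nonneg]
      exact pow_le_pow_left₀ (by positivity) hg n
end Isotropic

/-! ### Three elementary limits for the threshold `n / D`. -/

lemma tendsto_natDiv_atTop {D : ℕ} (hD : 0 < D) : Tendsto (fun n : ℕ => n / D) atTop atTop :=
  tendsto_atTop.2 fun b => eventually_atTop.2 ⟨b * D, fun _ hn => (Nat.le_div_iff_mul_le hD).2 hn⟩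

/-- With `T = n / D` one has `n ≤ D + D * T`, so for `A ≥ 1` the expression is at most `A ^ D * (A ^
D * σ ^ T) ^ T`, whose inner base is eventually below `1 / 2`. -/
lemma tendsto_pow_mul_pow_sq {A σ : ℝ} (hA : 0 ≤ A) (hσ : 0 ≤ σ) (hσ1 : σ < 1) {D : ℕ}
    (hD : 0 < D) : Tendsto (fun n : ℕ => A ^ n * σ ^ ((n / D) ^ 2)) atTop (𝓝 0) := by
  set A' := max 1 A with hA'
  have h1 : (1 : ℝ) ≤ A' := le_max_left _ _
  have hT := tendsto_natDiv_atTop hD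
  have h2 : Tendsto (fun T : ℕ => A' ^ D * (A' ^ D * σ ^ T) ^ T) atTop (𝓝 0) := by
    have h3 : Tendsto (fun T : ℕ => A' ^ D * σ ^ T) atTop (𝓝 0) := by
      simpa using (tendsto_pow_atTop_nhds_zero_of_lt_one hσ hσ1).const_mul (A' ^ D)
    have h4 : Tendsto (fun T : ℕ => A' ^ D * (1 / 2 : ℝ) ^ T) atTop (𝓝 0) := by
      simpa using (tendsto_pow_atTop_nhds_zero_of_lt_one (by norm_num)
        (by norm_num : (1 / 2 : ℝ) < 1)).const_mul (A' ^ D)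
    refine squeeze_zero' (Eventually.of_forall fun T => by positivity) ?_ h4
    filter_upwards [h3.eventually (gt_mem_nhds (by norm_num : (0 : ℝ) < 1 / 2))] with T hT
    gcongr
  refine squeeze_zero (fun n => by positivity) (fun n => ?_) (h2.comp hT)
  simp only [Function.comp]
  have h5 : n ≤ D + D * (n / D) := by
    have := Nat.div_add_mod n D; have := Nat.mod_lt n hD; omega
  calc A ^ n * σ ^ ((n / D) ^ 2) ≤ A' ^ n * σ ^ ((n / D) ^ 2) := by
        gcongr; exact le_max_right _ _
    _ ≤ A' ^ (D + D * (n / D)) * σ ^ ((n / D) ^ 2) := by gcongr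
    _ = _ := by rw [mul_pow, pow_add, ← pow_mul, ← pow_mul, sq]; ring

lemma tendsto_pow_div_pow {r b : ℝ} (hr : 0 ≤ r) (hr1 : r ≤ 1) (hb : 0 ≤ b) {D : ℕ} (hD : 0 < D)
    (h : r ^ D * b < 1) : Tendsto (fun n : ℕ => r ^ n * b ^ (n / D)) atTop (𝓝 0) := by
  refine squeeze_zero (fun n => by positivity) (fun n => ?_)
    ((tendsto_pow_atTop_nhds_zero_of_lt_one (by positivity) h).comp (tendsto_natDiv_atTop hD))
  simp only [Function.comp]
  rw [mul_pow, ← pow_mul]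
  exact mul_le_mul_of_nonneg_right (pow_le_pow_of_le_one hr hr1 (Nat.mul_div_le n D))
    (by positivity)

/-- Since `(1 + x) ^ n ≤ exp (n * x)`, it is enough that `n` is at most linear in `T = n / D` while
`σ ^ T` decays geometrically. -/
lemma tendsto_one_add_pow_sub_one {σ κ : ℝ} (hσ : 0 ≤ σ) (hσ1 : σ < 1) (hκ : 0 ≤ κ) {D : ℕ}
    (hD : 0 < D) : Tendsto (fun n : ℕ => (1 + κ * σ ^ (n / D)) ^ n - 1) atTop (𝓝 0) := by
  have h2 : Tendsto (fun T : ℕ => Real.exp ((D + D * T : ℝ) * (κ * σ ^ T)) - 1) atTop (𝓝 0) := by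
    have h3 : Tendsto (fun T : ℕ => (D + D * T : ℝ) * (κ * σ ^ T)) atTop (𝓝 0) := by
      have h4 := (tendsto_pow_atTop_nhds_zero_of_lt_one hσ hσ1).const_mul (D * κ)
      have h5 := (tendsto_self_mul_const_pow_of_lt_one hσ hσ1).const_mul (D * κ)
      have h6 := h4.add h5
      simp only [mul_zero, add_zero] at h6
      refine h6.congr fun T => ?_
      ring
    have := (Real.continuous_exp.tendsto 0).comp h3
    simpa using this.sub_const 1
  refine squeeze_zero (fun n => ?_) (fun n => ?_) (h2.comp (tendsto_natDiv_atTop hD))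
  · rw [sub_nonneg]; exact one_le_pow₀ (by have : 0 ≤ κ * σ ^ (n / D) := by positivity
                                           linarith)
  · simp only [Function.comp]
    have h5 : n ≤ D + D * (n / D) := by
      have := Nat.div_add_mod n D; have := Nat.mod_lt n hD; omega
    have h5' : (n : ℝ) ≤ D + D * (n / D : ℕ) := by exact_mod_cast h5
    have hp : 0 ≤ κ * σ ^ (n / D) := by positivity
    gcongr
    calc (1 + κ * σ ^ (n / D)) ^ n ≤ (Real.exp (κ * σ ^ (n / D))) ^ n := by
          gcongr; rw [add_comm]; exact Real.add_one_le_exp _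
      _ = Real.exp (n * (κ * σ ^ (n / D))) := by rw [← Real.exp_nat_mul]
      _ ≤ _ := by gcongr

/-! ### Negligibility of tuples outside all Lagrangians. -/

section Isotropic
open scoped Classical

/-- Tuples not contained in a Lagrangian subgroup have negligible weight. -/
lemma tendsto_sum_pow_pairDefect {W : Type*} [AddCommGroup W] [Fintype W] (P : W → AddSubgroup W)
    (hsymm : ∀ v w, v ∈ P w → w ∈ P v) (γ : ℕ)
    (hcard : ∀ L, IsIsotropic P L → Nat.card L ≤ γ)
    (hperp : ∀ L, IsLagrangian P γ L → ∀ w, L ≤ P w → w ∈ L)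
    {σ : ℝ} (hσ : 0 < σ) (hσ1 : σ < 1) :
    Tendsto (fun n : ℕ => (∑ w : Fin n → W,
      (if ∀ L, IsLagrangian P γ L → outsideCount L w ≠ 0 then σ ^ pairDefect P w else 0)) /
        (γ : ℝ) ^ n) atTop (𝓝 0) := by
  have hγ : 1 ≤ γ := by
    have := hcard ⊥ (by intro w hw v hv; rw [AddSubgroup.mem_bot] at hv; rw [hv]; exact zero_mem _)
    simpa using this
  have hγ' : (1 : ℝ) ≤ γ := by exact_mod_cast hγ
  have hK : (1 : ℝ) ≤ Fintype.card W := by exact_mod_cast Fintype.card_pos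
  set K : ℝ := (Fintype.card W : ℝ)
  -- This makes `K * z = 1 / 2`, so a subgroup of order at most `γ - 1` costs at most `γ - 1 / 2`
  -- per position, strictly less than `γ`.
  obtain ⟨z, hz⟩ : ∃ z : ℝ, z = 1 / (2 * K) := ⟨_, rfl⟩
  have hz0 : 0 < z := by rw [hz]; positivity
  have hz1 : z ≤ 1 := by
    rw [hz, div_le_one (by positivity)]; linarith
  have hKz : K * z = 1 / 2 := by rw [hz]; field_simp
  set r : ℝ := (γ - 1 + K * z) / γ with hr
  have hr0 : 0 ≤ r := by rw [hr, hKz]; exact div_nonneg (by linarith) (by linarith)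
  have hr1 : r < 1 := by rw [hr, hKz, div_lt_one (by linarith)]; linarith
  set b : ℝ := (1 / z) ^ (Fintype.card W) with hb
  have hb0 : 0 < b := by positivity
  -- Each unit of the threshold `n / D` loses a factor `b`, while `D` positions gain `r ^ D`; for
  -- large `D` the gain wins.
  obtain ⟨D, hD0, hD⟩ : ∃ D : ℕ, 0 < D ∧ r ^ D * b < 1 := by
    have : Tendsto (fun D : ℕ => r ^ D * b) atTop (𝓝 0) := by
      simpa using (tendsto_pow_atTop_nhds_zero_of_lt_one hr0 hr1).mul_const b
    obtain ⟨D, h1, h2⟩ := ((this.eventually (gt_mem_nhds one_pos)).and (eventually_gt_atTop 0)).exists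
    exact ⟨D, h2, h1⟩
  set s : ℝ := (Fintype.card (AddSubgroup W) : ℝ)
  have lim := ((tendsto_pow_mul_pow_sq (A := K / (σ * γ)) (by positivity) hσ.le hσ1 hD0).add
    (((tendsto_pow_div_pow hr0 hr1.le hb0.le hD0 hD).const_mul s).add
    ((tendsto_one_add_pow_sub_one hσ.le hσ1 (κ := K / γ) (by positivity) hD0).const_mul s)))
  simp only [mul_zero, add_zero] at lim
  refine squeeze_zero (fun n => ?_) (fun n => ?_) lim
  · refine div_nonneg (Finset.sum_nonneg fun w _ => ?_) (by positivity)
    split_ifs <;> positivity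
  · refine (div_le_div_of_nonneg_right (sum_pow_pairDefect_le P hsymm γ hcard hperp hσ hσ1.le hz0 hz1
      (n / D)) (by positivity)).trans (le_of_eq ?_)
    have hγn : (γ : ℝ) ^ n ≠ 0 := by positivity
    rw [add_div, add_div, show (Fintype.card W : ℝ) = K from rfl,
      show (Fintype.card (AddSubgroup W) : ℝ) = s from rfl]
    congr 1
    · rw [div_pow, mul_pow]; field_simp
    congr 1
    · rw [hr, hb, div_pow, ← pow_mul, div_pow, one_pow, mul_comm K z]; field_simp
    · have : 1 + K / γ * σ ^ (n / D) = (γ + K * σ ^ (n / D)) / γ := by field_simp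
      rw [this, div_pow, mul_comm K]; field_simp
end Isotropic

/-! ### Gauss sums of alternating pairings twisted by an alternating matrix. -/

section GaussSum
open scoped Classical

/-- The quadratic phase attached to an alternating pairing and an alternating matrix. -/
noncomputable def quadPhase {L : Type*} [AddCommGroup L] {a n : ℕ} [Module (ZMod a) L]
    (ψ : L →+ AddChar L ℂ) (C : Matrix (Fin n) (Fin n) (ZMod a)) (w : Fin n → L) : ℂ :=
  ∏ i, ∏ j, if i < j then ψ (w i) (-(C i j • w j)) else 1

lemma AddChar.alternating_swap {L : Type*} [AddCommGroup L] {ψ : L →+ AddChar L ℂ}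
    (h : ∀ x, ψ x x = 1) (x y : L) : ψ x y = ψ y (-x) := by
  have h1 := h (x + y)
  simp only [map_add, AddChar.add_apply, AddChar.map_add_eq_mul, h, one_mul, mul_one] at h1
  rw [AddChar.map_neg_eq_inv]
  exact eq_inv_of_mul_eq_one_left (by rwa [mul_comm] at h1)

/-- The phase is quadratic with polar form `ψ (C u) w`. The signs of the alternating `ψ` and the
alternating `C` cancel, so the two ordered halves `i < j` and `j < i` of the polar form fit
together. -/
lemma quadPhase_add {L : Type*} [AddCommGroup L] {a n : ℕ} [Module (ZMod a) L]
    {ψ : L →+ AddChar L ℂ} (h : ∀ x, ψ x x = 1) {C : Matrix (Fin n) (Fin n) (ZMod a)}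
    (hC : C.IsAlternating) (w u : Fin n → L) :
    quadPhase ψ C (w + u) = quadPhase ψ C w * quadPhase ψ C u *
      ∏ i, ψ (∑ j, C i j • u j) (w i) := by
  have hC1 : ∀ i j, C j i = - C i j := fun i j => by
    have := congrFun (congrFun hC.1 i) j; simpa using this
  have h1 : ∏ i, ψ (∑ j, C i j • u j) (w i) = (∏ i, ∏ j, if i < j then ψ (w i) (-(C i j • u j)) else 1) *
      ∏ i, ∏ j, if i < j then ψ (u i) (-(C i j • w j)) else 1 := by
    rw [Finset.prod_comm (f := fun i j => if i < j then ψ (u i) (-(C i j • w j)) else 1),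
      ← Finset.prod_mul_distrib]
    refine Finset.prod_congr rfl fun i _ => ?_
    rw [map_sum, AddChar.sum_apply, ← Finset.prod_mul_distrib]
    refine Finset.prod_congr rfl fun j _ => ?_
    have e1 : ψ (C i j • u j) (w i) = ψ (w i) (-(C i j • u j)) := AddChar.alternating_swap h _ _
    rcases lt_trichotomy i j with hij | rfl | hij
    · rw [if_pos hij, if_neg hij.not_gt, mul_one, e1]
    · rw [if_neg (lt_irrefl _), hC.2 i, zero_smul, map_zero, AddChar.zero_apply, one_mul,
        if_neg (lt_irrefl _)]
    · rw [if_neg hij.not_gt, if_pos hij, one_mul, hC1 i j, neg_smul, neg_neg]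
      have e2 : ∀ (c : ZMod a) (x : L), ψ (c • x) = (ψ x).compAddMonoidHom
          (DistribSMul.toAddMonoidHom L c) := by
        intro c x
        ext y
        rw [AddChar.compAddMonoidHom_apply]
        have hc : c • x = (c.cast : ℤ) • x := by
          rw [← Int.cast_smul_eq_zsmul (ZMod a), ZMod.intCast_zmod_cast]
        have hc' : c • y = (c.cast : ℤ) • y := by
          rw [← Int.cast_smul_eq_zsmul (ZMod a), ZMod.intCast_zmod_cast]
        rw [DistribSMul.toAddMonoidHom_apply, hc, hc', map_zsmul, AddChar.zsmul_apply,
          AddChar.map_zsmul_eq_zpow]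
      rw [e2]; rfl
  rw [h1, quadPhase, quadPhase, quadPhase, ← Finset.prod_mul_distrib, ← Finset.prod_mul_distrib,
    ← Finset.prod_mul_distrib]
  refine Finset.prod_congr rfl fun i _ => ?_
  rw [← Finset.prod_mul_distrib, ← Finset.prod_mul_distrib, ← Finset.prod_mul_distrib]
  refine Finset.prod_congr rfl fun j _ => ?_
  split_ifs
  · rw [Pi.add_apply, Pi.add_apply, map_add, AddChar.add_apply, smul_add, neg_add,
      AddChar.map_add_eq_mul, AddChar.map_add_eq_mul]
    ring
  · simp

lemma norm_quadPhase {L : Type*} [AddCommGroup L] [Finite L] {a n : ℕ} [Module (ZMod a) L]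
    (ψ : L →+ AddChar L ℂ) (C : Matrix (Fin n) (Fin n) (ZMod a)) (w : Fin n → L) :
    ‖quadPhase ψ C w‖ = 1 := by
  rw [quadPhase, norm_prod]
  refine Finset.prod_eq_one fun i _ => ?_
  rw [norm_prod]
  refine Finset.prod_eq_one fun j _ => ?_
  split_ifs
  · exact AddChar.norm_apply _ _
  · simp

/-- Weyl differencing: expand the square and substitute `v = w + u`. For fixed `u` the sum over `w`
is a product of complete character sums, which vanishes unless every coordinate of `C u` pairs
trivially with `L`. -/
lemma norm_sum_quadPhase_sq_le {L : Type*} [AddCommGroup L] [Fintype L] {a n : ℕ}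
    [Module (ZMod a) L] {ψ : L →+ AddChar L ℂ} (h : ∀ x, ψ x x = 1)
    {C : Matrix (Fin n) (Fin n) (ZMod a)} (hC : C.IsAlternating) :
    ‖∑ w : Fin n → L, quadPhase ψ C w‖ ^ 2 ≤ (Fintype.card L : ℝ) ^ n *
      (Finset.univ.filter fun u : Fin n → L => ∀ i, ψ (∑ j, C i j • u j) = 0).card := by
  have h1 : (∑ w : Fin n → L, quadPhase ψ C w) * (starRingEnd ℂ) (∑ w : Fin n → L, quadPhase ψ C w) =
      ∑ u : Fin n → L, quadPhase ψ C u * ∏ i, ∑ x : L, ψ (∑ j, C i j • u j) x := by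
    rw [map_sum, Finset.sum_mul_sum, Finset.sum_comm]
    have : ∀ w : Fin n → L, ∑ v, quadPhase ψ C v * (starRingEnd ℂ) (quadPhase ψ C w) =
        ∑ u, quadPhase ψ C u * ∏ i, ψ (∑ j, C i j • u j) (w i) := by
      intro w
      rw [← Equiv.sum_comp (Equiv.addLeft w)]
      refine Finset.sum_congr rfl fun u _ => ?_
      rw [Equiv.coe_addLeft, quadPhase_add h hC]
      have : quadPhase ψ C w * (starRingEnd ℂ) (quadPhase ψ C w) = 1 := by
        rw [Complex.mul_conj, Complex.normSq_eq_norm_sq, norm_quadPhase]; simp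
      linear_combination (quadPhase ψ C u * ∏ i, ψ (∑ j, C i j • u j) (w i)) * this
    rw [Finset.sum_congr rfl fun w _ => this w, Finset.sum_comm]
    refine Finset.sum_congr rfl fun u _ => ?_
    rw [← Finset.mul_sum, Fintype.prod_sum]
  have h2 : ‖∑ w : Fin n → L, quadPhase ψ C w‖ ^ 2 = ‖∑ u : Fin n → L, quadPhase ψ C u *
      ∏ i, ∑ x : L, ψ (∑ j, C i j • u j) x‖ := by
    rw [← h1, norm_mul, RCLike.norm_conj, sq]
  rw [h2]
  refine (norm_sum_le _ _).trans ?_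
  rw [mul_comm, ← nsmul_eq_mul, ← Finset.sum_const, Finset.sum_filter]
  refine Finset.sum_le_sum fun u _ => ?_
  rw [norm_mul, norm_quadPhase, one_mul, norm_prod]
  split_ifs with hu
  · rw [Finset.prod_congr rfl (g := fun _ => (Fintype.card L : ℝ))]
    · simp
    · intro i _
      rw [hu i]; simp
  · push Not at hu
    obtain ⟨i, hi⟩ := hu
    rw [Finset.prod_eq_zero (Finset.mem_univ i)]
    rw [AddChar.sum_eq_ite, if_neg hi, norm_zero]

lemma exists_prime_orderOf_pairing {L : Type*} [AddCommGroup L] {a : ℕ} [NeZero a]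
    [Module (ZMod a) L] {ψ : L →+ AddChar L ℂ} (hψ : ψ ≠ 0) :
    ∃ p : ℕ, p.Prime ∧ p ∣ a ∧ ∃ x y : L, orderOf (ψ x y) = p := by
  obtain ⟨x, hx⟩ := DFunLike.ne_iff.1 hψ
  obtain ⟨y, hy⟩ := AddChar.ne_zero_iff.1 hx
  have h1 : ψ x y ^ a = 1 := by
    rw [← AddChar.map_nsmul_eq_pow, ← Nat.cast_smul_eq_nsmul (ZMod a), ZMod.natCast_self, zero_smul,
      AddChar.map_zero_eq_one]
  have hd : orderOf (ψ x y) ∣ a := orderOf_dvd_of_pow_eq_one h1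
  have hd1 : orderOf (ψ x y) ≠ 1 := by rwa [Ne, orderOf_eq_one_iff]
  obtain ⟨p, hp, hpd⟩ := Nat.exists_prime_and_dvd hd1
  -- Multiplying `x` by the order divided by `p` raises `ψ x y` to that power and cuts its order
  -- down to `p`.
  refine ⟨p, hp, hpd.trans hd, (orderOf (ψ x y) / p) • x, y, ?_⟩
  rw [map_nsmul, AddChar.nsmul_apply]
  have h0 : orderOf (ψ x y) ≠ 0 := fun h0 => NeZero.ne a (by rw [h0] at hd; exact zero_dvd_iff.1 hd)
  exact orderOf_pow_orderOf_div h0 hpd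

/-- The set counted is the kernel of `u ↦ ψ (C u)`. On test vectors `u j = t j • x`, evaluation at
`y` gives the powers of `ψ x y` with exponents `C t`, which determine `C t` modulo `p`. Hence the
image has at least `p ^ rank` elements. -/
lemma pow_rank_mul_card_le {L : Type*} [AddCommGroup L] [Fintype L] {a : ℕ} [NeZero a]
    [Module (ZMod a) L] {ψ : L →+ AddChar L ℂ} {p : ℕ} (hp : p.Prime) (hpa : p ∣ a) {x y : L}
    (hxy : orderOf (ψ x y) = p) {n : ℕ} (C : Matrix (Fin n) (Fin n) (ZMod a)) :
    p ^ (C.map (ZMod.castHom hpa (ZMod p))).rank *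
      (Finset.univ.filter fun u : Fin n → L => ∀ i, ψ (∑ j, C i j • u j) = 0).card ≤
        Fintype.card L ^ n := by
  have := Fact.mk hp
  set Θ : (Fin n → L) →+ (Fin n → AddChar L ℂ) :=
    { toFun := fun u i => ψ (∑ j, C i j • u j)
      map_zero' := by ext1 i; simp
      map_add' := fun u v => by ext1 i; simp [Finset.sum_add_distrib, smul_add] } with hΘ
  set Cp := C.map (ZMod.castHom hpa (ZMod p)) with hCp
  have hker : Nat.card Θ.ker =
      (Finset.univ.filter fun u : Fin n → L => ∀ i, ψ (∑ j, C i j • u j) = 0).card := by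
    rw [Nat.card_eq_fintype_card, Fintype.card_subtype]
    congr 1
    ext u
    simp [AddMonoidHom.mem_ker, hΘ, funext_iff]
  have htot : Nat.card Θ.range * Nat.card Θ.ker = Fintype.card L ^ n := by
    have h1 := AddSubgroup.card_eq_card_quotient_mul_card_addSubgroup Θ.ker
    rw [Nat.card_congr (QuotientAddGroup.quotientKerEquivRange Θ).toEquiv] at h1
    rw [← h1, Nat.card_eq_fintype_card, Fintype.card_fun, Fintype.card_fin]
  rw [← hker, ← htot]
  refine Nat.mul_le_mul_right _ ?_
  have hrank : p ^ Cp.rank = Nat.card (LinearMap.range Cp.mulVecLin) := by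
    rw [Module.natCard_eq_pow_finrank (K := ZMod p), Nat.card_zmod]; rfl
  rw [hrank]
  choose t ht using fun r : LinearMap.range Cp.mulVecLin => r.2
  refine Nat.card_le_card_of_injective
    (fun r => (⟨Θ fun j => (t r j).val • x, _, rfl⟩ : Θ.range)) fun r r' hrr => ?_
  have hrr' : ∀ i, ψ (∑ j, C i j • (t r j).val • x) y = ψ (∑ j, C i j • (t r' j).val • x) y := by
    intro i
    have := congrFun (congrArg Subtype.val hrr) i
    exact DFunLike.congr_fun this y
  have hval : ∀ (r) (i), ψ (∑ j, C i j • (t r j).val • x) y =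
      ψ x y ^ (∑ j, (C i j).val * (t r j).val) := by
    intro r i
    have : ∀ j, C i j • (t r j).val • x = ((C i j).val * (t r j).val) • x := by
      intro j
      conv_lhs => rw [← ZMod.natCast_zmod_val (C i j), Nat.cast_smul_eq_nsmul, smul_smul]
    rw [Finset.sum_congr rfl fun j _ => this j, ← Finset.sum_smul, map_nsmul, AddChar.nsmul_apply]
  apply Subtype.ext
  rw [← ht r, ← ht r']
  ext i
  have h1 := hrr' i
  obtain ⟨U, hU⟩ := AddChar.val_isUnit (ψ x) y
  rw [hval, hval, ← hU, ← Units.val_pow_eq_pow_val, ← Units.val_pow_eq_pow_val, Units.val_inj,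
    pow_inj_mod, ← orderOf_units, hU, hxy] at h1
  have h2 := (ZMod.natCast_eq_natCast_iff' _ _ p).2 h1
  have h3 : ∀ r, Cp.mulVecLin (t r) i = ((∑ j, (C i j).val * (t r j).val : ℕ) : ZMod p) := by
    intro r
    rw [Matrix.mulVecLin_apply, Matrix.mulVec, dotProduct]
    push_cast
    refine Finset.sum_congr rfl fun j _ => ?_
    rw [ZMod.natCast_zmod_val, hCp, Matrix.map_apply]
    congr 1
    conv_lhs => rw [← ZMod.natCast_zmod_val (C i j)]
    rw [map_natCast]
  rw [h3, h3, h2]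

/-- Quadratic Gauss sums attached to a nontrivial alternating pairing are small if the matrix has
large rank. -/
lemma exists_prime_norm_sum_quadPhase_sq_le {L : Type*} [AddCommGroup L] [Fintype L] {a : ℕ}
    [NeZero a] [Module (ZMod a) L] {ψ : L →+ AddChar L ℂ} (hψ : ψ ≠ 0) (h : ∀ x, ψ x x = 1) :
    ∃ p : ℕ, p.Prime ∧ ∃ hpa : p ∣ a, ∀ (n : ℕ) (C : Matrix (Fin n) (Fin n) (ZMod a)),
      C.IsAlternating → (‖∑ w : Fin n → L, quadPhase ψ C w‖ / (Fintype.card L : ℝ) ^ n) ^ 2 ≤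
        ((p : ℝ)⁻¹) ^ (C.map (ZMod.castHom hpa (ZMod p))).rank := by
  obtain ⟨p, hp, hpa, x, y, hxy⟩ := exists_prime_orderOf_pairing (a := a) hψ
  refine ⟨p, hp, hpa, fun n C hC => ?_⟩
  have h1 := norm_sum_quadPhase_sq_le h hC
  have h2 := pow_rank_mul_card_le hp hpa hxy C
  have hp0 : (0 : ℝ) < p := by exact_mod_cast hp.pos
  have hL : (0 : ℝ) < (Fintype.card L : ℝ) ^ n := by
    have : 0 < Fintype.card L := Fintype.card_pos
    positivity
  have h2' : (p : ℝ) ^ (C.map (ZMod.castHom hpa (ZMod p))).rank *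
      (Finset.univ.filter fun u : Fin n → L => ∀ i, ψ (∑ j, C i j • u j) = 0).card ≤
        (Fintype.card L : ℝ) ^ n := by exact_mod_cast h2
  generalize (Finset.univ.filter fun u : Fin n → L => ∀ i, ψ (∑ j, C i j • u j) = 0).card = N
    at h1 h2'
  rw [div_pow, div_le_iff₀ (by positivity), inv_pow, ← div_eq_inv_mul, le_div_iff₀ (by positivity)]
  calc _ ≤ (Fintype.card L : ℝ) ^ n * N * (p : ℝ) ^ (C.map (ZMod.castHom hpa (ZMod p))).rank :=
        mul_le_mul_of_nonneg_right h1 (by positivity)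
    _ = (Fintype.card L : ℝ) ^ n * ((p : ℝ) ^ (C.map (ZMod.castHom hpa (ZMod p))).rank * N) := by ring
    _ ≤ _ := by rw [sq]; exact mul_le_mul_of_nonneg_left h2' hL.le
end GaussSum

/-! ### The symmetric pairing on `G × Ĝ` and its Lagrangian subgroups. -/

section Pairing
open scoped Classical

/-- The character `(f', c') ↦ c f'` attached to `(f, c)`. -/
noncomputable def leftPairing (G : Type*) [AddCommGroup G] :
    (G × AddChar G ℂ) →+ AddChar (G × AddChar G ℂ) ℂ where
  toFun w := w.2.compAddMonoidHom (AddMonoidHom.fst _ _)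
  map_zero' := by ext; simp
  map_add' _ _ := by ext; simp

lemma leftPairing_apply {G : Type*} [AddCommGroup G] (w v : G × AddChar G ℂ) :
    leftPairing G w v = w.2 v.1 := rfl

/-- The character `(f', c') ↦ c f' * c' f` attached to `(f, c)`. -/
noncomputable def symmPairing {G : Type*} [AddCommGroup G] (w : G × AddChar G ℂ) :
    AddChar (G × AddChar G ℂ) ℂ :=
  leftPairing G w + (AddChar.doubleDualEmb w.1).compAddMonoidHom (AddMonoidHom.snd G (AddChar G ℂ))

/-- The elements orthogonal to `w` for the symmetrized pairing. -/
noncomputable def perpSubgroup {G : Type*} [AddCommGroup G] (w : G × AddChar G ℂ) :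
    AddSubgroup (G × AddChar G ℂ) where
  carrier := {v | w.2 v.1 * v.2 w.1 = 1}
  zero_mem' := by simp
  add_mem' := fun {v v'} h h' => by
    simp only [Set.mem_ofPred_eq] at h h' ⊢
    rw [Prod.fst_add, Prod.snd_add, AddChar.map_add_eq_mul, AddChar.add_apply]
    calc _ = (w.2 v.1 * v.2 w.1) * (w.2 v'.1 * v'.2 w.1) := by ring
      _ = 1 := by rw [h, h', one_mul]
  neg_mem' := fun {v} h => by
    simp only [Set.mem_ofPred_eq] at h ⊢
    rw [Prod.fst_neg, Prod.snd_neg, AddChar.map_neg_eq_inv, AddChar.neg_apply', ← mul_inv, h, inv_one]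

lemma mem_perpSubgroup {G : Type*} [AddCommGroup G] {w v : G × AddChar G ℂ} :
    v ∈ perpSubgroup w ↔ w.2 v.1 * v.2 w.1 = 1 := Iff.rfl

lemma mem_perpSubgroup_symm {G : Type*} [AddCommGroup G] (v w : G × AddChar G ℂ)
    (h : v ∈ perpSubgroup w) : w ∈ perpSubgroup v := by
  rw [mem_perpSubgroup] at h ⊢
  rwa [mul_comm]

lemma sum_subgroup_addChar {W : Type*} [AddCommGroup W] [Fintype W] (L : AddSubgroup W)
    (χ : AddChar W ℂ) : ∑ v : L, χ v = if ∀ v ∈ L, χ v = 1 then (Nat.card L : ℂ) else 0 := by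
  have h := AddChar.sum_eq_ite (χ.compAddMonoidHom L.subtype)
  simp only [AddChar.compAddMonoidHom_apply, AddSubgroup.coe_subtype] at h
  rw [h, Nat.card_eq_fintype_card]
  congr 1
  rw [AddChar.eq_zero_iff, Subtype.forall]
  rfl

/-- The symmetric pairing is perfect on a group of order `|G|²`. Summing it over all `w` and all `v
∈ L` in both orders gives the two sides. -/
lemma card_mul_card_perp {G : Type*} [AddCommGroup G] [Fintype G]
    (L : AddSubgroup (G × AddChar G ℂ)) :
    Nat.card L * (Finset.univ.filter fun w : G × AddChar G ℂ => L ≤ perpSubgroup w).card =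
      Fintype.card G ^ 2 := by
  have h1 : ∑ w : G × AddChar G ℂ, ∑ v : L, symmPairing w (v : G × AddChar G ℂ) =
      (Nat.card L : ℂ) * (Finset.univ.filter fun w : G × AddChar G ℂ => L ≤ perpSubgroup w).card := by
    rw [mul_comm, ← nsmul_eq_mul, ← Finset.sum_const, Finset.sum_filter]
    exact Finset.sum_congr rfl fun w _ => (sum_subgroup_addChar L _).trans (if_congr Iff.rfl rfl rfl)
  have h2 : ∑ w : G × AddChar G ℂ, ∑ v : L, symmPairing w (v : G × AddChar G ℂ) =
      (Fintype.card G : ℂ) ^ 2 := by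
    rw [Finset.sum_comm]
    have : ∀ v : L, ∑ w : G × AddChar G ℂ, symmPairing w (v : G × AddChar G ℂ) =
      if v = 0 then (Fintype.card G : ℂ) ^ 2 else 0 := by
      intro v
      have e : ∀ w : G × AddChar G ℂ, symmPairing w (v : G × AddChar G ℂ) =
          v.1.2 w.1 * w.2 v.1.1 := fun w => mul_comm _ _
      rw [Finset.sum_congr rfl fun w _ => e w, Fintype.sum_prod_type]
      simp_rw [← Finset.mul_sum]
      rw [← Finset.sum_mul, AddChar.sum_apply_eq_ite, AddChar.sum_eq_ite]
      have : v = 0 ↔ (v.1.1 = 0 ∧ v.1.2 = 0) := by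
        rw [← Prod.mk_eq_zero, Subtype.ext_iff]; rfl
      by_cases h1 : v.1.1 = 0 <;> by_cases h2 : v.1.2 = 0 <;> simp [h1, h2, this, sq]
    rw [Finset.sum_congr rfl fun v _ => this v, Finset.sum_ite_eq' Finset.univ (0 : L),
      if_pos (Finset.mem_univ _)]
  have := h1.symm.trans h2
  exact_mod_cast this

lemma card_le_of_isIsotropic {G : Type*} [AddCommGroup G] [Fintype G]
    (L : AddSubgroup (G × AddChar G ℂ)) (hL : IsIsotropic perpSubgroup L) :
    Nat.card L ≤ Fintype.card G := by
  have h1 : Nat.card L ≤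
      (Finset.univ.filter fun w : G × AddChar G ℂ => L ≤ perpSubgroup w).card := by
    rw [Nat.card_eq_fintype_card, Fintype.card_subtype]
    refine Finset.card_le_card fun w hw => ?_
    simp only [Finset.mem_filter, Finset.mem_univ, true_and] at hw ⊢
    exact hL w hw
  have h2 := Nat.mul_le_mul_left (Nat.card L) h1
  rw [card_mul_card_perp, ← sq] at h2
  exact (Nat.pow_le_pow_iff_left two_ne_zero).1 h2

/-- A Lagrangian lies in its orthogonal, and both have order `|G|`. -/
lemma mem_of_isLagrangian {G : Type*} [AddCommGroup G] [Fintype G]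
    (L : AddSubgroup (G × AddChar G ℂ)) (hL : IsLagrangian perpSubgroup (Fintype.card G) L)
    (w : G × AddChar G ℂ) (hw : L ≤ perpSubgroup w) : w ∈ L := by
  have h1 := card_mul_card_perp L
  rw [hL.2, sq] at h1
  have h2 := Nat.eq_of_mul_eq_mul_left Fintype.card_pos h1
  have h3 : (Finset.univ.filter fun w => w ∈ L) =
      (Finset.univ.filter fun w : G × AddChar G ℂ => L ≤ perpSubgroup w) := by
    refine Finset.eq_of_subset_of_card_le (fun w hw => ?_) ?_
    · simp only [Finset.mem_filter, Finset.mem_univ, true_and] at hw ⊢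
      exact hL.1 w hw
    · rw [h2, ← hL.2, Nat.card_eq_fintype_card, Fintype.card_subtype]
  have h4 : w ∈ (Finset.univ.filter fun w : G × AddChar G ℂ => L ≤ perpSubgroup w) := by simpa using hw
  rw [← h3] at h4
  simpa using h4

/-- The characters that are trivial on a subgroup. -/
noncomputable def annihilatorSubgroup {G : Type*} [AddCommGroup G] (A : AddSubgroup G) :
    AddSubgroup (AddChar G ℂ) where
  carrier := {c | ∀ f ∈ A, c f = 1}
  zero_mem' := by simp
  add_mem' := fun {c c'} h h' f hf => by rw [AddChar.add_apply, h f hf, h' f hf, one_mul]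
  neg_mem' := fun {c} h f hf => by rw [AddChar.neg_apply', h f hf, inv_one]

lemma card_mul_card_annihilator {G : Type*} [AddCommGroup G] [Fintype G] (A : AddSubgroup G) :
    Nat.card A * Nat.card (annihilatorSubgroup A) = Fintype.card G := by
  have h1 : ∑ c : AddChar G ℂ, ∑ v : A, c v =
      (Nat.card A : ℂ) * Nat.card (annihilatorSubgroup A) := by
    rw [Nat.card_eq_fintype_card (α := annihilatorSubgroup A), Fintype.card_subtype, mul_comm,
      ← nsmul_eq_mul, ← Finset.sum_const, Finset.sum_filter]
    refine Finset.sum_congr rfl fun w _ => (sum_subgroup_addChar A _).trans ?_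
    congr 1
  have h2 : ∑ c : AddChar G ℂ, ∑ v : A, c v = (Fintype.card G : ℂ) := by
    rw [Finset.sum_comm]
    simp_rw [AddChar.sum_apply_eq_ite]
    simp
  exact_mod_cast h1.symm.trans h2

/-- If `c(f') = 1` throughout `L`, the characters occurring in `L` annihilate the first projection
`A` of `L`. So `L` lies in `A × A^⊥`, which already has order `|G|`, and equality follows. -/
lemma card_lagrangian_leftPairing_trivial (G : Type*) [AddCommGroup G] [Fintype G] :
    (Finset.univ.filter fun L : AddSubgroup (G × AddChar G ℂ) =>
      IsLagrangian perpSubgroup (Fintype.card G) L ∧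
        ∀ w ∈ L, ∀ v ∈ L, leftPairing G w v = 1).card = Nat.card (AddSubgroup G) := by
  rw [Nat.card_eq_fintype_card (α := AddSubgroup G), ← Finset.card_univ (α := AddSubgroup G)]
  symm
  refine Finset.card_bij (fun A _ => A.prod (annihilatorSubgroup A)) (fun A _ => ?_)
    (fun A _ B _ h => ?_) fun L hL => ?_
  · simp only [Finset.mem_filter, Finset.mem_univ, true_and]
    have h : ∀ w ∈ A.prod (annihilatorSubgroup A), ∀ v ∈ A.prod (annihilatorSubgroup A),
        leftPairing G w v = 1 := fun w hw v hv => hw.2 _ hv.1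
    refine ⟨⟨fun w hw v hv => ?_, ?_⟩, h⟩
    · rw [mem_perpSubgroup, ← leftPairing_apply, ← leftPairing_apply, h w hw v hv, h v hv w hw,
        one_mul]
    · rw [← card_mul_card_annihilator A, Nat.card_congr (AddSubgroup.prodEquiv _ _).toEquiv,
        Nat.card_prod]
  · have := congrArg (AddSubgroup.map (AddMonoidHom.fst G (AddChar G ℂ))) h
    ext f
    have h1 : ∀ D : AddSubgroup G, f ∈ (D.prod (annihilatorSubgroup D)).map
        (AddMonoidHom.fst G (AddChar G ℂ)) ↔ f ∈ D := by
      intro D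
      rw [AddSubgroup.mem_map]
      constructor
      · rintro ⟨x, hx, rfl⟩; exact hx.1
      · intro hf; exact ⟨(f, 0), ⟨hf, zero_mem _⟩, rfl⟩
    have h2 := congrArg (f ∈ ·) this
    simp only [h1] at h2
    rw [h2]
  · simp only [Finset.mem_filter, Finset.mem_univ, true_and] at hL
    refine ⟨L.map (AddMonoidHom.fst G (AddChar G ℂ)), Finset.mem_univ _, ?_⟩
    symm
    refine AddSubgroup.eq_of_le_of_card_ge (fun w hw => ⟨⟨w, hw, rfl⟩, ?_⟩) ?_
    · rintro f ⟨v, hv, rfl⟩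
      exact hL.2 w hw v hv
    · rw [hL.1.2, ← card_mul_card_annihilator (L.map (AddMonoidHom.fst G (AddChar G ℂ))),
        Nat.card_congr (AddSubgroup.prodEquiv _ _).toEquiv, Nat.card_prod]
end Pairing

/-! ### Fourier expansion of the moments and the gain from balanced entries. -/

section Fourier
open scoped Classical

/-- Positions on or above the diagonal. -/
abbrev UpperPair (n : ℕ) : Type := {ij : Fin n × Fin n // ij.1 ≤ ij.2}

/-- The `C`-symmetric matrix with given entries on and above the diagonal. -/
def csymmMatrix {R : Type*} [CommRing R] {n : ℕ} (C : Matrix (Fin n) (Fin n) R)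
    (y : UpperPair n → R) : Matrix (Fin n) (Fin n) R :=
  fun i j => if h : i ≤ j then y ⟨(i, j), h⟩ else y ⟨(j, i), (not_le.1 h).le⟩ - C j i

/-- The number of tuples in `G` annihilated by the columns of a matrix; equivalently, the number of
homomorphisms from the cokernel to `G`. -/
noncomputable def solCount {R : Type*} [CommRing R] {n : ℕ} (X : Matrix (Fin n) (Fin n) R)
    (G : Type*) [AddCommGroup G] [Module R G] : ℕ :=
  Nat.card {f : Fin n → G // ∀ j, ∑ i, X i j • f i = 0}

/-- A probability vector on `ZMod a` that gives mass at most `1 - ε` to every residue class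
modulo a prime divisor of `a`. -/
structure IsBalancedWeight {a : ℕ} [NeZero a] (ε : ℝ) (μ : ZMod a → ℝ) : Prop where
  nonneg : ∀ x, 0 ≤ μ x
  sum_one : ∑ x, μ x = 1
  balanced : ∀ (p : ℕ) (_ : p.Prime) (hpa : p ∣ a) (r : ZMod p),
    ∑ x, (if ZMod.castHom hpa (ZMod p) x = r then μ x else 0) ≤ 1 - ε

lemma prod_pairs_eq_prod_upperPair {M : Type*} [CommMonoid M] {n : ℕ} (T : Fin n → Fin n → M) :
    ∏ i, ∏ j, T i j = ∏ e : UpperPair n,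
      if e.1.1 = e.1.2 then T e.1.1 e.1.1 else T e.1.1 e.1.2 * T e.1.2 e.1.1 := by
  have h1 : ∏ e : UpperPair n, (if e.1.1 = e.1.2 then T e.1.1 e.1.1 else
      T e.1.1 e.1.2 * T e.1.2 e.1.1) = ∏ ij : Fin n × Fin n, if ij.1 ≤ ij.2 then
        (if ij.1 = ij.2 then T ij.1 ij.1 else T ij.1 ij.2 * T ij.2 ij.1) else 1 := by
    rw [← Finset.prod_filter]
    exact (Finset.prod_subtype (Finset.univ.filter fun ij : Fin n × Fin n => ij.1 ≤ ij.2)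
      (by simp) (fun ij => if ij.1 = ij.2 then T ij.1 ij.1 else T ij.1 ij.2 * T ij.2 ij.1)).symm
  rw [h1, Fintype.prod_prod_type]
  have h2 : ∀ i j, (if i ≤ j then (if i = j then T i i else T i j * T j i) else 1) =
      (if i ≤ j then T i j else 1) * (if i < j then T j i else 1) := by
    intro i j
    rcases lt_trichotomy i j with h | rfl | h
    · simp [h, h.le, h.ne]
    · simp
    · simp [h.not_ge, h.not_gt]
  simp_rw [h2, Finset.prod_mul_distrib]
  rw [Finset.prod_comm (f := fun i j => if i < j then T j i else 1), ← Finset.prod_mul_distrib]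
  refine Finset.prod_congr rfl fun i _ => ?_
  rw [← Finset.prod_mul_distrib]
  refine Finset.prod_congr rfl fun j _ => ?_
  rcases le_or_gt i j with h | h
  · simp [h, h.not_gt]
  · simp [h, h.not_ge]

lemma smul_addChar {G : Type*} [AddCommGroup G] {a : ℕ} [NeZero a] [Module (ZMod a) G]
    (c : AddChar G ℂ) (x : ZMod a) (f : G) : c (x • f) = c f ^ x.val := by
  conv_lhs => rw [← ZMod.natCast_zmod_val x, Nat.cast_smul_eq_nsmul, AddChar.map_nsmul_eq_pow]

/-- The summand for the position `e` in the Fourier expansion. -/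
noncomputable def csymmFourierTerm {G : Type*} [AddCommGroup G] {a n : ℕ} [Module (ZMod a) G]
    (C : Matrix (Fin n) (Fin n) (ZMod a)) (w : Fin n → G × AddChar G ℂ) (e : UpperPair n)
    (x : ZMod a) : ℂ :=
  if e.1.1 = e.1.2 then (w e.1.1).2 (x • (w e.1.1).1) else
    (w e.1.2).2 (x • (w e.1.1).1) * (w e.1.1).2 ((x - C e.1.1 e.1.2) • (w e.1.2).1)

/-- The Fourier coefficient of the law of a random `C`-symmetric matrix. -/
noncomputable def csymmFourierCoeff {G : Type*} [AddCommGroup G] {a n : ℕ} [NeZero a]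
    [Module (ZMod a) G] (μ : UpperPair n → ZMod a → ℝ) (C : Matrix (Fin n) (Fin n) (ZMod a))
    (w : Fin n → G × AddChar G ℂ) : ℂ :=
  ∏ e : UpperPair n, ∑ x, (μ e x : ℂ) * csymmFourierTerm C w e x

/-- For each column, averaging over the characters of `G` detects whether the corresponding
combination of the `f i` vanishes. -/
lemma solCount_mul_pow_card {G : Type*} [AddCommGroup G] [Fintype G] {a n : ℕ}
    [Module (ZMod a) G] (X : Matrix (Fin n) (Fin n) (ZMod a)) :
    (solCount X G : ℂ) * (Fintype.card G : ℂ) ^ n =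
      ∑ w : Fin n → G × AddChar G ℂ, ∏ j, ∏ i, (w j).2 (X i j • (w i).1) := by
  have h1 : ∀ f : Fin n → G, (if ∀ j, ∑ i, X i j • f i = 0 then (Fintype.card G : ℂ) ^ n else 0) =
      ∑ c : Fin n → AddChar G ℂ, ∏ j, ∏ i, c j (X i j • f i) := by
    intro f
    have h2 : ∀ (c : Fin n → AddChar G ℂ) (j : Fin n), ∏ i, c j (X i j • f i) =
        c j (∑ i, X i j • f i) := fun c j => by
      exact (map_prod (c j).toMonoidHom (fun i => Multiplicative.ofAdd (X i j • f i)) _).symm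
    simp_rw [h2]
    rw [← Fintype.prod_sum (fun j (c : AddChar G ℂ) => c (∑ i, X i j • f i))]
    simp_rw [AddChar.sum_apply_eq_ite]
    split_ifs with h
    · simp [h]
    · push Not at h
      obtain ⟨j, hj⟩ := h
      rw [Finset.prod_eq_zero (Finset.mem_univ j)]
      rw [if_neg hj]
  have h3 : (solCount X G : ℂ) * (Fintype.card G : ℂ) ^ n = ∑ f : Fin n → G,
      if ∀ j, ∑ i, X i j • f i = 0 then (Fintype.card G : ℂ) ^ n else 0 := by
    rw [← Finset.sum_filter, Finset.sum_const, nsmul_eq_mul, solCount, Nat.card_eq_fintype_card,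
      Fintype.card_subtype]
  rw [h3, Finset.sum_congr rfl fun f _ => h1 f, ← Fintype.sum_prod_type']
  exact (Equiv.sum_comp (Equiv.arrowProdEquivProdArrow (Fin n) (fun _ => G) (fun _ => AddChar G ℂ))
    (fun fc : (Fin n → G) × (Fin n → AddChar G ℂ) =>
      ∏ j, ∏ i, fc.2 j (X i j • fc.1 i))).symm

/-- The entries below the diagonal are the mirrored ones shifted by `C`. After pairing `(i, j)` with
`(j, i)`, each factor depends on a single free entry, and the product weight lets the sum over
matrices factor. -/
lemma sum_weight_solCount_mul_pow_card {G : Type*} [AddCommGroup G] [Fintype G] {a n : ℕ} [NeZero a]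
    [Module (ZMod a) G] (μ : UpperPair n → ZMod a → ℝ) (C : Matrix (Fin n) (Fin n) (ZMod a)) :
    ((∑ y : UpperPair n → ZMod a, (∏ e, μ e (y e)) * solCount (csymmMatrix C y) G : ℝ) : ℂ) *
      (Fintype.card G : ℂ) ^ n = ∑ w : Fin n → G × AddChar G ℂ, csymmFourierCoeff μ C w := by
  push_cast
  rw [Finset.sum_mul]
  have h1 : ∀ (y : UpperPair n → ZMod a) (w : Fin n → G × AddChar G ℂ),
      ∏ j, ∏ i, (w j).2 (csymmMatrix C y i j • (w i).1) = ∏ e, csymmFourierTerm C w e (y e) := by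
    intro y w
    rw [Finset.prod_comm, prod_pairs_eq_prod_upperPair]
    refine Finset.prod_congr rfl fun e _ => ?_
    obtain ⟨⟨i, j⟩, hij⟩ := e
    simp only at hij
    simp only [csymmFourierTerm]
    by_cases h : i = j
    · subst h
      simp [csymmMatrix]
    · have hlt : i < j := lt_of_le_of_ne hij h
      simp [csymmMatrix, h, hij, hlt.not_ge]
  simp_rw [mul_assoc, solCount_mul_pow_card, h1, Finset.mul_sum]
  rw [Finset.sum_comm]
  refine Finset.sum_congr rfl fun w _ => ?_
  rw [csymmFourierCoeff, Fintype.prod_sum (fun e x => (μ e x : ℂ) * csymmFourierTerm C w e x)]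
  refine Finset.sum_congr rfl fun y _ => ?_
  rw [Finset.prod_mul_distrib]

lemma norm_csymmFourierTerm {G : Type*} [AddCommGroup G] [Finite G] {a n : ℕ} [Module (ZMod a) G]
    (C : Matrix (Fin n) (Fin n) (ZMod a)) (w : Fin n → G × AddChar G ℂ) (e : UpperPair n)
    (x : ZMod a) : ‖csymmFourierTerm C w e x‖ = 1 := by
  rw [csymmFourierTerm]
  split_ifs
  · exact AddChar.norm_apply _ _
  · rw [norm_mul, AddChar.norm_apply, AddChar.norm_apply, one_mul]

lemma norm_sum_weight_le_one {a : ℕ} [NeZero a] {μ : ZMod a → ℝ} (h0 : ∀ x, 0 ≤ μ x)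
    (h1 : ∑ x, μ x = 1) {θ : ZMod a → ℂ} (hθ : ∀ x, ‖θ x‖ = 1) :
    ‖∑ x, (μ x : ℂ) * θ x‖ ≤ 1 := by
  refine (norm_sum_le _ _).trans (le_of_eq ?_)
  rw [← h1]
  refine Finset.sum_congr rfl fun x _ => ?_
  rw [norm_mul, hθ, mul_one, Complex.norm_real, Real.norm_of_nonneg (h0 x)]

/-- Let `p` be a prime dividing the order of `χ 1`. Two points in the same fibre of `χ` differ by a
multiple of that order, so a fibre lies in one residue class modulo `p`. -/
lemma sum_weight_filter_addChar_le {a : ℕ} [NeZero a] {ε : ℝ} {μ : ZMod a → ℝ}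
    (hμ : IsBalancedWeight ε μ) {χ : AddChar (ZMod a) ℂ} (hχ : χ ≠ 1) (z : ℂ) :
    ∑ x, (if χ x = z then μ x else 0) ≤ 1 - ε := by
  have hχ1 : χ 1 ≠ 1 := by
    intro h
    refine hχ (AddChar.eq_one_iff.2 fun x => ?_)
    have := smul_addChar χ x 1
    rw [smul_eq_mul, mul_one] at this
    rw [this, h, one_pow]
  have ha : χ 1 ^ a = 1 := by
    rw [← AddChar.map_nsmul_eq_pow, nsmul_eq_mul, ZMod.natCast_self, zero_mul, AddChar.map_zero_eq_one]
  obtain ⟨p, hp, hpd⟩ := Nat.exists_prime_and_dvd (n := orderOf (χ 1)) (by rwa [Ne, orderOf_eq_one_iff])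
  have hda : orderOf (χ 1) ∣ a := orderOf_dvd_of_pow_eq_one ha
  have hpa := hpd.trans hda
  by_cases hz : ∃ x, χ x = z
  · obtain ⟨x₀, rfl⟩ := hz
    refine le_trans (Finset.sum_le_sum fun x _ => ?_) (hμ.balanced p hp hpa (ZMod.castHom hpa _ x₀))
    split_ifs with h1 h2
    · exact le_rfl
    · exfalso
      apply h2
      have h3 : χ (x - x₀) = 1 := by
        rw [AddChar.map_sub_eq_div, h1, div_self]
        intro h; have := AddChar.norm_apply χ x₀; rw [h, norm_zero] at this; exact zero_ne_one this
      have h4 := smul_addChar χ (x - x₀) 1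
      rw [smul_eq_mul, mul_one, h3] at h4
      have h5 := hpd.trans (orderOf_dvd_of_pow_eq_one h4.symm)
      have h6 : ZMod.castHom hpa (ZMod p) (x - x₀) = 0 := by
        rw [← ZMod.natCast_zmod_val (x - x₀), map_natCast]
        exact (ZMod.natCast_eq_zero_iff _ _).2 h5
      rw [map_sub, sub_eq_zero] at h6
      exact h6
    · exact hμ.nonneg x
    · exact le_rfl
  · push Not at hz
    rw [Finset.sum_eq_zero fun x _ => if_neg (hz x)]
    refine le_trans ?_ (hμ.balanced p hp hpa 0)
    exact Finset.sum_nonneg fun x _ => by split_ifs; exacts [hμ.nonneg x, le_rfl]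

/-- For independent copies `x`, `x'` the left side is the mean of the real part of `χ (x - x')`. It
loses at least `κ` whenever `χ x ≠ χ x'`, and given `x` this has probability at least `ε`. -/
lemma norm_sum_weight_addChar_sq_le {a : ℕ} [NeZero a] {ε : ℝ} {μ : ZMod a → ℝ}
    (hμ : IsBalancedWeight ε μ) {χ : AddChar (ZMod a) ℂ} (hχ : χ ≠ 1) {κ : ℝ} (hκ0 : 0 ≤ κ)
    (hκ : ∀ x, χ x ≠ 1 → κ ≤ 1 - (χ x).re) :
    ‖∑ x, (μ x : ℂ) * χ x‖ ^ 2 ≤ 1 - κ * ε := by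
  have h1 : ((‖∑ x, (μ x : ℂ) * χ x‖ ^ 2 : ℝ) : ℂ) =
      ∑ x, ∑ x', ((μ x * μ x' : ℝ) : ℂ) * χ (x - x') := by
    rw [Complex.ofReal_pow, ← Complex.mul_conj', map_sum, Finset.sum_mul_sum]
    refine Finset.sum_congr rfl fun x _ => Finset.sum_congr rfl fun x' _ => ?_
    rw [map_mul, Complex.conj_ofReal, sub_eq_add_neg, AddChar.map_add_eq_mul,
      AddChar.map_neg_eq_conj]
    push_cast; ring
  have h2 : ‖∑ x, (μ x : ℂ) * χ x‖ ^ 2 = ∑ x, ∑ x', (μ x * μ x') * (χ (x - x')).re := by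
    have := congrArg Complex.re h1
    rw [Complex.ofReal_re] at this
    rw [this, Complex.re_sum]
    refine Finset.sum_congr rfl fun x _ => ?_
    rw [Complex.re_sum]
    refine Finset.sum_congr rfl fun x' _ => ?_
    rw [Complex.re_ofReal_mul]
  have h3 : ∀ x x', (μ x * μ x') * (χ (x - x')).re ≤
      μ x * μ x' - κ * (μ x * (μ x' - if χ x' = χ x then μ x' else 0)) := by
    intro x x'
    have hm := mul_nonneg (hμ.nonneg x) (hμ.nonneg x')
    by_cases h : χ x' = χ x
    · rw [if_pos h, sub_self, mul_zero, mul_zero, sub_zero]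
      have : (χ (x - x')).re ≤ 1 := (Complex.re_le_norm _).trans (AddChar.norm_apply _ _).le
      nlinarith
    · rw [if_neg h, sub_zero]
      have := hκ (x - x') (by
        intro h'; apply h
        have : x = (x - x') + x' := by ring
        rw [this, AddChar.map_add_eq_mul, h', one_mul])
      nlinarith
  rw [h2]
  refine (Finset.sum_le_sum fun x _ => Finset.sum_le_sum fun x' _ => h3 x x').trans ?_
  have h4 : ∀ x, ∑ x', (μ x * μ x' - κ * (μ x * (μ x' - if χ x' = χ x then μ x' else 0))) ≤
      μ x * (1 - κ * ε) := by
    intro x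
    rw [Finset.sum_sub_distrib, ← Finset.mul_sum, ← Finset.mul_sum, ← Finset.mul_sum,
      Finset.sum_sub_distrib, hμ.sum_one]
    have := sum_weight_filter_addChar_le hμ hχ (χ x)
    have h5 : κ * (μ x * ε) ≤ κ * (μ x * (1 - ∑ x', if χ x' = χ x then μ x' else 0)) := by
      refine mul_le_mul_of_nonneg_left (mul_le_mul_of_nonneg_left ?_ (hμ.nonneg x)) hκ0
      linarith
    linarith
  refine (Finset.sum_le_sum fun x _ => h4 x).trans (le_of_eq ?_)
  rw [← Finset.sum_mul, hμ.sum_one, one_mul]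

lemma exists_norm_sum_weight_addChar_le (a : ℕ) [NeZero a] {ε : ℝ} (hε : 0 < ε) :
    ∃ ρ : ℝ, 0 < ρ ∧ ρ < 1 ∧ ∀ μ : ZMod a → ℝ, IsBalancedWeight ε μ →
      ∀ χ : AddChar (ZMod a) ℂ, χ ≠ 1 → ‖∑ x, (μ x : ℂ) * χ x‖ ≤ ρ := by
  obtain ⟨κ, hκ0, hκ⟩ : ∃ κ : ℝ, 0 < κ ∧ ∀ (χ : AddChar (ZMod a) ℂ) (x : ZMod a), χ x ≠ 1 →
      κ ≤ 1 - (χ x).re := by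
    have hpos : ∀ (χ : AddChar (ZMod a) ℂ) (x : ZMod a), χ x ≠ 1 → 0 < 1 - (χ x).re := by
      intro χ x h
      have h1 := AddChar.norm_apply χ x
      rw [sub_pos]
      refine lt_of_le_of_ne ((Complex.re_le_norm _).trans h1.le) fun h2 => h ?_
      have h3 := (Complex.re_eq_norm (z := χ x)).1 (by rw [h1, h2])
      rw [Complex.nonneg_iff] at h3
      exact Complex.ext h2 h3.2.symm
    -- There are finitely many pairs of a character and a point, so the positive gaps have a
    -- positive minimum.
    by_cases hne : (Finset.univ.filter fun cx : AddChar (ZMod a) ℂ × ZMod a => cx.1 cx.2 ≠ 1).Nonempty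
    · obtain ⟨m, hm, hmin⟩ := Finset.exists_min_image _
        (fun cx : AddChar (ZMod a) ℂ × ZMod a => 1 - (cx.1 cx.2).re) hne
      refine ⟨_, hpos m.1 m.2 (by simpa using hm), fun χ x h => hmin (χ, x) (by simpa using h)⟩
    · refine ⟨1, one_pos, fun χ x h => absurd ⟨(χ, x), by simpa using h⟩ hne⟩
  -- The maximum with `1 / 2` only serves to keep `ρ` positive.
  have hm1 : max (1 / 2) (1 - κ * ε) < 1 := max_lt (by norm_num) (by nlinarith [mul_pos hκ0 hε])
  have hm0 : (0 : ℝ) < max (1 / 2) (1 - κ * ε) := lt_of_lt_of_le (by norm_num) (le_max_left _ _)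
  refine ⟨√(max (1 / 2) (1 - κ * ε)), Real.sqrt_pos.2 hm0, by
    rw [Real.sqrt_lt' one_pos]; simpa using hm1, fun μ hμ χ hχ => ?_⟩
  refine Real.le_sqrt_of_sq_le ?_
  exact (norm_sum_weight_addChar_sq_le hμ hχ hκ0.le (hκ χ)).trans (le_max_right _ _)
end Fourier

/-! ### Limiting moments: one unit for every subgroup of `G`. -/

section Moments
open scoped Classical

/-- A position of a tuple that produces cancellation in the Fourier expansion. -/
def IsObstructed {G : Type*} [AddCommGroup G] {n : ℕ} (w : Fin n → G × AddChar G ℂ)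
    (e : UpperPair n) : Prop :=
  (e.1.1 = e.1.2 ∧ leftPairing G (w e.1.1) (w e.1.1) ≠ 1) ∨
    (e.1.1 ≠ e.1.2 ∧ w e.1.2 ∉ perpSubgroup (w e.1.1))

/-- The character `x ↦ c (x • f)` of `ZMod a`. -/
noncomputable def scalarChar {G : Type*} [AddCommGroup G] (a : ℕ) [Module (ZMod a) G]
    (c : AddChar G ℂ) (f : G) : AddChar (ZMod a) ℂ :=
  c.compAddMonoidHom (LinearMap.toSpanSingleton (ZMod a) G f).toAddMonoidHom

lemma scalarChar_apply {G : Type*} [AddCommGroup G] {a : ℕ} [Module (ZMod a) G]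
    (c : AddChar G ℂ) (f : G) (x : ZMod a) : scalarChar a c f x = c (x • f) := rfl

lemma csymmFourierTerm_eq {G : Type*} [AddCommGroup G] {a n : ℕ} [Module (ZMod a) G]
    (C : Matrix (Fin n) (Fin n) (ZMod a)) (w : Fin n → G × AddChar G ℂ) (e : UpperPair n)
    (h : e.1.1 ≠ e.1.2) (x : ZMod a) : csymmFourierTerm C w e x =
      (w e.1.1).2 (-(C e.1.1 e.1.2 • (w e.1.2).1)) *
        (scalarChar a (w e.1.2).2 (w e.1.1).1 + scalarChar a (w e.1.1).2 (w e.1.2).1) x := by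
  rw [csymmFourierTerm, if_neg h, sub_smul, sub_eq_add_neg, AddChar.map_add_eq_mul,
    AddChar.add_apply, scalarChar_apply, scalarChar_apply]
  ring

/-- Up to a phase coming from `C`, the entry enters through a character of `ZMod a` whose value at
`1` is the symmetric pairing of the two tuple values (off the diagonal) or `leftPairing` of one
value with itself (on it). Being obstructed means that this value, hence the character, is
nontrivial. -/
lemma norm_sum_csymmFourierTerm_le {G : Type*} [AddCommGroup G] [Fintype G] {a n : ℕ} [NeZero a]
    [Module (ZMod a) G] {ρ : ℝ} {μ : ZMod a → ℝ} (h0 : ∀ x, 0 ≤ μ x) (h1 : ∑ x, μ x = 1)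
    (hρ : ∀ χ : AddChar (ZMod a) ℂ, χ ≠ 1 → ‖∑ x, (μ x : ℂ) * χ x‖ ≤ ρ)
    (C : Matrix (Fin n) (Fin n) (ZMod a)) (w : Fin n → G × AddChar G ℂ) (e : UpperPair n) :
    ‖∑ x, (μ x : ℂ) * csymmFourierTerm C w e x‖ ≤ if IsObstructed w e then ρ else 1 := by
  split_ifs with h
  · rcases h with ⟨he, h⟩ | ⟨he, h⟩
    · have : ∀ x, csymmFourierTerm C w e x = scalarChar a (w e.1.1).2 (w e.1.1).1 x := fun x => by
        rw [csymmFourierTerm, if_pos he]; rfl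
      simp_rw [this]
      refine hρ _ fun h' => h ?_
      have := DFunLike.congr_fun h' (1 : ZMod a)
      rwa [scalarChar_apply, one_smul] at this
    · simp_rw [csymmFourierTerm_eq C w e he]
      have : ∀ x, (μ x : ℂ) * ((w e.1.1).2 (-(C e.1.1 e.1.2 • (w e.1.2).1)) *
        (scalarChar a (w e.1.2).2 (w e.1.1).1 + scalarChar a (w e.1.1).2 (w e.1.2).1) x) =
        (w e.1.1).2 (-(C e.1.1 e.1.2 • (w e.1.2).1)) * ((μ x : ℂ) *
        (scalarChar a (w e.1.2).2 (w e.1.1).1 + scalarChar a (w e.1.1).2 (w e.1.2).1) x) :=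
        fun x => by ring
      simp_rw [this]
      rw [← Finset.mul_sum, norm_mul, AddChar.norm_apply, one_mul]
      refine hρ _ fun h' => h ?_
      have := DFunLike.congr_fun h' (1 : ZMod a)
      rw [mem_perpSubgroup]
      rw [AddChar.add_apply, scalarChar_apply, scalarChar_apply, one_smul, one_smul, mul_comm] at this
      rwa [AddChar.one_apply] at this
  · exact norm_sum_weight_le_one h0 h1 (norm_csymmFourierTerm C w e)

lemma norm_csymmFourierCoeff_le {G : Type*} [AddCommGroup G] [Fintype G] {a n : ℕ} [NeZero a]
    [Module (ZMod a) G] {ρ : ℝ} {μ : UpperPair n → ZMod a → ℝ} (h0 : ∀ e x, 0 ≤ μ e x)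
    (h1 : ∀ e, ∑ x, μ e x = 1)
    (hρ : ∀ e, ∀ χ : AddChar (ZMod a) ℂ, χ ≠ 1 → ‖∑ x, (μ e x : ℂ) * χ x‖ ≤ ρ)
    (C : Matrix (Fin n) (Fin n) (ZMod a)) (w : Fin n → G × AddChar G ℂ) :
    ‖csymmFourierCoeff μ C w‖ ≤ ∏ e, if IsObstructed w e then ρ else 1 := by
  rw [csymmFourierCoeff, norm_prod]
  exact Finset.prod_le_prod (fun e _ => norm_nonneg _) fun e _ =>
    norm_sum_csymmFourierTerm_le (h0 e) (h1 e) (hρ e) C w e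

/-- The square root appears because `pairDefect` counts ordered pairs: each obstructed off-diagonal
entry is counted twice. -/
lemma prod_obstructed_le_pow_pairDefect {G : Type*} [AddCommGroup G] {n : ℕ} {ρ : ℝ} (hρ0 : 0 < ρ)
    (hρ1 : ρ ≤ 1) (w : Fin n → G × AddChar G ℂ) :
    (∏ e, if IsObstructed w e then ρ else 1) ≤ √ρ ^ pairDefect perpSubgroup w := by
  have h1 : √ρ ^ pairDefect perpSubgroup w =
      ∏ i, ∏ j, if i ≠ j ∧ w j ∉ perpSubgroup (w i) then √ρ else 1 := by
    rw [pairDefect, ← Fintype.prod_prod_type'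
      (fun i j => if i ≠ j ∧ w j ∉ perpSubgroup (w i) then √ρ else 1), ← Finset.prod_filter,
      Finset.prod_const]
  rw [h1, prod_pairs_eq_prod_upperPair]
  refine Finset.prod_le_prod (fun e _ => by split_ifs <;> positivity) fun e _ => ?_
  by_cases he : e.1.1 = e.1.2
  · rw [if_pos he, if_neg (c := e.1.1 ≠ e.1.1 ∧ _) (fun h => h.1 rfl)]
    split_ifs
    exacts [hρ1, le_rfl]
  · rw [if_neg he]
    have e1 : (e.1.2 ≠ e.1.1 ∧ w e.1.1 ∉ perpSubgroup (w e.1.2)) ↔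
        (e.1.1 ≠ e.1.2 ∧ w e.1.2 ∉ perpSubgroup (w e.1.1)) :=
      and_congr ne_comm (not_congr ⟨mem_perpSubgroup_symm _ _, mem_perpSubgroup_symm _ _⟩)
    rw [if_congr e1 rfl rfl]
    by_cases h : w e.1.2 ∈ perpSubgroup (w e.1.1)
    · have hn : ¬ (e.1.1 ≠ e.1.2 ∧ w e.1.2 ∉ perpSubgroup (w e.1.1)) := fun h' => h'.2 h
      rw [if_neg hn, mul_one]
      split_ifs
      exacts [hρ1, le_rfl]
    · have hp : e.1.1 ≠ e.1.2 ∧ w e.1.2 ∉ perpSubgroup (w e.1.1) := ⟨he, h⟩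
      have ho : IsObstructed w e := Or.inr hp
      rw [if_pos hp, Real.mul_self_sqrt hρ0.le, if_pos ho]

lemma prod_obstructed_le_prod_diag {G : Type*} [AddCommGroup G] {n : ℕ} {ρ : ℝ} (hρ0 : 0 < ρ)
    (hρ1 : ρ ≤ 1) (w : Fin n → G × AddChar G ℂ) :
    (∏ e, if IsObstructed w e then ρ else 1) ≤
      ∏ i, if leftPairing G (w i) (w i) ≠ 1 then ρ else 1 := by
  have h1 : (∏ i, if leftPairing G (w i) (w i) ≠ 1 then ρ else 1) =
      ∏ i, ∏ j, if i = j then (if leftPairing G (w i) (w i) ≠ 1 then ρ else 1) else 1 := by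
    refine Finset.prod_congr rfl fun i _ => ?_
    rw [Finset.prod_ite_eq, if_pos (Finset.mem_univ _)]
  rw [h1, prod_pairs_eq_prod_upperPair]
  refine Finset.prod_le_prod (fun e _ => by split_ifs <;> positivity) fun e _ => ?_
  by_cases he : e.1.1 = e.1.2
  · have e1 : IsObstructed w e ↔ leftPairing G (w e.1.1) (w e.1.1) ≠ 1 := by
      rw [IsObstructed]; tauto
    rw [if_pos he, if_pos rfl, if_congr e1 rfl rfl]
  · rw [if_neg he, if_neg he, if_neg (Ne.symm he), mul_one]
    split_ifs
    exacts [hρ1, le_rfl]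

lemma sum_tuples_in_subgroup {W M : Type*} [AddCommGroup W] [Fintype W] [AddCommMonoid M] {n : ℕ}
    (L : AddSubgroup W) (F : (Fin n → W) → M) :
    ∑ w : Fin n → W, (if outsideCount L w = 0 then F w else 0) =
      ∑ v : Fin n → L, F fun i => (v i : W) := by
  rw [← Finset.sum_filter]
  symm
  refine Finset.sum_bij (fun v _ i => (v i : W)) (fun v _ => ?_) (fun v _ v' _ h => ?_)
    (fun w hw => ?_) fun v _ => rfl
  · simp [outsideCount_eq_zero_iff]
  · ext i; exact congrFun h i
  · simp only [Finset.mem_filter, Finset.mem_univ, true_and, outsideCount_eq_zero_iff] at hw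
    exact ⟨fun i => ⟨w i, hw i⟩, Finset.mem_univ _, rfl⟩

lemma nsmul_prod_addChar {G : Type*} [AddCommGroup G] {a : ℕ} [Module (ZMod a) G]
    (w : G × AddChar G ℂ) : a • w = 0 := by
  have h : ∀ f : G, a • f = 0 := fun f => by
    rw [← Nat.cast_smul_eq_nsmul (ZMod a), ZMod.natCast_self, zero_smul]
  refine Prod.ext (h _) ?_
  ext f
  change (a • w.2) f = 1
  rw [AddChar.nsmul_apply, ← AddChar.map_nsmul_eq_pow, h, AddChar.map_zero_eq_one]

/-- The pairing `leftPairing` restricted to a subgroup. -/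
noncomputable def restrictPairing {G : Type*} [AddCommGroup G]
    (L : AddSubgroup (G × AddChar G ℂ)) : L →+ AddChar L ℂ where
  toFun l := (leftPairing G l).compAddMonoidHom L.subtype
  map_zero' := by ext; simp
  map_add' _ _ := by ext; simp

lemma restrictPairing_apply {G : Type*} [AddCommGroup G]
    (L : AddSubgroup (G × AddChar G ℂ)) (l l' : L) :
    restrictPairing L l l' = leftPairing G l l' := rfl

/-- On such an `L` the characters through which the random entries act are all trivial. Only the
deterministic shift by `C` survives, and the weights enter through their total mass alone. -/
lemma csymmFourierCoeff_eq_quadPhase {G : Type*} [AddCommGroup G] [Fintype G] {a n : ℕ} [NeZero a]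
    [Module (ZMod a) G] {μ : UpperPair n → ZMod a → ℝ} (h1 : ∀ e, ∑ x, μ e x = 1)
    (C : Matrix (Fin n) (Fin n) (ZMod a)) {L : AddSubgroup (G × AddChar G ℂ)} [Module (ZMod a) L]
    (hiso : IsIsotropic perpSubgroup L) (hq : ∀ l ∈ L, leftPairing G l l = 1) (v : Fin n → L) :
    csymmFourierCoeff μ C (fun i => (v i : G × AddChar G ℂ)) = quadPhase (restrictPairing L) C v := by
  rw [quadPhase, prod_pairs_eq_prod_upperPair, csymmFourierCoeff]
  refine Finset.prod_congr rfl fun e _ => ?_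
  by_cases he : e.1.1 = e.1.2
  · rw [if_pos he, if_neg (lt_irrefl _)]
    have : ∀ x, csymmFourierTerm C (fun i => (v i : G × AddChar G ℂ)) e x = 1 := fun x => by
      rw [csymmFourierTerm, if_pos he, smul_addChar, ← leftPairing_apply, hq _ (v _).2, one_pow]
    simp_rw [this, mul_one]
    exact_mod_cast h1 e
  · have hlt : e.1.1 < e.1.2 := lt_of_le_of_ne e.2 he
    rw [if_neg he, if_pos hlt, if_neg hlt.not_gt, mul_one]
    have : ∀ x, csymmFourierTerm C (fun i => (v i : G × AddChar G ℂ)) e x =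
        (v e.1.1).1.2 (-(C e.1.1 e.1.2 • (v e.1.2).1.1)) := fun x => by
      rw [csymmFourierTerm_eq _ _ _ he, AddChar.add_apply, scalarChar_apply, scalarChar_apply,
        smul_addChar, smul_addChar, ← mul_pow]
      have h2 := hiso _ (v e.1.1).2 (v e.1.2).2
      rw [mem_perpSubgroup, mul_comm] at h2
      rw [h2, one_pow, mul_one]
    simp_rw [this]
    rw [← Finset.sum_mul]
    have h3 : ∑ x, (μ e x : ℂ) = 1 := by exact_mod_cast h1 e
    rw [h3, one_mul, restrictPairing_apply, leftPairing_apply]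
    congr 1
    have := ZMod.map_smul ((AddMonoidHom.fst G (AddChar G ℂ)).comp L.subtype) (C e.1.1 e.1.2)
      (v e.1.2)
    exact congrArg Neg.neg this.symm

/-- The sum is compared with the sum over Lagrangians of the tuples inside each. A tuple in no
Lagrangian gives the first error term. A tuple in `k ≥ 1` of them is counted `k - 1` times too
often, which is at most the number `k² - k` of ordered pairs of distinct Lagrangians containing it.
The main term is rewritten by `card_lagrangian_leftPairing_trivial`. -/
lemma norm_sum_csymmFourierCoeff_sub_le {G : Type*} [AddCommGroup G] [Fintype G] {n : ℕ}
    (F : (Fin n → G × AddChar G ℂ) → ℂ) {σ : ℝ} (hσ0 : 0 ≤ σ) (hσ1 : σ ≤ 1)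
    (hF : ∀ w, ‖F w‖ ≤ σ ^ pairDefect perpSubgroup w) :
    ‖(∑ w, F w) / (Fintype.card G : ℂ) ^ n - Nat.card (AddSubgroup G)‖ ≤
      (∑ w : Fin n → G × AddChar G ℂ, (if ∀ L, IsLagrangian perpSubgroup (Fintype.card G) L →
        outsideCount L w ≠ 0 then σ ^ pairDefect perpSubgroup w else 0)) /
        (Fintype.card G : ℝ) ^ n +
      ((Finset.univ.filter (IsLagrangian (W := G × AddChar G ℂ) perpSubgroup (Fintype.card G))).offDiag.card *
        ((Fintype.card G - 1 : ℝ) / Fintype.card G) ^ n +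
      ∑ L ∈ Finset.univ.filter (IsLagrangian (W := G × AddChar G ℂ) perpSubgroup (Fintype.card G)),
        ‖(∑ v : Fin n → L, F fun i => (v i : G × AddChar G ℂ)) / (Fintype.card G : ℂ) ^ n -
          if ∀ w ∈ L, ∀ v ∈ L, leftPairing G w v = 1 then 1 else 0‖) := by
  set 𝓛 := Finset.univ.filter (IsLagrangian (W := G × AddChar G ℂ) perpSubgroup (Fintype.card G))
    with h𝓛
  set γ : ℕ := Fintype.card G with hγ
  have hγ0 : (0 : ℝ) < γ := by rw [hγ]; exact_mod_cast Fintype.card_pos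
  have hF1 : ∀ w, ‖F w‖ ≤ 1 := fun w => (hF w).trans (pow_le_one₀ hσ0 hσ1)
  have hpt : ∀ w, ‖F w - ∑ L ∈ 𝓛, (if outsideCount L w = 0 then F w else 0)‖ ≤
      (if ∀ L, IsLagrangian perpSubgroup γ L → outsideCount L w ≠ 0 then
        σ ^ pairDefect perpSubgroup w else 0) +
      ∑ q ∈ 𝓛.offDiag, (if outsideCount (q.1 ⊓ q.2) w = 0 then 1 else 0 : ℝ) := by
    intro w
    set K := 𝓛.filter fun L => outsideCount L w = 0 with hK
    have h1 : ∑ L ∈ 𝓛, (if outsideCount L w = 0 then F w else 0) = K.card * F w := by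
      rw [← Finset.sum_filter, Finset.sum_const, nsmul_eq_mul]
    have h2 : (∑ q ∈ 𝓛.offDiag, (if outsideCount (q.1 ⊓ q.2) w = 0 then 1 else 0 : ℝ)) =
        K.offDiag.card := by
      rw [← Finset.sum_filter, Finset.sum_const, nsmul_eq_mul, mul_one]
      congr 2
      ext q
      simp only [hK, Finset.mem_filter, Finset.mem_offDiag, outsideCount_eq_zero_iff,
        AddSubgroup.mem_inf, forall_and]
      tauto
    rw [h1, h2]
    by_cases h0 : K.card = 0
    · rw [h0, if_pos, Nat.cast_zero, zero_mul, sub_zero]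
      · have := hF w
        have : (0 : ℝ) ≤ K.offDiag.card := by positivity
        linarith
      · intro L hL hout
        rw [Finset.card_eq_zero] at h0
        have : L ∈ K := by
          simp only [hK, h𝓛, Finset.mem_filter, Finset.mem_univ, true_and]; exact ⟨hL, hout⟩
        rw [h0] at this
        exact Finset.notMem_empty _ this
    · have h3 : (1 : ℝ) ≤ K.card := by exact_mod_cast Nat.one_le_iff_ne_zero.2 h0
      have h4 : (K.offDiag.card : ℝ) = K.card * K.card - K.card := by
        rw [Finset.offDiag_card, Nat.cast_sub (Nat.le_mul_self _), Nat.cast_mul]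
      have h5 : F w - K.card * F w = -(((K.card - 1 : ℝ) : ℂ) * F w) := by push_cast; ring
      rw [h5, norm_neg, norm_mul, Complex.norm_real, Real.norm_of_nonneg (by linarith), h4]
      have h6 : (0 : ℝ) ≤ (if ∀ L, IsLagrangian perpSubgroup γ L → outsideCount L w ≠ 0 then
        σ ^ pairDefect perpSubgroup w else 0) := by split_ifs <;> positivity
      have h7 := mul_le_mul_of_nonneg_left (hF1 w) (by linarith : (0 : ℝ) ≤ K.card - 1)
      nlinarith
  have hoff : ∑ w : Fin n → G × AddChar G ℂ,
      ∑ q ∈ 𝓛.offDiag, (if outsideCount (q.1 ⊓ q.2) w = 0 then 1 else 0 : ℝ) ≤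
        𝓛.offDiag.card * (γ - 1 : ℝ) ^ n := by
    rw [Finset.sum_comm, ← nsmul_eq_mul]
    refine Finset.sum_le_card_nsmul _ _ _ fun q hq => ?_
    rw [sum_outsideCount_eq_zero]
    simp only [h𝓛, Finset.mem_offDiag, Finset.mem_filter, Finset.mem_univ, true_and] at hq
    obtain ⟨hq1, hq2, hne⟩ := hq
    -- Distinct subgroups of the same finite order `γ` meet in a proper subgroup of each, so tuples
    -- in the intersection are exponentially rare compared with `γ ^ n`.
    have hlt : Nat.card (q.1 ⊓ q.2 : AddSubgroup (G × AddChar G ℂ)) + 1 ≤ γ := by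
      by_contra hcon
      apply hne
      have e1 := AddSubgroup.eq_of_le_of_card_ge (inf_le_left : q.1 ⊓ q.2 ≤ q.1)
        (by rw [hq1.2]; omega)
      have e2 := AddSubgroup.eq_of_le_of_card_ge (inf_le_right : q.1 ⊓ q.2 ≤ q.2)
        (by rw [hq2.2]; omega)
      exact e1.symm.trans e2
    have hlt' : (Nat.card (q.1 ⊓ q.2 : AddSubgroup (G × AddChar G ℂ)) : ℝ) + 1 ≤ γ := by
      exact_mod_cast hlt
    gcongr
    linarith
  have hN : (Nat.card (AddSubgroup G) : ℂ) =
      ∑ L ∈ 𝓛, if ∀ w ∈ L, ∀ v ∈ L, leftPairing G w v = 1 then 1 else 0 := by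
    rw [← card_lagrangian_leftPairing_trivial, ← Finset.sum_filter, Finset.sum_const, nsmul_eq_mul,
      mul_one, Finset.filter_filter]
  have hmain : ‖∑ w, F w - ∑ L ∈ 𝓛, ∑ v : Fin n → L, F fun i => (v i : G × AddChar G ℂ)‖ ≤
      (∑ w : Fin n → G × AddChar G ℂ, (if ∀ L, IsLagrangian perpSubgroup γ L →
        outsideCount L w ≠ 0 then σ ^ pairDefect perpSubgroup w else 0)) +
        𝓛.offDiag.card * (γ - 1 : ℝ) ^ n := by
    have h1 : ∑ L ∈ 𝓛, ∑ v : Fin n → L, F (fun i => (v i : G × AddChar G ℂ)) =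
        ∑ w, ∑ L ∈ 𝓛, (if outsideCount L w = 0 then F w else 0) := by
      rw [Finset.sum_comm]
      exact Finset.sum_congr rfl fun L _ => (sum_tuples_in_subgroup L F).symm
    rw [h1, ← Finset.sum_sub_distrib]
    refine (norm_sum_le _ _).trans ((Finset.sum_le_sum fun w _ => hpt w).trans ?_)
    rw [Finset.sum_add_distrib]
    exact add_le_add le_rfl hoff
  have hdec : (∑ w, F w) / (γ : ℂ) ^ n - Nat.card (AddSubgroup G) =
      (∑ w, F w - ∑ L ∈ 𝓛, ∑ v : Fin n → L, F fun i => (v i : G × AddChar G ℂ)) / (γ : ℂ) ^ n +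
      ∑ L ∈ 𝓛, ((∑ v : Fin n → L, F fun i => (v i : G × AddChar G ℂ)) / (γ : ℂ) ^ n -
          if ∀ w ∈ L, ∀ v ∈ L, leftPairing G w v = 1 then 1 else 0) := by
    rw [hN, Finset.sum_sub_distrib, ← Finset.sum_div]
    ring
  rw [hdec]
  refine (norm_add_le _ _).trans ?_
  rw [← add_assoc]
  refine add_le_add ?_ (norm_sum_le _ _)
  rw [norm_div, norm_pow, Complex.norm_natCast, div_pow, ← mul_div_assoc, ← add_div]
  gcongr

/-- The dominating product is over positions, so the sum over tuples in `L` factors, and the single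
element `l` weighs `ρ` instead of `1`. -/
lemma sum_norm_csymmFourierCoeff_le {G : Type*} [AddCommGroup G] [Fintype G] {n : ℕ} {ρ : ℝ}
    (hρ0 : 0 < ρ) (hρ1 : ρ ≤ 1) (F : (Fin n → G × AddChar G ℂ) → ℂ)
    (hF : ∀ w, ‖F w‖ ≤ ∏ i, if leftPairing G (w i) (w i) ≠ 1 then ρ else 1)
    (L : AddSubgroup (G × AddChar G ℂ)) {l : G × AddChar G ℂ} (hl : l ∈ L)
    (hq : leftPairing G l l ≠ 1) :
    ‖∑ v : Fin n → L, F fun i => (v i : G × AddChar G ℂ)‖ ≤ (Nat.card L - 1 + ρ) ^ n := by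
  refine (norm_sum_le _ _).trans ((Finset.sum_le_sum fun v _ => hF _).trans ?_)
  rw [← Fintype.sum_pow (fun l : L => if leftPairing G (l : G × AddChar G ℂ) l ≠ 1 then ρ else 1)]
  have h0 : ∀ l : L, (0 : ℝ) ≤ if leftPairing G (l : G × AddChar G ℂ) l ≠ 1 then ρ else 1 := by
    intro l; split_ifs <;> positivity
  refine pow_le_pow_left₀ (Finset.sum_nonneg fun l _ => h0 l) ?_ n
  rw [← Finset.sum_erase_add _ _ (Finset.mem_univ (⟨l, hl⟩ : L)), if_pos hq]
  refine add_le_add ?_ le_rfl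
  refine (Finset.sum_le_card_nsmul _ _ 1 fun x _ => by split_ifs; exacts [hρ1, le_rfl]).trans ?_
  rw [Finset.card_erase_of_mem (Finset.mem_univ _), Finset.card_univ, Nat.card_eq_fintype_card,
    nsmul_eq_mul, mul_one, Nat.cast_sub Fintype.card_pos, Nat.cast_one]

/-- The moments of the cokernel of a random `C`-symmetric matrix converge, if the rank of `C`
modulo every prime divisor of `a` tends to infinity. -/
theorem tendsto_moment {a : ℕ} [NeZero a] {ε : ℝ} (hε : 0 < ε)
    (C : ∀ n, Matrix (Fin n) (Fin n) (ZMod a)) (hC : ∀ n, (C n).IsAlternating)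
    (hrank : ∀ (p : ℕ) (_ : p.Prime) (hpa : p ∣ a),
      Tendsto (fun n => ((C n).map (ZMod.castHom hpa (ZMod p))).rank) atTop atTop)
    (μ : ∀ n, UpperPair n → ZMod a → ℝ) (hμ : ∀ n e, IsBalancedWeight ε (μ n e))
    (G : Type*) [AddCommGroup G] [Finite G] [Module (ZMod a) G] :
    Tendsto (fun n => ∑ y : UpperPair n → ZMod a, (∏ e, μ n e (y e)) *
      (solCount (csymmMatrix (C n) y) G : ℝ)) atTop (𝓝 (Nat.card (AddSubgroup G))) := by
  have := Fintype.ofFinite G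
  obtain ⟨ρ, hρ0, hρ1, hρ⟩ := exists_norm_sum_weight_addChar_le a hε
  have hσ0 : 0 < √ρ := Real.sqrt_pos.2 hρ0
  have hσ1 : √ρ < 1 := by rw [Real.sqrt_lt' one_pos]; simpa using hρ1
  have hγ0 : (0 : ℝ) < Fintype.card G := by exact_mod_cast Fintype.card_pos
  have hγ1 : (1 : ℝ) ≤ Fintype.card G := by exact_mod_cast Fintype.card_pos
  have hb : ∀ n (w : Fin n → G × AddChar G ℂ), ‖csymmFourierCoeff (μ n) (C n) w‖ ≤
      ∏ e, if IsObstructed w e then ρ else 1 := fun n w =>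
    norm_csymmFourierCoeff_le (fun e => (hμ n e).nonneg) (fun e => (hμ n e).sum_one)
      (fun e => hρ _ (hμ n e)) (C n) w
  have hLag : ∀ L : AddSubgroup (G × AddChar G ℂ), IsLagrangian perpSubgroup (Fintype.card G) L →
      Tendsto (fun n => ‖(∑ v : Fin n → L, csymmFourierCoeff (μ n) (C n)
        fun i => (v i : G × AddChar G ℂ)) / (Fintype.card G : ℂ) ^ n -
          if ∀ w ∈ L, ∀ v ∈ L, leftPairing G w v = 1 then 1 else 0‖) atTop (𝓝 0) := by
    intro L hL
    have hLc : (Nat.card L : ℝ) = Fintype.card G := by exact_mod_cast hL.2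
    -- Isotropy makes `leftPairing` skew on `L`; triviality on the diagonal makes it alternating, as
    -- the Gauss sum bound requires. A nontrivial diagonal value is not excluded by skewness when
    -- `2` divides the order of `G`, and is treated separately through the diagonal entries.
    by_cases hq : ∀ l ∈ L, leftPairing G l l = 1
    · let _ : Module (ZMod a) L := AddCommGroup.zmodModule fun l =>
        Subtype.ext (nsmul_prod_addChar (l : G × AddChar G ℂ))
      have hphase : ∀ n, ∑ v : Fin n → L, csymmFourierCoeff (μ n) (C n)
          (fun i => (v i : G × AddChar G ℂ)) =
            ∑ v : Fin n → L, quadPhase (restrictPairing L) (C n) v := fun n =>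
        Finset.sum_congr rfl fun v _ =>
          csymmFourierCoeff_eq_quadPhase (fun e => (hμ n e).sum_one) (C n) hL.1 hq v
      -- A trivial pairing gives phase `1` and the contribution `1`. A nontrivial one gives a Gauss
      -- sum, which tends to zero as the rank of `C` grows.
      by_cases htriv : ∀ w ∈ L, ∀ v ∈ L, leftPairing G w v = 1
      · have h1 : ∀ n (v : Fin n → L), quadPhase (restrictPairing L) (C n) v = 1 := by
          intro n v
          refine Finset.prod_eq_one fun i _ => Finset.prod_eq_one fun j _ => ?_
          split_ifs
          · exact htriv _ (v i).2 _ (-(C n i j • v j) : L).2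
          · rfl
        refine tendsto_const_nhds.congr fun n => ?_
        rw [hphase, Finset.sum_congr rfl fun v _ => h1 n v, if_pos htriv, Finset.sum_const,
          Finset.card_univ, Fintype.card_fun, Fintype.card_fin, ← Nat.card_eq_fintype_card, hL.2,
          nsmul_eq_mul, mul_one, Nat.cast_pow, div_self, sub_self, norm_zero]
        have : (Fintype.card G : ℂ) ≠ 0 := by exact_mod_cast Fintype.card_ne_zero
        exact pow_ne_zero _ this
      · have hψ : restrictPairing L ≠ 0 := by
          intro h0
          apply htriv
          intro w hw v hv
          have := DFunLike.congr_fun (DFunLike.congr_fun h0 ⟨w, hw⟩) ⟨v, hv⟩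
          exact this
        obtain ⟨p, hp, hpa, hbd⟩ := exists_prime_norm_sum_quadPhase_sq_le (a := a) hψ
          (fun l => hq l l.2)
        have hp1 : (p : ℝ)⁻¹ < 1 := inv_lt_one_of_one_lt₀ (by exact_mod_cast hp.one_lt)
        have hlim : Tendsto (fun n => ‖∑ v : Fin n → L, quadPhase (restrictPairing L) (C n) v‖ /
            (Fintype.card L : ℝ) ^ n) atTop (𝓝 0) := by
          have h2 := squeeze_zero (fun n => by positivity) (fun n => hbd n (C n) (hC n))
            ((tendsto_pow_atTop_nhds_zero_of_lt_one (by positivity) hp1).comp (hrank p hp hpa))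
          have h3 := (Real.continuous_sqrt.tendsto 0).comp h2
          rw [Real.sqrt_zero] at h3
          refine h3.congr fun n => ?_
          simp only [Function.comp]
          rw [Real.sqrt_sq (by positivity)]
        refine hlim.congr fun n => ?_
        rw [hphase, if_neg htriv, sub_zero, norm_div, norm_pow, Complex.norm_natCast,
          ← Nat.card_eq_fintype_card, hLc]
    · push Not at hq
      obtain ⟨l, hl, hql⟩ := hq
      have hr0 : 0 ≤ ((Fintype.card G : ℝ) - 1 + ρ) / Fintype.card G := by
        apply div_nonneg <;> linarith
      have hr1 : ((Fintype.card G : ℝ) - 1 + ρ) / Fintype.card G < 1 := by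
        rw [div_lt_one hγ0]; linarith
      refine squeeze_zero (fun n => norm_nonneg _) (fun n => ?_)
        (tendsto_pow_atTop_nhds_zero_of_lt_one hr0 hr1)
      rw [if_neg (fun h => hql (h l hl l hl)), sub_zero, norm_div, norm_pow, Complex.norm_natCast,
        div_pow, ← hLc]
      gcongr
      exact sum_norm_csymmFourierCoeff_le hρ0 hρ1.le _ (fun w => (hb n w).trans
        (prod_obstructed_le_prod_diag hρ0 hρ1.le w)) L hl hql
  have hlim := (tendsto_sum_pow_pairDefect (W := G × AddChar G ℂ) perpSubgroup
    mem_perpSubgroup_symm (Fintype.card G) card_le_of_isIsotropic mem_of_isLagrangian hσ0 hσ1).add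
    (((tendsto_pow_atTop_nhds_zero_of_lt_one (r := (Fintype.card G - 1 : ℝ) / Fintype.card G)
      (div_nonneg (by linarith) hγ0.le) (by rw [div_lt_one hγ0]; linarith)).const_mul
      ((Finset.univ.filter (IsLagrangian (W := G × AddChar G ℂ) perpSubgroup
        (Fintype.card G))).offDiag.card : ℝ)).add
    (tendsto_finsetSum (Finset.univ.filter (IsLagrangian (W := G × AddChar G ℂ) perpSubgroup
        (Fintype.card G))) fun L hL => hLag L (by simpa using hL)))
  simp only [mul_zero, Finset.sum_const_zero, add_zero] at hlim
  rw [tendsto_iff_norm_sub_tendsto_zero]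
  refine squeeze_zero (fun n => norm_nonneg _) (fun n => ?_) hlim
  have h1 := norm_sum_csymmFourierCoeff_sub_le (csymmFourierCoeff (μ n) (C n)) hσ0.le hσ1.le
    (fun w => (hb n w).trans (prod_obstructed_le_pow_pairDefect hρ0 hρ1.le w))
  refine le_trans (le_of_eq ?_) h1
  rw [← sum_weight_solCount_mul_pow_card, mul_div_cancel_right₀, ← Complex.norm_real]
  · push_cast; rfl
  · have : (Fintype.card G : ℂ) ≠ 0 := by exact_mod_cast Fintype.card_ne_zero
    exact pow_ne_zero _ this
end Moments

/-! ### The moment method: interpolation polynomials on profiles. -/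

section MomentMethod

/-- Profiles: the first coordinate is a power of `p`, and it controls the others. -/
structure IsProfile (p : ℕ) {k : ℕ} (x : Fin (k + 1) → ℕ) : Prop where
  pow : ∃ d, x 0 = p ^ d
  le : ∀ i, x i ≤ x 0 ^ ((i : ℕ) + 1)

/-- A polynomial in the profile that vanishes at all profiles other than `y` whose first coordinate
is at most `p ^ s`. -/
noncomputable def profilePoly (p : ℕ) {k : ℕ} (y : Fin (k + 1) → ℕ) (s : ℕ) :
    MvPolynomial (Fin (k + 1)) ℝ :=
  (∏ j ∈ (Finset.range (s + 1)).filter (fun j => p ^ j ≠ y 0),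
    MvPolynomial.C ((1 - y 0 / (p : ℝ) ^ j)⁻¹) *
      (1 - MvPolynomial.C (((p : ℝ) ^ j)⁻¹) * MvPolynomial.X 0)) *
  ∏ i : Fin (k + 1), ∏ u ∈ (Finset.range (y 0 ^ ((i : ℕ) + 1) + 1)).erase (y i),
    MvPolynomial.C (((y i : ℝ) - u)⁻¹) * (MvPolynomial.X i - MvPolynomial.C (u : ℝ))

lemma eval_profilePoly (p : ℕ) {k : ℕ} (y : Fin (k + 1) → ℕ) (s : ℕ) (x : Fin (k + 1) → ℝ) :
    MvPolynomial.eval x (profilePoly p y s) =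
      (∏ j ∈ (Finset.range (s + 1)).filter (fun j => p ^ j ≠ y 0),
        (1 - y 0 / (p : ℝ) ^ j)⁻¹ * (1 - ((p : ℝ) ^ j)⁻¹ * x 0)) *
      ∏ i : Fin (k + 1), ∏ u ∈ (Finset.range (y 0 ^ ((i : ℕ) + 1) + 1)).erase (y i),
        ((y i : ℝ) - u)⁻¹ * (x i - u) := by
  simp [profilePoly]

lemma eval_profilePoly_self {p : ℕ} (hp : 2 ≤ p) {k : ℕ} {y : Fin (k + 1) → ℕ} (s : ℕ) :
    MvPolynomial.eval (fun i => (y i : ℝ)) (profilePoly p y s) = 1 := by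
  have hp0 : (0 : ℝ) < p := by positivity
  rw [eval_profilePoly, Finset.prod_eq_one, Finset.prod_eq_one, one_mul]
  · intro i _
    refine Finset.prod_eq_one fun u hu => ?_
    rw [inv_mul_cancel₀]
    rw [sub_ne_zero]
    exact_mod_cast (Finset.ne_of_mem_erase hu).symm
  · intro j hj
    rw [Finset.mem_filter] at hj
    rw [div_eq_inv_mul, inv_mul_cancel₀]
    rw [sub_ne_zero, Ne, eq_comm, inv_mul_eq_one₀ (by positivity)]
    exact_mod_cast hj.2

/-- If the first coordinates differ, `x 0` is one of the powers `p ^ j` with `j ≤ s` and the first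
product vanishes. If they agree, every `x i` is at most `y 0 ^ (i + 1)`, so a coordinate that
differs from `y i` is a root of the second product. -/
lemma eval_profilePoly_eq_zero {p : ℕ} (hp : 2 ≤ p) {k : ℕ} {x y : Fin (k + 1) → ℕ}
    (hx : IsProfile p x) {s : ℕ} (hs : x 0 ≤ p ^ s) (hxy : x ≠ y) :
    MvPolynomial.eval (fun i => (x i : ℝ)) (profilePoly p y s) = 0 := by
  have hp0 : (0 : ℝ) < p := by positivity
  rw [eval_profilePoly]
  by_cases h0 : x 0 = y 0
  · obtain ⟨i, hi⟩ := Function.ne_iff.1 hxy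
    rw [mul_eq_zero]; right
    refine Finset.prod_eq_zero (Finset.mem_univ i) (Finset.prod_eq_zero (i := x i) ?_ ?_)
    · rw [Finset.mem_erase, Finset.mem_range]
      have := hx.le i
      rw [h0] at this
      exact ⟨hi, by omega⟩
    · rw [sub_self, mul_zero]
  · obtain ⟨d, hd⟩ := hx.pow
    rw [mul_eq_zero]; left
    refine Finset.prod_eq_zero (i := d) ?_ ?_
    · rw [Finset.mem_filter, Finset.mem_range, ← hd]
      rw [hd] at hs
      exact ⟨Nat.lt_succ_of_le ((Nat.pow_le_pow_iff_right hp).1 hs), h0⟩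
    · rw [hd, Nat.cast_pow, inv_mul_cancel₀ (by positivity), sub_self, mul_zero]

/-- Because `y 0` is a power of `p` other than `p ^ j`, the ratio `y 0 / p ^ j` is at least `2` or
at most `1 / 2`, so the normalizing factor is at most `2 ≤ p`. The bound `p * (x 0 / p ^ j)` for
each factor is at least `1` when `x 0 > p ^ s`, so the index omitted from the product may be put
back. -/
lemma abs_eval_profilePoly_le {p : ℕ} (hp : 2 ≤ p) {k : ℕ} {x y : Fin (k + 1) → ℕ}
    (hx : IsProfile p x) (hy : IsProfile p y) {s : ℕ} (hs : p ^ s < x 0) :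
    |MvPolynomial.eval (fun i => (x i : ℝ)) (profilePoly p y s)| ≤
      (∏ j ∈ Finset.range (s + 1), ((p : ℝ) / p ^ j)) * (x 0 : ℝ) ^ (s + 1) *
        ∏ i : Fin (k + 1), ((1 + y 0 ^ ((i : ℕ) + 1)) * (x 0 : ℝ) ^ ((i : ℕ) + 1)) ^
          (y 0 ^ ((i : ℕ) + 1)) := by
  have hp0 : (0 : ℝ) < p := by positivity
  have hp2 : (2 : ℝ) ≤ p := by exact_mod_cast hp
  have hx1 : (1 : ℝ) ≤ x 0 := by exact_mod_cast (by omega : 1 ≤ x 0)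
  rw [eval_profilePoly, abs_mul, Finset.abs_prod, Finset.abs_prod]
  refine mul_le_mul ?_ ?_ (Finset.prod_nonneg fun _ _ => abs_nonneg _) (by positivity)
  · have hfac : ∀ j ∈ Finset.range (s + 1), (1 : ℝ) ≤ x 0 / p ^ j := by
      intro j hj
      rw [one_le_div (by positivity)]
      have : p ^ j ≤ p ^ s := Nat.pow_le_pow_right (by omega) (by rw [Finset.mem_range] at hj; omega)
      exact_mod_cast this.trans hs.le
    have h1 : ∀ j ∈ (Finset.range (s + 1)).filter (fun j => p ^ j ≠ y 0),
        |(1 - y 0 / (p : ℝ) ^ j)⁻¹ * (1 - ((p : ℝ) ^ j)⁻¹ * x 0)| ≤ p * (x 0 / p ^ j) := by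
      intro j hj
      rw [Finset.mem_filter] at hj
      rw [abs_mul]
      refine mul_le_mul ?_ ?_ (abs_nonneg _) hp0.le
      · rw [abs_inv]
        refine le_trans ?_ hp2
        have hne0 : (1 : ℝ) - y 0 / (p : ℝ) ^ j ≠ 0 := by
          rw [sub_ne_zero, Ne, eq_comm, div_eq_one_iff_eq (by positivity)]
          exact_mod_cast hj.2.symm
        rw [inv_le_comm₀ (abs_pos.2 hne0) two_pos]
        · obtain ⟨d, hd⟩ := hy.pow
          rw [hd] at hj ⊢
          have hne : j ≠ d := fun h => hj.2 (by rw [h])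
          rcases lt_or_gt_of_ne hne with h | h
          · have h2 : (2 : ℝ) ≤ (p ^ d : ℕ) / p ^ j := by
              obtain ⟨t, rfl⟩ := Nat.exists_eq_add_of_lt h
              rw [le_div_iff₀ (by positivity)]
              push_cast
              rw [pow_succ, pow_add]
              have : (1 : ℝ) ≤ p ^ t := one_le_pow₀ (by linarith)
              nlinarith [pow_pos hp0 j, mul_le_mul this hp2 two_pos.le (by positivity)]
            rw [abs_of_nonpos (by linarith)]
            linarith
          · have h2 : (p ^ d : ℕ) / (p : ℝ) ^ j ≤ 2⁻¹ := by
              obtain ⟨t, rfl⟩ := Nat.exists_eq_add_of_lt h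
              rw [div_le_iff₀ (by positivity)]
              push_cast
              rw [pow_succ, pow_add]
              have : (1 : ℝ) ≤ p ^ t := one_le_pow₀ (by linarith)
              nlinarith [pow_pos hp0 d, mul_le_mul this hp2 two_pos.le (by positivity)]
            rw [abs_of_nonneg (by linarith)]
            linarith
      · have := hfac j hj.1
        rw [← div_eq_inv_mul, abs_of_nonpos (by linarith)]
        linarith
    refine (Finset.prod_le_prod (fun _ _ => abs_nonneg _) h1).trans ?_
    have h2 : (∏ j ∈ Finset.range (s + 1), ((p : ℝ) / p ^ j)) * (x 0 : ℝ) ^ (s + 1) =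
        ∏ j ∈ Finset.range (s + 1), ((p : ℝ) * (x 0 / p ^ j)) := by
      conv_lhs => rw [← Finset.card_range (s + 1), ← Finset.prod_const, Finset.card_range]
      rw [← Finset.prod_mul_distrib]
      exact Finset.prod_congr rfl fun j _ => by ring
    rw [h2]
    refine Finset.prod_le_prod_of_subset_of_one_le (Finset.filter_subset _ _)
      (fun _ _ => by positivity) fun j hj _ => ?_
    have := hfac j hj
    nlinarith
  · refine Finset.prod_le_prod (fun _ _ => abs_nonneg _) fun i _ => ?_
    rw [Finset.abs_prod]
    have hcard : ((Finset.range (y 0 ^ ((i : ℕ) + 1) + 1)).erase (y i)).card =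
        y 0 ^ ((i : ℕ) + 1) := by
      rw [Finset.card_erase_of_mem (Finset.mem_range.2 (Nat.lt_succ_of_le (hy.le i))),
        Finset.card_range]
      rfl
    conv_rhs => rw [← hcard, ← Finset.prod_const]
    refine Finset.prod_le_prod (fun _ _ => abs_nonneg _) fun u hu => ?_
    rw [Finset.mem_erase, Finset.mem_range] at hu
    have hxi : (x i : ℝ) ≤ (x 0 : ℝ) ^ ((i : ℕ) + 1) := by exact_mod_cast hx.le i
    have hx0 : (1 : ℝ) ≤ (x 0 : ℝ) ^ ((i : ℕ) + 1) := one_le_pow₀ hx1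
    have hu' : (u : ℝ) ≤ (y 0 : ℝ) ^ ((i : ℕ) + 1) := by exact_mod_cast Nat.lt_succ_iff.1 hu.2
    have h3 : |((y i : ℝ) - u)⁻¹| ≤ 1 := by
      rw [abs_inv]
      apply inv_le_one_of_one_le₀
      have : (1 : ℤ) ≤ |(y i : ℤ) - u| := Int.one_le_abs (sub_ne_zero.2 (by exact_mod_cast hu.1.symm))
      exact_mod_cast this
    have h4 : |(x i : ℝ) - u| ≤ (1 + (y 0 : ℝ) ^ ((i : ℕ) + 1)) * (x 0 : ℝ) ^ ((i : ℕ) + 1) := by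
      have : |(x i : ℝ) - u| ≤ x i + u := by
        rw [abs_le]; constructor <;> linarith [(Nat.cast_nonneg (x i) : (0:ℝ) ≤ x i),
          (Nat.cast_nonneg u : (0:ℝ) ≤ u)]
      nlinarith [(Nat.cast_nonneg u : (0:ℝ) ≤ u)]
    rw [abs_mul]
    calc _ ≤ 1 * _ := mul_le_mul h3 h4 (abs_nonneg _) zero_le_one
      _ = _ := by rw [one_mul]

-- What matters is that `A` and `D` do not depend on `s`: the second product of the polynomial
-- involves only `y`, so it costs a fixed power of `x 0`.
open scoped Classical in
lemma exists_profilePoly_error {p : ℕ} (hp : 2 ≤ p) {k : ℕ} {y : Fin (k + 1) → ℕ}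
    (hy : IsProfile p y) : ∃ (A : ℝ) (D : ℕ), 0 ≤ A ∧ ∀ (s : ℕ) (x : Fin (k + 1) → ℕ),
      IsProfile p x → |MvPolynomial.eval (fun i => (x i : ℝ)) (profilePoly p y s) -
        if x = y then 1 else 0| ≤
        A * (∏ j ∈ Finset.range (s + 1), ((p : ℝ) / p ^ j)) * (x 0 : ℝ) ^ (s + D) := by
  refine ⟨∏ i : Fin (k + 1), (1 + (y 0 : ℝ) ^ ((i : ℕ) + 1)) ^ (y 0 ^ ((i : ℕ) + 1)),
    1 + ∑ i : Fin (k + 1), ((i : ℕ) + 1) * (y 0 ^ ((i : ℕ) + 1)), by positivity,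
    fun s x hx => ?_⟩
  have hp0 : (0 : ℝ) < p := by positivity
  by_cases hxy : x = y
  · rw [if_pos hxy, hxy, eval_profilePoly_self hp, sub_self, abs_zero]
    positivity
  · rw [if_neg hxy, sub_zero]
    rcases le_or_gt (x 0) (p ^ s) with h | h
    · rw [eval_profilePoly_eq_zero hp hx h hxy, abs_zero]
      positivity
    · refine (abs_eval_profilePoly_le hp hx hy h).trans (le_of_eq ?_)
      simp_rw [mul_pow]
      rw [Finset.prod_mul_distrib]
      simp_rw [← pow_mul]
      rw [Finset.prod_pow_eq_pow_sum, ← add_assoc, pow_add _ (s + 1)]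
      ring

lemma tendsto_sum_eval {α : ℕ → Type*} [∀ n, Fintype (α n)] (w : ∀ n, α n → ℝ) {k : ℕ}
    (x : ∀ n, α n → Fin (k + 1) → ℕ) (c : ℝ) (M : (Fin (k + 1) → ℕ) → ℝ)
    (h : ∀ m : Fin (k + 1) → ℕ, Tendsto (fun n => ∑ ω, w n ω * ∏ i, (x n ω i : ℝ) ^ m i) atTop
      (𝓝 (c * M m))) (f : MvPolynomial (Fin (k + 1)) ℝ) :
    Tendsto (fun n => ∑ ω, w n ω * MvPolynomial.eval (fun i => (x n ω i : ℝ)) f) atTop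
      (𝓝 (c * ∑ m ∈ f.support, f.coeff m * M m)) := by
  have h1 : ∀ n, ∑ ω, w n ω * MvPolynomial.eval (fun i => (x n ω i : ℝ)) f =
      ∑ m ∈ f.support, f.coeff m * ∑ ω, w n ω * ∏ i, (x n ω i : ℝ) ^ m i := by
    intro n
    simp_rw [MvPolynomial.eval_eq', Finset.mul_sum]
    rw [Finset.sum_comm]
    exact Finset.sum_congr rfl fun m _ => Finset.sum_congr rfl fun ω _ => by ring
  simp_rw [h1]
  rw [Finset.mul_sum]
  refine tendsto_finsetSum _ fun m _ => ?_
  have := (h m).const_mul (f.coeff m)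
  rwa [← mul_assoc, mul_comm (f.coeff m) c, mul_assoc] at this

open scoped Classical in
/-- Two weighted families of profiles with proportional limiting moments of moderate growth have
proportional asymptotic distributions. -/
theorem tendsto_profile_sub {p : ℕ} (hp : 2 ≤ p) {α β : ℕ → Type} [∀ n, Fintype (α n)]
    [∀ n, Fintype (β n)] (w : ∀ n, α n → ℝ) (w' : ∀ n, β n → ℝ) (hw : ∀ n ω, 0 ≤ w n ω)
    (hw' : ∀ n ω, 0 ≤ w' n ω) {k : ℕ} (x : ∀ n, α n → Fin (k + 1) → ℕ)
    (x' : ∀ n, β n → Fin (k + 1) → ℕ) (hx : ∀ n ω, IsProfile p (x n ω))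
    (hx' : ∀ n ω, IsProfile p (x' n ω)) {c : ℝ} (hc : 0 ≤ c) (M : (Fin (k + 1) → ℕ) → ℝ)
    (h : ∀ m : Fin (k + 1) → ℕ, Tendsto (fun n => ∑ ω, w n ω * ∏ i, (x n ω i : ℝ) ^ m i) atTop
      (𝓝 (c * M m)))
    (h' : ∀ m : Fin (k + 1) → ℕ, Tendsto (fun n => ∑ ω, w' n ω * ∏ i, (x' n ω i : ℝ) ^ m i) atTop
      (𝓝 (M m)))
    (hM : ∀ D : ℕ, Tendsto (fun s : ℕ => (∏ j ∈ Finset.range (s + 1), ((p : ℝ) / p ^ j)) *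
      M (Pi.single 0 (s + D))) atTop (𝓝 0))
    {y : Fin (k + 1) → ℕ} (hy : IsProfile p y) :
    Tendsto (fun n => (∑ ω, if x n ω = y then w n ω else 0) -
      c * ∑ ω, if x' n ω = y then w' n ω else 0) atTop (𝓝 0) := by
  obtain ⟨A, D, hA, herr⟩ := exists_profilePoly_error hp hy
  set b : ℕ → ℝ := fun s => ∏ j ∈ Finset.range (s + 1), ((p : ℝ) / p ^ j) with hb
  have hM0 : ∀ m, 0 ≤ M m := fun m => ge_of_tendsto' (h' m) fun n =>
    Finset.sum_nonneg fun ω _ => mul_nonneg (hw' n ω) (by positivity)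
  have hsingle : ∀ (z : Fin (k + 1) → ℕ) (t : ℕ),
      ∏ i, (z i : ℝ) ^ (Pi.single (M := fun _ => ℕ) 0 t i) = (z 0 : ℝ) ^ t := by
    intro z t
    rw [Finset.prod_eq_single 0]
    · simp
    · intro i _ hi; simp [hi]
    · simp
  have key : ∀ {γ : Type} [Fintype γ] (v : γ → ℝ) (hv : ∀ ω, 0 ≤ v ω) (z : γ → Fin (k + 1) → ℕ)
      (hz : ∀ ω, IsProfile p (z ω)) (s : ℕ),
      |(∑ ω, if z ω = y then v ω else 0) -
        ∑ ω, v ω * MvPolynomial.eval (fun i => (z ω i : ℝ)) (profilePoly p y s)| ≤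
      A * b s * ∑ ω, v ω * ∏ i, (z ω i : ℝ) ^ (Pi.single (M := fun _ => ℕ) 0 (s + D) i) := by
    intro γ _ v hv z hz s
    rw [← Finset.sum_sub_distrib, Finset.mul_sum]
    refine (Finset.abs_sum_le_sum_abs _ _).trans (Finset.sum_le_sum fun ω _ => ?_)
    rw [hsingle]
    have e : (if z ω = y then v ω else 0) -
        v ω * MvPolynomial.eval (fun i => (z ω i : ℝ)) (profilePoly p y s) =
        -(v ω * (MvPolynomial.eval (fun i => (z ω i : ℝ)) (profilePoly p y s) -
          if z ω = y then 1 else 0)) := by split_ifs <;> ring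
    rw [e, abs_neg, abs_mul, abs_of_nonneg (hv ω)]
    calc _ ≤ v ω * (A * b s * (z ω 0 : ℝ) ^ (s + D)) :=
          mul_le_mul_of_nonneg_left (herr s _ (hz ω)) (hv ω)
      _ = _ := by ring
  rw [Metric.tendsto_atTop]
  intro δ hδ
  have hM1 := (hM D).const_mul (A * c * 2)
  rw [mul_zero] at hM1
  -- First `s` is fixed so that the limiting interpolation errors of both families are small
  -- together; then `n` is large enough for finitely many moments to be near their limits.
  obtain ⟨s, hs1⟩ := (hM1.eventually (gt_mem_nhds (half_pos hδ))).exists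
  set Λ := ∑ m ∈ (profilePoly p y s).support, (profilePoly p y s).coeff m * M m with hΛ
  have t1 := tendsto_sum_eval w x c M h (profilePoly p y s)
  have t2 := tendsto_sum_eval w' x' 1 M (by simpa using h') (profilePoly p y s)
  rw [one_mul] at t2
  have t3 := (h (Pi.single 0 (s + D))).const_mul (A * b s)
  have t4 := (h' (Pi.single 0 (s + D))).const_mul (A * b s)
  have t5 := (((t1.sub (t2.const_mul c)).abs).add (t3.add (t4.const_mul c)))
  have hlim : |c * Λ - c * Λ| + (A * b s * (c * M (Pi.single 0 (s + D))) +
      c * (A * b s * M (Pi.single 0 (s + D)))) < δ := by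
    rw [sub_self, abs_zero, zero_add]
    have : A * b s * (c * M (Pi.single 0 (s + D))) + c * (A * b s * M (Pi.single 0 (s + D))) =
      A * c * 2 * (b s * M (Pi.single 0 (s + D))) := by ring
    rw [this]
    linarith
  obtain ⟨N, hN⟩ := eventually_atTop.1 (t5.eventually (gt_mem_nhds hlim))
  refine ⟨N, fun n hn => ?_⟩
  have e1 := abs_le.1 (key (w n) (hw n) (x n) (hx n) s)
  have e2 := abs_le.1 (key (w' n) (hw' n) (x' n) (hx' n) s)
  have e2' := mul_le_mul_of_nonneg_left e2.1 hc
  have e2'' := mul_le_mul_of_nonneg_left e2.2 hc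
  have e3 := hN n hn
  rw [Real.dist_eq, sub_zero]
  refine lt_of_le_of_lt ?_ e3
  have e4 := le_abs_self (∑ ω, w n ω * MvPolynomial.eval (fun i => (x n ω i : ℝ)) (profilePoly p y s)
    - c * ∑ ω, w' n ω * MvPolynomial.eval (fun i => (x' n ω i : ℝ)) (profilePoly p y s))
  have e5 := neg_abs_le (∑ ω, w n ω * MvPolynomial.eval (fun i => (x n ω i : ℝ)) (profilePoly p y s)
    - c * ∑ ω, w' n ω * MvPolynomial.eval (fun i => (x' n ω i : ℝ)) (profilePoly p y s))
  rw [abs_le]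
  constructor <;> linarith [e1.1, e1.2]
end MomentMethod

/-! ### Homomorphism counts determine finite abelian groups; numbers of subgroups. -/

section HomCounts
open scoped Classical

lemma AddMonoidHom.finite_of_finite (A G : Type*) [AddCommGroup A] [AddCommGroup G] [Finite A]
    [Finite G] : Finite (A →+ G) := DFunLike.finite _

lemma natCard_addMonoidHom_congr {A B G H : Type*} [AddCommGroup A] [AddCommGroup B]
    [AddCommGroup G] [AddCommGroup H] (e : A ≃+ B) (e' : G ≃+ H) :
    Nat.card (A →+ G) = Nat.card (B →+ H) :=
  Nat.card_congr
    { toFun := fun f => (e'.toAddMonoidHom.comp f).comp e.symm.toAddMonoidHom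
      invFun := fun f => (e'.symm.toAddMonoidHom.comp f).comp e.toAddMonoidHom
      left_inv := fun f => by ext; simp
      right_inv := fun f => by ext; simp }

lemma natCard_addMonoidHom_pi {A ι : Type*} [AddCommGroup A] [Fintype ι] (G : ι → Type*)
    [∀ i, AddCommGroup (G i)] : Nat.card (A →+ ∀ i, G i) = ∏ i, Nat.card (A →+ G i) := by
  rw [← Nat.card_pi]
  refine Nat.card_congr
    { toFun := fun f i => (Pi.evalAddMonoidHom G i).comp f
      invFun := fun f => AddMonoidHom.pi f
      left_inv := fun f => by ext; rfl
      right_inv := fun f => by ext; rfl }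

lemma natCard_addMonoidHom_prod (A G H : Type*) [AddCommGroup A] [AddCommGroup G]
    [AddCommGroup H] : Nat.card (A →+ G × H) = Nat.card (A →+ G) * Nat.card (A →+ H) := by
  rw [← Nat.card_prod]
  refine Nat.card_congr
    { toFun := fun f => ((AddMonoidHom.fst G H).comp f, (AddMonoidHom.snd G H).comp f)
      invFun := fun f => f.1.prod f.2
      left_inv := fun f => by ext <;> rfl
      right_inv := fun f => by ext <;> rfl }

lemma natCard_addMonoidHom_le_ker_mul {A G H : Type*} [AddCommGroup A] [AddCommGroup G]
    [AddCommGroup H] [Finite A] [Finite G] [Finite H] (f : G →+ H) :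
    Nat.card (A →+ G) ≤ Nat.card (A →+ f.ker) * Nat.card (A →+ H) := by
  have := AddMonoidHom.finite_of_finite A G
  have := AddMonoidHom.finite_of_finite A H
  have := AddMonoidHom.finite_of_finite A f.ker
  set Φ : (A →+ G) →+ (A →+ H) := AddMonoidHom.compHom f with hΦ
  have h1 := AddSubgroup.card_eq_card_quotient_mul_card_addSubgroup Φ.ker
  rw [Nat.card_congr (QuotientAddGroup.quotientKerEquivRange Φ).toEquiv, mul_comm] at h1
  rw [h1]
  refine Nat.mul_le_mul ?_ (Nat.card_le_card_of_injective _ Subtype.val_injective)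
  refine Nat.card_le_card_of_injective
    (fun g : Φ.ker => g.1.codRestrict f.ker fun x => DFunLike.congr_fun g.2 x) fun g g' h => ?_
  apply Subtype.ext
  ext x
  exact congrArg Subtype.val (DFunLike.congr_fun h x)

/-- Induction along the extension of `ZMod (p ^ (i + 1))` by a kernel of order `p`, using left
exactness of `Hom`. -/
lemma natCard_addMonoidHom_zmod_pow_le {A : Type*} [AddCommGroup A] [Finite A] {p : ℕ}
    (hp : p.Prime) (i : ℕ) :
    Nat.card (A →+ ZMod (p ^ (i + 1))) ≤ Nat.card (A →+ ZMod p) ^ (i + 1) := by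
  have := Fact.mk hp
  have hne : ∀ j, NeZero (p ^ j) := fun j => ⟨pow_ne_zero j hp.ne_zero⟩
  induction i with
  | zero => rw [zero_add, pow_one, pow_one]
  | succ i ih =>
    have := hne (i + 1)
    have := hne (i + 1 + 1)
    set f := (ZMod.castHom (pow_dvd_pow p (Nat.le_succ (i + 1))) (ZMod (p ^ (i + 1)))).toAddMonoidHom
      with hf
    have hsurj : Function.Surjective f := ZMod.ringHom_surjective _
    have hcard : Nat.card f.ker = p := by
      have h1 := AddSubgroup.card_eq_card_quotient_mul_card_addSubgroup f.ker
      rw [Nat.card_congr (QuotientAddGroup.quotientKerEquivOfSurjective f hsurj).toEquiv,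
        Nat.card_zmod, Nat.card_zmod] at h1
      exact (Nat.eq_of_mul_eq_mul_left (pow_pos hp.pos _) ((pow_succ p (i + 1)).symm.trans h1)).symm
    have hcyc : IsAddCyclic f.ker := isAddCyclic_of_prime_card hcard
    have e : f.ker ≃+ ZMod p := (zmodAddCyclicAddEquiv hcyc).symm.trans
      (ZMod.ringEquivCongr hcard).toAddEquiv
    refine (natCard_addMonoidHom_le_ker_mul f).trans ?_
    rw [natCard_addMonoidHom_congr (AddEquiv.refl A) e, pow_succ _ (i + 1), mul_comm]
    exact Nat.mul_le_mul_right _ ih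

/-- The numbers of homomorphisms from a group to `ZMod p, ZMod (p ^ 2), …`. -/
noncomputable def homProfile (p k : ℕ) (A : Type*) [AddCommGroup A] (i : Fin (k + 1)) : ℕ :=
  Nat.card (A →+ ZMod (p ^ ((i : ℕ) + 1)))

lemma homProfile_congr (p k : ℕ) {A B : Type*} [AddCommGroup A] [AddCommGroup B] (e : A ≃+ B) :
    homProfile p k A = homProfile p k B := by
  ext i; exact natCard_addMonoidHom_congr e (AddEquiv.refl _)

lemma isProfile_homProfile {p : ℕ} (hp : p.Prime) (k : ℕ) (A : Type*) [AddCommGroup A] [Finite A] :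
    IsProfile p (homProfile p k A) := by
  have := Fact.mk hp
  have := AddMonoidHom.finite_of_finite A (ZMod p)
  have h0 : homProfile p k A 0 = Nat.card (A →+ ZMod p) := by
    rw [homProfile, Fin.val_zero, zero_add, pow_one]
  constructor
  · refine ⟨Module.finrank (ZMod p) (A →+ ZMod p), ?_⟩
    rw [h0, Module.natCard_eq_pow_finrank (K := ZMod p), Nat.card_zmod]
  · intro i
    rw [h0]
    exact natCard_addMonoidHom_zmod_pow_le hp i

lemma natCard_addMonoidHom_eq_sum_surjective (A G : Type*) [AddCommGroup A] [AddCommGroup G]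
    [Finite A] [Fintype (AddSubgroup G)] [Finite G] : Nat.card (A →+ G) =
      ∑ K : AddSubgroup G, Nat.card {f : A →+ K // Function.Surjective f} := by
  have h : ∀ K : AddSubgroup G, Finite {f : A →+ K // Function.Surjective f} := fun K => by
    have := AddMonoidHom.finite_of_finite A K
    infer_instance
  rw [← Nat.card_sigma]
  refine (Nat.card_congr ?_).symm
  refine Equiv.ofBijective (fun s => s.1.subtype.comp s.2.1) ⟨?_, fun f => ?_⟩
  · rintro ⟨K, f, hf⟩ ⟨K', f', hf'⟩ h
    simp only at h
    have hr : ∀ (K : AddSubgroup G) (f : A →+ K), Function.Surjective f →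
        (K.subtype.comp f).range = K := fun K f hf => by
      rw [AddMonoidHom.range_comp, AddMonoidHom.range_eq_top.2 hf, ← AddMonoidHom.range_eq_map]
      exact K.range_subtype
    have hK : K = K' := by rw [← hr K f hf, ← hr K' f' hf', h]
    subst hK
    have : f = f' := by
      ext x
      exact DFunLike.congr_fun h x
    subst this
    rfl
  · exact ⟨⟨f.range, f.rangeRestrict, f.rangeRestrict_surjective⟩, by ext; rfl⟩

lemma natCard_surjective_congr {A G H : Type*} [AddCommGroup A] [AddCommGroup G] [AddCommGroup H]
    (e : G ≃+ H) : Nat.card {f : A →+ G // Function.Surjective f} =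
      Nat.card {f : A →+ H // Function.Surjective f} :=
  Nat.card_congr
    { toFun := fun f => ⟨e.toAddMonoidHom.comp f.1, e.surjective.comp f.2⟩
      invFun := fun f => ⟨e.symm.toAddMonoidHom.comp f.1, e.symm.surjective.comp f.2⟩
      left_inv := fun f => by ext; simp
      right_inv := fun f => by ext; simp }

/-- Homomorphisms are sorted by their image. By induction on the order of `G` the surjections onto
proper subgroups agree, and subtraction leaves those onto `G`. -/
lemma natCard_surjective_eq_of_natCard_hom_eq.{u} {A B : Type*} [AddCommGroup A] [AddCommGroup B]
    [Finite A] [Finite B] {a : ℕ}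
    (h : ∀ (K : Type u) [AddCommGroup K] [Finite K], (∀ x : K, a • x = 0) →
      Nat.card (A →+ K) = Nat.card (B →+ K))
    (G : Type u) [AddCommGroup G] [Finite G] (hG : ∀ x : G, a • x = 0) :
    Nat.card {f : A →+ G // Function.Surjective f} =
      Nat.card {f : B →+ G // Function.Surjective f} := by
  induction hn : Nat.card G using Nat.strong_induction_on generalizing G with
  | _ n ih =>
    have := Fintype.ofFinite (AddSubgroup G)
    have h1 := natCard_addMonoidHom_eq_sum_surjective A G
    have h2 := natCard_addMonoidHom_eq_sum_surjective B G
    rw [← Finset.sum_erase_add _ _ (Finset.mem_univ (⊤ : AddSubgroup G)),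
      natCard_surjective_congr AddSubgroup.topEquiv] at h1 h2
    have h3 : ∑ K ∈ Finset.univ.erase (⊤ : AddSubgroup G),
        Nat.card {f : A →+ K // Function.Surjective f} =
        ∑ K ∈ Finset.univ.erase (⊤ : AddSubgroup G),
        Nat.card {f : B →+ K // Function.Surjective f} := by
      refine Finset.sum_congr rfl fun K hK => ?_
      refine ih (Nat.card K) ?_ K (fun x => Subtype.ext (hG x)) rfl
      rw [← hn]
      refine lt_of_le_of_ne (AddSubgroup.card_le_card_addGroup K) fun he => ?_
      exact Finset.ne_of_mem_erase hK (AddSubgroup.eq_top_of_card_eq K he)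
    rw [h G hG, h2, h3] at h1
    omega

lemma natCard_hom_eq_of_primePow {A B : Type*} [AddCommGroup A] [AddCommGroup B] [Finite A]
    [Finite B] {a : ℕ} (h : ∀ p k : ℕ, p.Prime → p ^ (k + 1) ∣ a →
      Nat.card (A →+ ZMod (p ^ (k + 1))) = Nat.card (B →+ ZMod (p ^ (k + 1))))
    (G : Type*) [AddCommGroup G] [Finite G] (hG : ∀ x : G, a • x = 0) :
    Nat.card (A →+ G) = Nat.card (B →+ G) := by
  obtain ⟨ι, _, p, hp, e, ⟨φ⟩⟩ := AddCommGroup.equiv_directSum_zmod_of_finite G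
  have φ' := φ.trans (DirectSum.addEquivProd fun i => ZMod (p i ^ e i))
  rw [natCard_addMonoidHom_congr (AddEquiv.refl A) φ', natCard_addMonoidHom_congr (AddEquiv.refl B) φ',
    natCard_addMonoidHom_pi, natCard_addMonoidHom_pi]
  refine Finset.prod_congr rfl fun i _ => ?_
  rcases Nat.eq_zero_or_pos (e i) with h0 | h0
  · have hsub : Subsingleton (ZMod (p i ^ e i)) := by rw [h0, pow_zero]; infer_instance
    have h1 : ∀ (D : Type _) [AddCommGroup D], Nat.card (D →+ ZMod (p i ^ e i)) = 1 := fun D _ =>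
      Nat.card_eq_one_iff_unique.2 ⟨⟨fun f g => by ext x; exact Subsingleton.elim _ _⟩, ⟨0⟩⟩
    rw [h1, Nat.card_eq_one_iff_unique.2 ⟨⟨fun f g => by ext x; exact Subsingleton.elim _ _⟩, ⟨0⟩⟩]
  · obtain ⟨k, hk⟩ := Nat.exists_eq_succ_of_ne_zero h0.ne'
    rw [hk]
    refine h _ _ (hp i) ?_
    rw [← Nat.succ_eq_add_one, ← hk, ← ZMod.natCast_eq_zero_iff]
    have h2 : a • (Pi.single i 1 : ∀ i, ZMod (p i ^ e i)) = 0 := by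
      rw [← φ'.apply_symm_apply (Pi.single i 1), ← map_nsmul, hG, map_zero]
    have h3 := congrFun h2 i
    simpa using h3

/-- Finite abelian groups killed by `a` are determined by the numbers of their homomorphisms
to cyclic groups whose orders are prime powers dividing `a`. -/
lemma nonempty_addEquiv_of_natCard_hom_eq {A B : Type*} [AddCommGroup A] [AddCommGroup B] [Finite A]
    [Finite B] {a : ℕ} (hA : ∀ x : A, a • x = 0) (hB : ∀ x : B, a • x = 0)
    (h : ∀ p k : ℕ, p.Prime → p ^ (k + 1) ∣ a →
      Nat.card (A →+ ZMod (p ^ (k + 1))) = Nat.card (B →+ ZMod (p ^ (k + 1)))) :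
    Nonempty (A ≃+ B) := by
  have hs : ∀ (D : Type _) [AddCommGroup D] [Finite D], (∀ x : D, a • x = 0) →
      Nat.card {f : A →+ D // Function.Surjective f} =
        Nat.card {f : B →+ D // Function.Surjective f} := fun D _ _ hD =>
    natCard_surjective_eq_of_natCard_hom_eq (fun K _ _ => natCard_hom_eq_of_primePow h K) D hD
  -- This repeats `hs` for `A` because `A` and `B` may live in different universes.
  have hs' : Nat.card {f : A →+ A // Function.Surjective f} =
        Nat.card {f : B →+ A // Function.Surjective f} :=
    natCard_surjective_eq_of_natCard_hom_eq (fun K _ _ => natCard_hom_eq_of_primePow h K) A hA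
  have := AddMonoidHom.finite_of_finite A A
  have := AddMonoidHom.finite_of_finite B B
  have hBB : Nat.card {f : B →+ B // Function.Surjective f} ≠ 0 :=
    Nat.card_ne_zero.2 ⟨⟨AddMonoidHom.id B, Function.surjective_id⟩, inferInstance⟩
  have hAA : Nat.card {f : A →+ A // Function.Surjective f} ≠ 0 :=
    Nat.card_ne_zero.2 ⟨⟨AddMonoidHom.id A, Function.surjective_id⟩, inferInstance⟩
  rw [hs'] at hAA
  rw [← hs B hB] at hBB
  obtain ⟨f, hf⟩ := (Nat.card_ne_zero.1 hBB).1
  obtain ⟨g, hg⟩ := (Nat.card_ne_zero.1 hAA).1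
  have hcard : Nat.card A = Nat.card B :=
    le_antisymm (Nat.card_le_card_of_surjective g hg) (Nat.card_le_card_of_surjective f hf)
  exact ⟨AddEquiv.ofBijective f ((Nat.bijective_iff_surjective_and_card f).2 ⟨hf, hcard⟩)⟩

/-- The Chinese remainder theorem gives a multiplier `u` acting as the projection to `G`, so every
subgroup contains the projections of its elements and is a product. -/
lemma natCard_addSubgroup_prod (G H : Type*) [AddCommGroup G] [AddCommGroup H] [Finite G] [Finite H]
    (hcop : (Nat.card G).Coprime (Nat.card H)) :
    Nat.card (AddSubgroup (G × H)) = Nat.card (AddSubgroup G) * Nat.card (AddSubgroup H) := by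
  rw [← Nat.card_prod]
  symm
  refine Nat.card_congr (Equiv.ofBijective (fun KL => KL.1.prod KL.2) ⟨?_, fun D => ?_⟩)
  · rintro ⟨K, L⟩ ⟨K', L'⟩ h
    simp only at h
    have h1 : K = K' := by
      ext x
      have : ((x, 0) : G × H) ∈ K.prod L ↔ (x, 0) ∈ K'.prod L' := by rw [h]
      simpa [AddSubgroup.mem_prod] using this
    have h2 : L = L' := by
      ext x
      have : ((0, x) : G × H) ∈ K.prod L ↔ (0, x) ∈ K'.prod L' := by rw [h]
      simpa [AddSubgroup.mem_prod] using this
    rw [h1, h2]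
  · refine ⟨(D.map (AddMonoidHom.fst G H), D.map (AddMonoidHom.snd G H)), ?_⟩
    obtain ⟨u, hu1, hu2⟩ := Nat.chineseRemainder hcop 1 0
    have e1 : ∀ x : G, u • x = x := fun x => by
      have := (nsmul_eq_nsmul_iff_modEq (n := u) (m := 1) (x := x)).2
        (hu1.of_dvd (addOrderOf_dvd_natCard x))
      rw [this, one_smul]
    have e2 : ∀ y : H, u • y = 0 := fun y => by
      have := (nsmul_eq_nsmul_iff_modEq (n := u) (m := 0) (x := y)).2
        (hu2.of_dvd (addOrderOf_dvd_natCard y))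
      rw [this, zero_smul]
    have hx : ∀ x y, (x, y) ∈ D → (x, (0 : H)) ∈ D := fun x y hxy => by
      have := D.nsmul_mem hxy u
      rwa [Prod.smul_mk, e1, e2] at this
    ext ⟨x, y⟩
    simp only [AddSubgroup.mem_prod, AddSubgroup.mem_map]
    constructor
    · rintro ⟨⟨⟨x', y'⟩, h1, rfl⟩, ⟨⟨x'', y''⟩, h2, rfl⟩⟩
      have h3 := D.add_mem (hx _ _ h1) (D.sub_mem h2 (hx _ _ h2))
      simpa using h3
    · intro h
      exact ⟨⟨_, h, rfl⟩, ⟨_, h, rfl⟩⟩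

/-- Each subspace of dimension `r` has at least `p ^ (r * (r - 1))` ordered bases, and different
subspaces have different bases among the `p ^ (r * m)` tuples. -/
lemma natCard_submodule_finrank_le {p : ℕ} [Fact p.Prime] (V : Type*) [AddCommGroup V]
    [Module (ZMod p) V] [Finite V] {m r : ℕ} (hm : Nat.card V = p ^ m) (hr : r ≤ m) :
    Nat.card {S : Submodule (ZMod p) V // Module.finrank (ZMod p) S = r} ≤ p ^ (r * (m + 1 - r)) := by
  have hp := (Fact.out : p.Prime)
  have hp1 : 1 ≤ p := hp.one_lt.le
  set I := {S : Submodule (ZMod p) V // Module.finrank (ZMod p) S = r} with hI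
  have := Fintype.ofFinite I
  have h1 : Nat.card (Σ S : I, {v : Fin r → S.1 // LinearIndependent (ZMod p) v}) ≤
      Nat.card (Fin r → V) := by
    refine Nat.card_le_card_of_injective (fun s i => ((s.2.1 i : s.1.1) : V)) ?_
    rintro ⟨⟨S, hS⟩, v, hv⟩ ⟨⟨S', hS'⟩, v', hv'⟩ h
    simp only at h
    have hspan : ∀ (S : Submodule (ZMod p) V) (hS : Module.finrank (ZMod p) S = r) (v : Fin r → S),
        LinearIndependent (ZMod p) v → Submodule.span (ZMod p) (Set.range fun i => (v i : V)) = S := by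
      intro S hS v hv
      have := hv.span_eq_top_of_card_eq_finrank' (by rw [Fintype.card_fin, hS])
      have h2 := congrArg (Submodule.map S.subtype) this
      rw [Submodule.map_span, Submodule.map_top, Submodule.range_subtype, ← Set.range_comp] at h2
      exact h2
    have hSS : S = S' := by rw [← hspan S hS v hv, ← hspan S' hS' v' hv', h]
    subst hSS
    have : v = v' := by ext i; exact congrFun h i
    subst this
    rfl
  have h2 : ∀ S : I, p ^ (r * (r - 1)) ≤
      Nat.card {v : Fin r → S.1 // LinearIndependent (ZMod p) v} := by
    intro S
    rw [card_linearIndependent (K := ZMod p) S.2.ge, S.2, ZMod.card]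
    calc p ^ (r * (r - 1)) = ∏ _i : Fin r, p ^ (r - 1) := by
          rw [Finset.prod_const, Finset.card_univ, Fintype.card_fin, ← pow_mul, mul_comm]
      _ ≤ _ := by
          refine Finset.prod_le_prod (fun _ _ => Nat.zero_le _) fun i _ => ?_
          have hi := i.2
          have h3 : p ^ (i : ℕ) ≤ p ^ (r - 1) := Nat.pow_le_pow_right hp1 (by omega)
          have h4 : p ^ r = p * p ^ (r - 1) := by
            rw [← pow_succ']; congr 1; omega
          have h5 : 2 * p ^ (r - 1) ≤ p * p ^ (r - 1) := Nat.mul_le_mul_right _ hp.two_le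
          omega
  rw [Nat.card_sigma] at h1
  have h3 : Fintype.card I * p ^ (r * (r - 1)) ≤ p ^ (r * m) := by
    calc _ ≤ ∑ S : I, Nat.card {v : Fin r → S.1 // LinearIndependent (ZMod p) v} := by
          rw [← smul_eq_mul, ← Finset.card_univ]
          exact Finset.card_nsmul_le_sum _ _ _ fun S _ => h2 S
      _ ≤ _ := h1
      _ = _ := by rw [Nat.card_fun, hm, Nat.card_eq_fintype_card, Fintype.card_fin, ← pow_mul, mul_comm]
  rw [Nat.card_eq_fintype_card]
  have h4 : p ^ (r * m) = p ^ (r * (m + 1 - r)) * p ^ (r * (r - 1)) := by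
    rw [← pow_add, ← Nat.mul_add]
    rcases Nat.eq_zero_or_pos r with rfl | h0
    · simp
    · congr 2; omega
  rw [h4] at h3
  exact Nat.le_of_mul_le_mul_right h3 (by positivity)

/-- Summation over the dimension `r`, using `r * (m + 1 - r) ≤ (m + 1)² / 4`. -/
lemma natCard_submodule_le {p : ℕ} [Fact p.Prime] (V : Type*) [AddCommGroup V]
    [Module (ZMod p) V] [Finite V] {m : ℕ} (hm : Nat.card V = p ^ m) :
    Nat.card (Submodule (ZMod p) V) ≤ (m + 1) * p ^ ((m + 1) ^ 2 / 4) := by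
  have hp := (Fact.out : p.Prime)
  have : Module.Finite (ZMod p) V := Module.Finite.of_finite
  have hfr : Module.finrank (ZMod p) V = m := by
    have := Module.natCard_eq_pow_finrank (K := ZMod p) (V := V)
    rw [hm, Nat.card_zmod] at this
    exact (Nat.pow_right_injective hp.two_le this).symm
  let F : Submodule (ZMod p) V → Fin (m + 1) := fun S =>
    ⟨Module.finrank (ZMod p) S, Nat.lt_succ_of_le (hfr ▸ Submodule.finrank_le S)⟩
  rw [Nat.card_congr (Equiv.sigmaFiberEquiv F).symm, Nat.card_sigma]
  refine (Finset.sum_le_card_nsmul _ _ (p ^ ((m + 1) ^ 2 / 4)) fun r _ => ?_).trans (by simp)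
  have hr : (r : ℕ) ≤ m := Nat.lt_succ_iff.1 r.2
  rw [Nat.card_congr (Equiv.subtypeEquivRight fun S => (Fin.ext_iff : F S = r ↔ _))]
  refine (natCard_submodule_finrank_le V hm hr).trans (Nat.pow_le_pow_right hp.pos ?_)
  rw [Nat.le_div_iff_mul_le (by norm_num)]
  obtain ⟨t, ht⟩ := Nat.exists_eq_add_of_le (hr.trans (Nat.le_succ m))
  rw [Nat.succ_eq_add_one] at ht
  have hsub : m + 1 - r = t := by omega
  have hsq : (m + 1) ^ 2 = ((r : ℕ) + t) ^ 2 := congrArg (· ^ 2) ht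
  rw [hsub, hsq]
  have := four_mul_le_sq_add (r : ℕ) t
  linarith

lemma natCard_addSubgroup_le {p : ℕ} (hp : p.Prime) (V : Type*) [AddCommGroup V] [Finite V]
    (hV : ∀ x : V, p • x = 0) {m : ℕ} (hm : Nat.card V = p ^ m) :
    Nat.card (AddSubgroup V) ≤ (m + 1) * p ^ ((m + 1) ^ 2 / 4) := by
  have := Fact.mk hp
  let _ : Module (ZMod p) V := AddCommGroup.zmodModule hV
  rw [Nat.card_congr (AddSubgroup.toZModSubmodule p (M := V)).toEquiv]
  exact natCard_submodule_le V hm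
end HomCounts

/-! ### Profile moments as homomorphism counts, and their growth. -/

section HomProfileMoments
open scoped Classical

/-- The group `(ZMod p) ^ m₀ × (ZMod (p ^ 2)) ^ m₁ × …`. -/
abbrev PrimePowerGroup (p k : ℕ) (m : Fin (k + 1) → ℕ) : Type :=
  ∀ i : Fin (k + 1), Fin (m i) → ZMod (p ^ ((i : ℕ) + 1))

lemma natCard_addMonoidHom_primePowerGroup (p k : ℕ) (m : Fin (k + 1) → ℕ) (A : Type*)
    [AddCommGroup A] :
    Nat.card (A →+ PrimePowerGroup p k m) = ∏ i, homProfile p k A i ^ m i := by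
  rw [natCard_addMonoidHom_pi]
  refine Finset.prod_congr rfl fun i _ => ?_
  rw [natCard_addMonoidHom_pi]
  simp [homProfile]

lemma natCard_primePowerGroup (p k : ℕ) (m : Fin (k + 1) → ℕ) :
    Nat.card (PrimePowerGroup p k m) = p ^ ∑ i : Fin (k + 1), ((i : ℕ) + 1) * m i := by
  rw [Nat.card_pi, ← Finset.prod_pow_eq_pow_sum]
  refine Finset.prod_congr rfl fun i _ => ?_
  rw [Nat.card_fun, Nat.card_zmod, Nat.card_eq_fintype_card, Fintype.card_fin, pow_mul]

lemma smul_primePowerGroup_single (p k t : ℕ) (x : PrimePowerGroup p k (Pi.single 0 t)) :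
    p • x = 0 := by
  funext i j
  rcases eq_or_ne i 0 with rfl | hi
  · have : (p : ZMod (p ^ (((0 : Fin (k + 1)) : ℕ) + 1))) = 0 := by
      rw [ZMod.natCast_eq_zero_iff, Fin.val_zero, zero_add, pow_one]
    rw [Pi.smul_apply, Pi.smul_apply, nsmul_eq_mul, this, zero_mul]; rfl
  · have : (Pi.single 0 t : Fin (k + 1) → ℕ) i = 0 := by rw [Pi.single_eq_of_ne hi]
    exact absurd (lt_of_lt_of_eq j.2 this) (Nat.not_lt_zero _)

lemma natCard_addSubgroup_primePowerGroup_single_le {p : ℕ} (hp : p.Prime) (k t : ℕ) :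
    Nat.card (AddSubgroup (PrimePowerGroup p k (Pi.single 0 t))) ≤
      (t + 1) * p ^ ((t + 1) ^ 2 / 4) := by
  have : ∀ i, NeZero (p ^ i) := fun i => ⟨pow_ne_zero i hp.ne_zero⟩
  refine natCard_addSubgroup_le hp _ (smul_primePowerGroup_single p k t) ?_
  rw [natCard_primePowerGroup]
  congr 1
  rw [Finset.sum_eq_single 0 (fun i _ hi => by rw [Pi.single_eq_of_ne hi, mul_zero])
    (fun h => absurd (Finset.mem_univ _) h)]
  simp

/-- This is the determinacy condition of the moment method. The product is `p` to the power `-s²/2`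
and the subgroup count `p` to the power `s²/4`, up to exponents linear in `s`. -/
lemma tendsto_prod_mul_natCard_addSubgroup {p : ℕ} (hp : p.Prime) (k D : ℕ) :
    Tendsto (fun s : ℕ => (∏ j ∈ Finset.range (s + 1), ((p : ℝ) / (p : ℝ) ^ j)) *
      (Nat.card (AddSubgroup (PrimePowerGroup p k (Pi.single 0 (s + D)))) : ℝ)) atTop (𝓝 0) := by
  have hp1 : (1 : ℝ) < p := by exact_mod_cast hp.one_lt
  have hp0 : (0 : ℝ) < p := zero_lt_one.trans hp1
  have hlim : Tendsto (fun s : ℕ => ((p : ℝ)⁻¹) ^ s) atTop (𝓝 0) :=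
    tendsto_pow_atTop_nhds_zero_of_lt_one (by positivity) (inv_lt_one_of_one_lt₀ hp1)
  refine squeeze_zero' (Eventually.of_forall fun s => by positivity) ?_ hlim
  filter_upwards [eventually_ge_atTop (4 * (D + 1) + 20)] with s hs
  have h1 : ∏ j ∈ Finset.range (s + 1), ((p : ℝ) / (p : ℝ) ^ j) =
      (p : ℝ) ^ (s + 1) / (p : ℝ) ^ (∑ j ∈ Finset.range (s + 1), j) := by
    rw [Finset.prod_div_distrib, Finset.prod_const, Finset.card_range,
      Finset.prod_pow_eq_pow_sum]
  have h2 : (Nat.card (AddSubgroup (PrimePowerGroup p k (Pi.single 0 (s + D)))) : ℝ) ≤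
      (p : ℝ) ^ (s + D + 1 + (s + D + 1) ^ 2 / 4) := by
    have h3 := natCard_addSubgroup_primePowerGroup_single_le hp k (s + D)
    have h4 : s + D + 1 ≤ p ^ (s + D + 1) := (Nat.lt_pow_self hp.one_lt).le
    rw [pow_add]
    exact_mod_cast h3.trans (Nat.mul_le_mul_right _ h4)
  rw [h1]
  have h5 : s + 1 + (s + D + 1 + (s + D + 1) ^ 2 / 4) + s ≤ ∑ j ∈ Finset.range (s + 1), j := by
    have h6 := Finset.sum_range_id_mul_two (s + 1)
    rw [Nat.add_sub_cancel] at h6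
    have h7 : (s + D + 1) ^ 2 / 4 * 4 ≤ (s + D + 1) ^ 2 := Nat.div_mul_le_self _ _
    obtain ⟨r, rfl⟩ := Nat.exists_eq_add_of_le hs
    nlinarith [Nat.zero_le (r * D), Nat.zero_le (D * D), Nat.zero_le (r * r)]
  calc _ ≤ (p : ℝ) ^ (s + 1) / (p : ℝ) ^ (∑ j ∈ Finset.range (s + 1), j) *
        (p : ℝ) ^ (s + D + 1 + (s + D + 1) ^ 2 / 4) := by gcongr
    _ ≤ _ := by
        rw [div_mul_eq_mul_div, ← pow_add, inv_pow, ← one_div, div_le_div_iff₀ (by positivity)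
          (by positivity), one_mul, ← pow_add]
        exact pow_le_pow_right₀ hp1.le h5

lemma solCount_eq_natCard_linearMap {R : Type*} [CommRing R] {n : ℕ} (X : Matrix (Fin n) (Fin n) R)
    (G : Type*) [AddCommGroup G] [Module R G] : solCount X G = Nat.card (X.Coker →ₗ[R] G) := by
  rw [solCount]
  have h : ∀ F : (Fin n → R) →ₗ[R] G, (∀ j, ∑ i, X i j • F (Pi.single i 1) = 0) ↔
      LinearMap.range X.mulVecLin ≤ LinearMap.ker F := by
    intro F
    have h1 : ∀ j, F (X.mulVecLin (Pi.single j 1)) = ∑ i, X i j • F (Pi.single i 1) := by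
      intro j
      conv_lhs => rw [← Finset.univ_sum_single (X.mulVecLin (Pi.single j 1))]
      rw [map_sum]
      refine Finset.sum_congr rfl fun i _ => ?_
      rw [← map_smul, ← Pi.single_smul, smul_eq_mul, mul_one, Matrix.mulVecLin_apply,
        Matrix.mulVec_single_one, Matrix.col_apply]
    rw [LinearMap.range_le_ker_iff]
    simp only [← h1]
    constructor
    · intro h
      refine LinearMap.pi_ext' fun j => LinearMap.ext_ring ?_
      exact h j
    · intro h j
      exact LinearMap.congr_fun h _
  have hf : ∀ f : Fin n → G, (∀ j, ∑ i, X i j • f i = 0) ↔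
      LinearMap.range X.mulVecLin ≤ LinearMap.ker (Fintype.linearCombination R f) := fun f => by
    rw [← h]
    simp only [Fintype.linearCombination_apply_single, one_smul]
  refine Nat.card_congr
    { toFun := fun f => Submodule.liftQ _ (Fintype.linearCombination R f.1) ((hf f.1).1 f.2)
      invFun := fun F => ⟨fun i => F (Submodule.Quotient.mk (Pi.single i 1)), ?_⟩
      left_inv := fun f => ?_
      right_inv := fun F => ?_ }
  · have := (h (F.comp (Submodule.mkQ _))).2 fun x hx => by
      rw [LinearMap.mem_ker, LinearMap.comp_apply, Submodule.mkQ_apply,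
        (Submodule.Quotient.mk_eq_zero _).2 hx, map_zero]
    exact this
  · ext i
    simp [Submodule.liftQ_apply, Fintype.linearCombination_apply_single]
  · refine Submodule.linearMap_qext _ (LinearMap.pi_ext' fun i => LinearMap.ext_ring ?_)
    simp [Fintype.linearCombination_apply_single]

lemma solCount_eq_natCard_addMonoidHom {a : ℕ} {n : ℕ} (X : Matrix (Fin n) (Fin n) (ZMod a))
    (G : Type*) [AddCommGroup G] [Module (ZMod a) G] : solCount X G = Nat.card (X.Coker →+ G) := by
  rw [solCount_eq_natCard_linearMap]
  exact Nat.card_congr (AddMonoidHom.toZModLinearMapEquiv a).symm.toEquiv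

end HomProfileMoments

/-! ### Reference model: uniform matrices, their moments, and generating tuples. -/

section UniformMatrices
open scoped Classical

lemma AddMonoidHom.natCard_preimage_mul {A B : Type*} [AddCommGroup A] [AddCommGroup B] [Finite A]
    (φ : A →+ B) (hφ : Function.Surjective φ) (Q : B → Prop) :
    Nat.card {x // Q (φ x)} * Nat.card B = Nat.card A * Nat.card {y // Q y} := by
  have h1 := AddSubgroup.card_eq_card_quotient_mul_card_addSubgroup φ.ker
  rw [Nat.card_congr (QuotientAddGroup.quotientKerEquivOfSurjective φ hφ).toEquiv] at h1
  have h2 : Nat.card {x // Q (φ x)} = Nat.card φ.ker * Nat.card {y // Q y} := by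
    rw [← Nat.card_prod]
    refine Nat.card_congr
      { toFun := fun x => (⟨x.1 - Function.surjInv hφ (φ x.1), ?_⟩, ⟨φ x.1, x.2⟩)
        invFun := fun z => ⟨z.1.1 + Function.surjInv hφ z.2.1, ?_⟩
        left_inv := fun x => ?_
        right_inv := fun z => ?_ }
    · rw [AddMonoidHom.mem_ker, map_sub, Function.surjInv_eq hφ, sub_self]
    · rw [map_add, AddMonoidHom.mem_ker.1 z.1.2, zero_add, Function.surjInv_eq hφ]
      exact z.2.2
    · simp
    · have h3 : φ (z.1.1 + Function.surjInv hφ z.2.1) = z.2.1 := by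
        rw [map_add, AddMonoidHom.mem_ker.1 z.1.2, zero_add, Function.surjInv_eq hφ]
      refine Prod.ext (Subtype.ext ?_) (Subtype.ext h3)
      simp [h3]
  rw [h2, h1]
  ring

/-- The number of `n`-tuples that generate `G`. -/
noncomputable def genCount (n : ℕ) (G : Type*) [AddCommGroup G] : ℕ :=
  Nat.card {f : Fin n → G // AddSubgroup.closure (Set.range f) = ⊤}

lemma natCard_closure_range_eq (n : ℕ) {G : Type*} [AddCommGroup G] (K : AddSubgroup G) :
    Nat.card {f : Fin n → G // AddSubgroup.closure (Set.range f) = K} = genCount n K := by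
  have key : ∀ f : Fin n → K, (AddSubgroup.closure (Set.range f)).map K.subtype =
      AddSubgroup.closure (Set.range fun i => (f i : G)) := fun f => by
    rw [AddMonoidHom.map_closure, ← Set.range_comp]; rfl
  refine Nat.card_congr
    { toFun := fun f => ⟨fun i => ⟨f.1 i, ?_⟩, ?_⟩
      invFun := fun f => ⟨fun i => f.1 i, ?_⟩
      left_inv := fun f => rfl
      right_inv := fun f => rfl }
  · exact f.2.le (AddSubgroup.subset_closure ⟨i, rfl⟩)
  · apply AddSubgroup.map_injective K.subtype_injective
    rw [key, ← AddMonoidHom.range_eq_map, K.range_subtype]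
    exact f.2
  · rw [← key, f.2, ← AddMonoidHom.range_eq_map, K.range_subtype]

lemma pow_natCard_eq_sum_genCount (n : ℕ) (G : Type*) [AddCommGroup G] [Finite G]
    [Fintype (AddSubgroup G)] : Nat.card G ^ n = ∑ K : AddSubgroup G, genCount n K := by
  have h : Nat.card (Fin n → G) = Nat.card G ^ n := by
    rw [Nat.card_fun, Nat.card_eq_fintype_card (α := Fin n), Fintype.card_fin]
  rw [← h, Nat.card_congr (Equiv.sigmaFiberEquiv
    fun f : Fin n → G => AddSubgroup.closure (Set.range f)).symm, Nat.card_sigma]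
  exact Finset.sum_congr rfl fun K _ => natCard_closure_range_eq n K

lemma genCount_congr (n : ℕ) {G H : Type*} [AddCommGroup G] [AddCommGroup H] (e : G ≃+ H) :
    genCount n G = genCount n H := by
  refine Nat.card_congr ((Equiv.arrowCongr (Equiv.refl _) e.toEquiv).subtypeEquiv fun f => ?_)
  have : AddSubgroup.closure (Set.range (e ∘ f)) =
      (AddSubgroup.closure (Set.range f)).map e.toAddMonoidHom := by
    rw [AddMonoidHom.map_closure, ← Set.range_comp]; rfl
  change _ ↔ AddSubgroup.closure (Set.range (e ∘ f)) = ⊤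
  rw [this, ← AddSubgroup.map_top_of_surjective e.toAddMonoidHom e.surjective]
  exact (AddSubgroup.map_injective e.injective).eq_iff.symm

lemma genCount_le (n : ℕ) (G : Type*) [AddCommGroup G] [Finite G] :
    genCount n G ≤ Nat.card G ^ n := by
  have h : Nat.card (Fin n → G) = Nat.card G ^ n := by
    rw [Nat.card_fun, Nat.card_eq_fintype_card (α := Fin n), Fintype.card_fin]
  rw [← h]
  exact Nat.card_le_card_of_injective _ Subtype.val_injective

/-- A tuple that does not generate lies in one of finitely many proper subgroups, each exponentially
rare. -/
lemma tendsto_genCount_div (G : Type*) [AddCommGroup G] [Finite G] :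
    Tendsto (fun n => (genCount n G : ℝ) / (Nat.card G : ℝ) ^ n) atTop (𝓝 1) := by
  have := Fintype.ofFinite (AddSubgroup G)
  have hG : (0 : ℝ) < Nat.card G := by exact_mod_cast Nat.card_pos
  have h1 : ∀ n, (genCount n G : ℝ) / (Nat.card G : ℝ) ^ n =
      1 - ∑ K ∈ Finset.univ.erase (⊤ : AddSubgroup G), (genCount n K : ℝ) / (Nat.card G : ℝ) ^ n := by
    intro n
    have h := pow_natCard_eq_sum_genCount n G
    rw [← Finset.sum_erase_add _ _ (Finset.mem_univ (⊤ : AddSubgroup G)),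
      genCount_congr n (AddSubgroup.topEquiv : (⊤ : AddSubgroup G) ≃+ G)] at h
    have h' : (Nat.card G : ℝ) ^ n = (∑ K ∈ Finset.univ.erase (⊤ : AddSubgroup G),
        (genCount n K : ℝ)) + genCount n G := by exact_mod_cast h
    rw [← Finset.sum_div, eq_sub_iff_add_eq, ← add_div, add_comm, ← h', div_self (by positivity)]
  simp_rw [h1]
  suffices h2 : Tendsto (fun n => ∑ K ∈ Finset.univ.erase (⊤ : AddSubgroup G),
      (genCount n K : ℝ) / (Nat.card G : ℝ) ^ n) atTop (𝓝 0) by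
    simpa using h2.const_sub 1
  rw [← Finset.sum_const_zero (s := Finset.univ.erase (⊤ : AddSubgroup G))]
  refine tendsto_finsetSum _ fun K hK => ?_
  have hlt : Nat.card K < Nat.card G := by
    refine lt_of_le_of_ne (AddSubgroup.card_le_card_addGroup K) fun he => ?_
    exact Finset.ne_of_mem_erase hK (AddSubgroup.eq_top_of_card_eq K he)
  refine squeeze_zero (fun n => by positivity) (fun n => ?_)
    (tendsto_pow_atTop_nhds_zero_of_lt_one (r := (Nat.card K : ℝ) / Nat.card G) (by positivity)
      ((div_lt_one hG).2 (by exact_mod_cast hlt)))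
  rw [div_pow]
  gcongr
  exact_mod_cast genCount_le n K

lemma range_linearCombination_eq_closure {a n : ℕ} [NeZero a] {G : Type*} [AddCommGroup G]
    [Module (ZMod a) G] (f : Fin n → G) :
    (Fintype.linearCombination (ZMod a) f).toAddMonoidHom.range =
      AddSubgroup.closure (Set.range f) := by
  apply le_antisymm
  · rintro _ ⟨y, rfl⟩
    change Fintype.linearCombination (ZMod a) f y ∈ _
    rw [Fintype.linearCombination_apply]
    refine sum_mem fun i _ => ?_
    rw [← ZMod.natCast_zmod_val (y i), Nat.cast_smul_eq_nsmul]
    exact AddSubgroup.nsmul_mem _ (AddSubgroup.subset_closure (Set.mem_range_self i)) _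
  · rw [AddSubgroup.closure_le]
    rintro _ ⟨i, rfl⟩
    refine ⟨Pi.single i 1, ?_⟩
    change Fintype.linearCombination (ZMod a) f _ = _
    rw [Fintype.linearCombination_apply_single, one_smul]

/-- For fixed `f`, each column of a uniform matrix is mapped to a uniform element of the subgroup
`K` generated by `f`, so all columns annihilate `f` with probability `|K|^(-n)`. The tuples are then
grouped by `K`. -/
lemma sum_solCount_div {a : ℕ} [NeZero a] (n : ℕ) (G : Type*) [AddCommGroup G] [Finite G]
    [Module (ZMod a) G] [Fintype (AddSubgroup G)] :
    ∑ Y : Matrix (Fin n) (Fin n) (ZMod a), ((a : ℝ) ^ (n * n))⁻¹ * (solCount Y G : ℝ) =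
      ∑ K : AddSubgroup G, (genCount n K : ℝ) / (Nat.card K : ℝ) ^ n := by
  have := Fintype.ofFinite G
  have ha : (0 : ℝ) < a := by exact_mod_cast Nat.pos_of_ne_zero (NeZero.ne a)
  have h1 : ∀ f : Fin n → G, Nat.card {Y : Matrix (Fin n) (Fin n) (ZMod a) //
      ∀ j, ∑ i, Y i j • f i = 0} =
      Nat.card (Fintype.linearCombination (ZMod a) f).toAddMonoidHom.ker ^ n := by
    intro f
    have : Nat.card (Fin n → (Fintype.linearCombination (ZMod a) f).toAddMonoidHom.ker) =
      Nat.card (Fintype.linearCombination (ZMod a) f).toAddMonoidHom.ker ^ n := by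
      rw [Nat.card_fun, Nat.card_eq_fintype_card (α := Fin n), Fintype.card_fin]
    rw [← this]
    exact Nat.card_congr
      { toFun := fun Y j => ⟨fun i => Y.1 i j, Y.2 j⟩
        invFun := fun Y => ⟨fun i j => (Y j).1 i, fun j => (Y j).2⟩
        left_inv := fun Y => rfl
        right_inv := fun Y => rfl }
  have h2 : ∀ f : Fin n → G, (Nat.card {Y : Matrix (Fin n) (Fin n) (ZMod a) //
      ∀ j, ∑ i, Y i j • f i = 0} : ℝ) =
      (a : ℝ) ^ (n * n) / (Nat.card (AddSubgroup.closure (Set.range f)) : ℝ) ^ n := by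
    intro f
    set φ := (Fintype.linearCombination (ZMod a) f).toAddMonoidHom
    have h3 := AddSubgroup.card_eq_card_quotient_mul_card_addSubgroup φ.ker
    rw [Nat.card_congr (QuotientAddGroup.quotientKerEquivRange φ).toEquiv,
      range_linearCombination_eq_closure, Nat.card_fun, Nat.card_zmod,
      Nat.card_eq_fintype_card (α := Fin n), Fintype.card_fin] at h3
    have h4 : (0 : ℝ) < Nat.card (AddSubgroup.closure (Set.range f)) := by
      exact_mod_cast Nat.card_pos
    rw [h1, pow_mul, eq_div_iff (by positivity)]
    push_cast
    rw [← mul_pow, mul_comm, ← Nat.cast_mul, ← h3]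
    push_cast; rfl
  have h5 : ∑ Y : Matrix (Fin n) (Fin n) (ZMod a), solCount Y G =
      ∑ f : Fin n → G, Nat.card {Y : Matrix (Fin n) (Fin n) (ZMod a) //
        ∀ j, ∑ i, Y i j • f i = 0} := by
    simp only [solCount, Nat.card_eq_fintype_card, Fintype.card_subtype, Finset.card_filter]
    exact Finset.sum_comm
  rw [← Finset.mul_sum, ← Nat.cast_sum, h5, Nat.cast_sum, Finset.mul_sum,
    ← Equiv.sum_comp (Equiv.sigmaFiberEquiv
      fun f : Fin n → G => AddSubgroup.closure (Set.range f)), Fintype.sum_sigma]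
  refine Finset.sum_congr rfl fun K _ => ?_
  rw [← natCard_closure_range_eq, Nat.card_eq_fintype_card (α := {f : Fin n → G // _}),
    ← Finset.card_univ, div_eq_mul_inv, ← nsmul_eq_mul, ← Finset.sum_const]
  refine Finset.sum_congr rfl fun f _ => ?_
  rw [h2]
  have : AddSubgroup.closure (Set.range ((Equiv.sigmaFiberEquiv
      fun f : Fin n → G => AddSubgroup.closure (Set.range f)) ⟨K, f⟩)) = K := f.2
  rw [this]
  field_simp

lemma tendsto_uniform_moment {a : ℕ} [NeZero a] (G : Type*) [AddCommGroup G] [Finite G]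
    [Module (ZMod a) G] :
    Tendsto (fun n => ∑ Y : Matrix (Fin n) (Fin n) (ZMod a),
      ((a : ℝ) ^ (n * n))⁻¹ * (solCount Y G : ℝ)) atTop (𝓝 (Nat.card (AddSubgroup G))) := by
  have := Fintype.ofFinite (AddSubgroup G)
  simp_rw [sum_solCount_div]
  rw [Nat.card_eq_fintype_card, ← Finset.card_univ, ← nsmul_one, ← Finset.sum_const]
  exact tendsto_finsetSum _ fun K _ => tendsto_genCount_div K

/-- Nakayama's lemma for finite abelian `p`-groups. -/
lemma AddSubgroup.eq_top_of_forall_exists_sub_smul {N : Type*} [AddCommGroup N] {p K : ℕ}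
    (hN : ∀ x : N, p ^ K • x = 0) (H : AddSubgroup N) (h : ∀ x : N, ∃ y, x - p • y ∈ H) :
    H = ⊤ := by
  have key : ∀ j, ∀ x : N, ∃ y, x - p ^ j • y ∈ H := by
    intro j
    induction j with
    | zero => exact fun x => ⟨x, by simp⟩
    | succ j ih =>
      intro x
      obtain ⟨y, hy⟩ := ih x
      obtain ⟨z, hz⟩ := h y
      refine ⟨z, ?_⟩
      have := H.add_mem hy (H.nsmul_mem hz (p ^ j))
      rwa [nsmul_sub, sub_add_sub_cancel, smul_smul, ← pow_succ] at this
  refine (AddSubgroup.eq_top_iff' H).2 fun x => ?_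
  obtain ⟨y, hy⟩ := key K x
  rwa [hN, sub_zero] at hy

/-- In dimension `n`, generating `n`-tuples are bases. -/
lemma genCount_zmodModule {p : ℕ} [Fact p.Prime] {n : ℕ} (V : Type*) [AddCommGroup V]
    [Module (ZMod p) V] [Finite V] (hV : Nat.card V = p ^ n) :
    genCount n V = ∏ i : Fin n, (p ^ n - p ^ (i : ℕ)) := by
  have hp := (Fact.out : p.Prime)
  have : Module.Finite (ZMod p) V := Module.Finite.of_finite
  have hfr : Module.finrank (ZMod p) V = n := by
    have := Module.natCard_eq_pow_finrank (K := ZMod p) (V := V)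
    rw [hV, Nat.card_zmod] at this
    exact (Nat.pow_right_injective hp.two_le this).symm
  have h1 := card_linearIndependent (K := ZMod p) (V := V) hfr.ge
  rw [hfr, ZMod.card] at h1
  rw [← h1]
  refine Nat.card_congr (Equiv.subtypeEquivRight fun f => ?_)
  rw [linearIndependent_iff_card_eq_finrank_span, Fintype.card_fin, Set.finrank,
    ← range_linearCombination_eq_closure (a := p), ← Fintype.range_linearCombination]
  constructor
  · intro h
    have h2 : LinearMap.range (Fintype.linearCombination (ZMod p) f) = ⊤ := by
      rw [LinearMap.range_eq_top]
      exact AddMonoidHom.range_eq_top.1 h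
    rw [h2, finrank_top, hfr]
  · intro h
    have h2 := Submodule.eq_top_of_finrank_eq (h.symm.trans hfr.symm)
    rw [LinearMap.range_eq_top] at h2
    exact AddMonoidHom.range_eq_top.2 h2

/-- By Nakayama, a tuple generates `N` exactly when its image generates `N / pN`, a space of
dimension `n` over `ZMod p`. The product is the proportion of bases among its `n`-tuples. -/
lemma genCount_mul_eq {p K n : ℕ} (hp : p.Prime) (N : Type*) [AddCommGroup N] [Finite N]
    (hN : ∀ x : N, p ^ K • x = 0)
    (hcard : Nat.card (N ⧸ (nsmulAddMonoidHom p : N →+ N).range) = p ^ n) :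
    (genCount n N : ℝ) = (Nat.card N : ℝ) ^ n * ∏ i ∈ Finset.range n, (1 - ((p : ℝ) ^ (i + 1))⁻¹) := by
  have := Fact.mk hp
  have hp0 : (0 : ℝ) < p := by exact_mod_cast hp.pos
  set S := (nsmulAddMonoidHom p : N →+ N).range with hS
  have hV : ∀ v : N ⧸ S, p • v = 0 := by
    intro v
    obtain ⟨x, rfl⟩ := QuotientAddGroup.mk_surjective v
    rw [← QuotientAddGroup.mk_nsmul, QuotientAddGroup.eq_zero_iff]
    exact ⟨x, rfl⟩
  let _ : Module (ZMod p) (N ⧸ S) := AddCommGroup.zmodModule hV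
  have h1 := genCount_zmodModule (p := p) (N ⧸ S) hcard
  let φ : (Fin n → N) →+ (Fin n → N ⧸ S) := (QuotientAddGroup.mk' S).compLeft (Fin n)
  have hφ : Function.Surjective φ := fun v =>
    ⟨fun i => Function.surjInv QuotientAddGroup.mk_surjective (v i), by
      ext i; exact Function.surjInv_eq QuotientAddGroup.mk_surjective _⟩
  have h2 := φ.natCard_preimage_mul hφ fun v => AddSubgroup.closure (Set.range v) = ⊤
  have h3 : ∀ f : Fin n → N, AddSubgroup.closure (Set.range (φ f)) = ⊤ ↔
      AddSubgroup.closure (Set.range f) = ⊤ := by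
    intro f
    have h4 : AddSubgroup.closure (Set.range (φ f)) =
        (AddSubgroup.closure (Set.range f)).map (QuotientAddGroup.mk' S) := by
      rw [AddMonoidHom.map_closure, ← Set.range_comp]; rfl
    rw [h4]
    constructor
    · intro h
      refine AddSubgroup.eq_top_of_forall_exists_sub_smul hN _ fun x => ?_
      obtain ⟨z, hz, hzx⟩ : QuotientAddGroup.mk' S x ∈
        (AddSubgroup.closure (Set.range f)).map (QuotientAddGroup.mk' S) := by rw [h]; trivial
      obtain ⟨y, hy⟩ := QuotientAddGroup.eq.1 hzx
      refine ⟨y, ?_⟩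
      have : x - p • y = z := by
        have : p • y = -z + x := hy
        rw [this]; abel
      rwa [this]
    · intro h
      rw [h]
      exact AddSubgroup.map_top_of_surjective _ (QuotientAddGroup.mk'_surjective S)
  rw [Nat.card_congr (Equiv.subtypeEquivRight h3)] at h2
  change genCount n N * _ = _ * genCount n (N ⧸ S) at h2
  rw [h1, Nat.card_fun, Nat.card_fun, hcard, Nat.card_eq_fintype_card (α := Fin n),
    Fintype.card_fin] at h2
  have h5 : ((∏ i : Fin n, (p ^ n - p ^ (i : ℕ)) : ℕ) : ℝ) =
      ((p : ℝ) ^ n) ^ n * ∏ i ∈ Finset.range n, (1 - ((p : ℝ) ^ (i + 1))⁻¹) := by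
    rw [Fin.prod_univ_eq_prod_range (fun i => p ^ n - p ^ i), ← Finset.prod_range_reflect,
      Nat.cast_prod]
    have h6 : ((p : ℝ) ^ n) ^ n = ∏ _i ∈ Finset.range n, (p : ℝ) ^ n := by simp
    rw [h6, ← Finset.prod_mul_distrib]
    refine Finset.prod_congr rfl fun i hi => ?_
    rw [Finset.mem_range] at hi
    rw [Nat.cast_sub (Nat.pow_le_pow_right hp.pos (by omega))]
    push_cast
    have h7 : (p : ℝ) ^ n = (p : ℝ) ^ (n - 1 - i) * (p : ℝ) ^ (i + 1) := by
      rw [← pow_add]; congr 1; omega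
    rw [mul_sub, mul_one, h7, mul_assoc, mul_inv_cancel₀ (by positivity), mul_one]
  have h8 : (genCount n N : ℝ) * ((p : ℝ) ^ n) ^ n = (Nat.card N : ℝ) ^ n *
      (((p : ℝ) ^ n) ^ n * ∏ i ∈ Finset.range n, (1 - ((p : ℝ) ^ (i + 1))⁻¹)) := by
    rw [← h5]
    exact_mod_cast h2
  have h9 : ((p : ℝ) ^ n) ^ n ≠ 0 := by positivity
  apply mul_right_cancel₀ h9
  rw [h8]; ring

lemma ZMod.exists_eq_pow_mul_of_smul_eq_zero {p : ℕ} (hp : p.Prime) (K : ℕ)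
    {x : ZMod (p ^ (K + 1))} (h : p • x = 0) : ∃ c : ℕ, x = c • ((p ^ K : ℕ) : ZMod (p ^ (K + 1))) := by
  have : NeZero (p ^ (K + 1)) := ⟨pow_ne_zero _ hp.ne_zero⟩
  have hx : ((p * x.val : ℕ) : ZMod (p ^ (K + 1))) = 0 := by
    rw [Nat.cast_mul, ZMod.natCast_zmod_val, ← nsmul_eq_mul, h]
  rw [ZMod.natCast_eq_zero_iff] at hx
  obtain ⟨c, hc⟩ : p ^ K ∣ x.val :=
    Nat.dvd_of_mul_dvd_mul_left hp.pos ((dvd_of_eq (pow_succ' p K).symm).trans hx)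
  refine ⟨c, ?_⟩
  rw [nsmul_eq_mul, ← Nat.cast_mul, mul_comm, ← hc, ZMod.natCast_zmod_val]

lemma natCard_zmod_torsion {p : ℕ} (hp : p.Prime) (K : ℕ) :
    Nat.card {x : ZMod (p ^ (K + 1)) // p • x = 0} = p := by
  have h1 : addOrderOf ((p ^ K : ℕ) : ZMod (p ^ (K + 1))) = p := by
    rw [ZMod.addOrderOf_coe' _ (pow_ne_zero _ hp.ne_zero),
      Nat.gcd_eq_right (pow_dvd_pow p (Nat.le_succ K)), pow_succ,
      Nat.mul_div_cancel_left _ (pow_pos hp.pos K)]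
  rw [← Nat.card_zmultiples] at h1
  refine Eq.trans ?_ h1
  refine Nat.card_congr (Equiv.subtypeEquivRight fun x => ?_)
  rw [AddSubgroup.mem_zmultiples_iff]
  constructor
  · intro h
    obtain ⟨c, hc⟩ := ZMod.exists_eq_pow_mul_of_smul_eq_zero hp K h
    exact ⟨c, by rw [natCast_zsmul, ← hc]⟩
  · rintro ⟨z, rfl⟩
    rw [smul_comm, nsmul_eq_mul, ← Nat.cast_mul, ← pow_succ', ZMod.natCast_self, smul_zero]

end UniformMatrices

/-! ### Exact law of the cokernel of a uniform matrix. -/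

section UniformCokernel
open scoped Classical

/-- For a finite group, `N / pN` and the `p`-torsion of `N` have the same order. The `p`-torsion of
the free module consists of multiples of `p ^ K`, which `F` kills, so it all lies in the kernel.
This is why the modulus is `p ^ (K + 1)` for a group killed by `p ^ K`. -/
lemma natCard_quotient_range_nsmul_ker {p : ℕ} (hp : p.Prime) {K n : ℕ} {G : Type*}
    [AddCommGroup G] (hG : ∀ x : G, p ^ K • x = 0) (F : (Fin n → ZMod (p ^ (K + 1))) →+ G) :
    Nat.card (F.ker ⧸ (nsmulAddMonoidHom p : F.ker →+ F.ker).range) = p ^ n := by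
  have : NeZero (p ^ (K + 1)) := ⟨pow_ne_zero _ hp.ne_zero⟩
  set φ := (nsmulAddMonoidHom p : F.ker →+ F.ker) with hφ
  have h1 := AddSubgroup.card_eq_card_quotient_mul_card_addSubgroup φ.ker
  rw [Nat.card_congr (QuotientAddGroup.quotientKerEquivRange φ).toEquiv, mul_comm] at h1
  rw [AddSubgroup.card_eq_card_quotient_mul_card_addSubgroup φ.range] at h1
  rw [Nat.eq_of_mul_eq_mul_right Nat.card_pos h1]
  have h2 : Nat.card (Fin n → {x : ZMod (p ^ (K + 1)) // p • x = 0}) = p ^ n := by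
    rw [Nat.card_fun, natCard_zmod_torsion hp, Nat.card_eq_fintype_card, Fintype.card_fin]
  rw [← h2]
  refine Nat.card_congr
    { toFun := fun x i => ⟨x.1.1 i, congrFun (congrArg Subtype.val x.2) i⟩
      invFun := fun x => ⟨⟨fun i => (x i).1, ?_⟩, Subtype.ext (funext fun i => (x i).2)⟩
      left_inv := fun x => rfl
      right_inv := fun x => rfl }
  choose c hc using fun i => ZMod.exists_eq_pow_mul_of_smul_eq_zero hp K (x i).2
  have h3 : (fun i => (x i).1) = p ^ K • fun i => ((c i : ℕ) : ZMod (p ^ (K + 1))) := by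
    funext i
    rw [hc i, Pi.smul_apply, nsmul_eq_mul, nsmul_eq_mul, mul_comm]
  rw [h3, AddMonoidHom.mem_ker, map_nsmul, hG]

lemma natCard_matrix_range_eq {a n : ℕ} [NeZero a] (N : Submodule (ZMod a) (Fin n → ZMod a)) :
    Nat.card {Y : Matrix (Fin n) (Fin n) (ZMod a) // LinearMap.range Y.mulVecLin = N} =
      genCount n N := by
  refine Eq.trans ?_ (natCard_closure_range_eq n N.toAddSubgroup)
  refine Nat.card_congr ((Matrix.transposeAddEquiv (Fin n) (Fin n) (ZMod a)).toEquiv.subtypeEquiv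
    fun Y => ?_)
  change _ ↔ AddSubgroup.closure (Set.range fun j i => Y i j) = _
  rw [← range_linearCombination_eq_closure (a := a)]
  have h : Fintype.linearCombination (ZMod a) (fun j i => Y i j) = Y.mulVecLin := by
    ext i j
    simp [Fintype.linearCombination_apply_single]
  rw [← Submodule.toAddSubgroup_inj, ← h]
  rfl

lemma natCard_coker_equiv {a n : ℕ} [NeZero a] (Y : Matrix (Fin n) (Fin n) (ZMod a)) (G : Type*)
    [AddCommGroup G] [Module (ZMod a) G] :
    Nat.card {f : Fin n → G // LinearMap.range (Fintype.linearCombination (ZMod a) f) = ⊤ ∧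
      LinearMap.range Y.mulVecLin = LinearMap.ker (Fintype.linearCombination (ZMod a) f)} =
    Nat.card (Y.Coker ≃+ G) := by
  symm
  have key : ∀ e : Y.Coker ≃+ G, Fintype.linearCombination (ZMod a)
      (fun i => e (Submodule.Quotient.mk (Pi.single i 1))) =
      (e.toAddMonoidHom.toZModLinearMap a).comp (Submodule.mkQ _) := by
    intro e
    refine LinearMap.pi_ext' fun i => LinearMap.ext_ring ?_
    simp [Fintype.linearCombination_apply_single]
  refine Nat.card_congr (Equiv.ofBijective
    (fun e => ⟨fun i => e (Submodule.Quotient.mk (Pi.single i 1)), ?_, ?_⟩) ⟨?_, ?_⟩)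
  · rw [key, LinearMap.range_eq_top]
    exact e.surjective.comp (Submodule.mkQ_surjective _)
  · rw [key]
    ext x
    rw [LinearMap.mem_ker, LinearMap.comp_apply, AddMonoidHom.coe_toZModLinearMap]
    change _ ↔ e _ = 0
    rw [map_eq_zero_iff e e.injective, Submodule.mkQ_apply, Submodule.Quotient.mk_eq_zero]
  · intro e e' h
    have h1 := congrArg Subtype.val h
    simp only at h1
    have h2 := (key e).symm.trans ((congrArg _ h1).trans (key e'))
    ext x
    obtain ⟨x, rfl⟩ := Submodule.mkQ_surjective _ x
    exact LinearMap.congr_fun h2 x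
  · rintro ⟨f, hf1, hf2⟩
    refine ⟨((Submodule.quotEquivOfEq _ _ hf2).trans (LinearMap.quotKerEquivOfSurjective
      (Fintype.linearCombination (ZMod a) f) (LinearMap.range_eq_top.1 hf1))).toAddEquiv, ?_⟩
    apply Subtype.ext
    funext i
    change Fintype.linearCombination (ZMod a) f (Pi.single i 1) = f i
    rw [Fintype.linearCombination_apply_single, one_smul]

/-- Double counting of pairs of a matrix and an isomorphism from its cokernel to `G`; such an
isomorphism is a generating tuple of `G` whose relations are exactly the column space. -/
lemma natCard_coker_equiv_mul {a n : ℕ} [NeZero a] (G : Type*) [AddCommGroup G] [Finite G]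
    [Module (ZMod a) G]
    [Fintype {f : Fin n → G // LinearMap.range (Fintype.linearCombination (ZMod a) f) = ⊤}] :
    Nat.card {Y : Matrix (Fin n) (Fin n) (ZMod a) // Nonempty (Y.Coker ≃+ G)} *
      Nat.card (G ≃+ G) =
    ∑ f : {f : Fin n → G // LinearMap.range (Fintype.linearCombination (ZMod a) f) = ⊤},
      genCount n (LinearMap.ker (Fintype.linearCombination (ZMod a) f.1)) := by
  have hfin : Finite (G ≃+ G) := DFunLike.finite _
  rw [← Nat.card_prod]
  simp_rw [← natCard_matrix_range_eq]
  rw [← Nat.card_sigma]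
  have h1 : Nat.card (Σ f : {f : Fin n → G // LinearMap.range
      (Fintype.linearCombination (ZMod a) f) = ⊤}, {Y : Matrix (Fin n) (Fin n) (ZMod a) //
        LinearMap.range Y.mulVecLin = LinearMap.ker (Fintype.linearCombination (ZMod a) f.1)}) =
      Nat.card (Σ Y : Matrix (Fin n) (Fin n) (ZMod a),
        {f : Fin n → G // LinearMap.range (Fintype.linearCombination (ZMod a) f) = ⊤ ∧
      LinearMap.range Y.mulVecLin = LinearMap.ker (Fintype.linearCombination (ZMod a) f)}) :=
    Nat.card_congr
      { toFun := fun s => ⟨s.2.1, s.1.1, s.1.2, s.2.2⟩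
        invFun := fun s => ⟨⟨s.2.1, s.2.2.1⟩, s.1, s.2.2.2⟩
        left_inv := fun s => rfl
        right_inv := fun s => rfl }
  rw [h1, Nat.card_sigma]
  simp_rw [natCard_coker_equiv]
  rw [Nat.card_prod, Nat.card_eq_fintype_card (α := {Y : Matrix (Fin n) (Fin n) (ZMod a) // _}),
    Fintype.card_subtype, ← smul_eq_mul, ← Finset.sum_const, Finset.sum_filter]
  refine Finset.sum_congr rfl fun Y _ => ?_
  split_ifs with h
  · obtain ⟨e⟩ := h
    exact Nat.card_congr
      { toFun := fun f => e.trans f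
        invFun := fun f => e.symm.trans f
        left_inv := fun f => by ext; simp
        right_inv := fun f => by ext; simp }
  · rw [Nat.card_eq_zero.2 (Or.inl ⟨fun e => h ⟨e⟩⟩)]

/-- Every relation module in the double count has the same order and the same quotient modulo `p`,
so by `genCount_mul_eq` it is spanned by equally many `n`-tuples of columns. -/
lemma natCard_coker_equiv_div {p : ℕ} (hp : p.Prime) (K n : ℕ) (G : Type*) [AddCommGroup G]
    [Finite G] [Module (ZMod (p ^ (K + 1))) G] (hG : ∀ x : G, p ^ K • x = 0) :
    (((p ^ (K + 1) : ℕ) : ℝ) ^ (n * n))⁻¹ * (Nat.card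
      {Y : Matrix (Fin n) (Fin n) (ZMod (p ^ (K + 1))) // Nonempty (Y.Coker ≃+ G)} : ℝ) =
    (Nat.card (G ≃+ G) : ℝ)⁻¹ * (∏ i ∈ Finset.range n, (1 - ((p : ℝ) ^ (i + 1))⁻¹)) *
      ((genCount n G : ℝ) / (Nat.card G : ℝ) ^ n) := by
  have : NeZero (p ^ (K + 1)) := ⟨pow_ne_zero _ hp.ne_zero⟩
  have hfin : Finite (G ≃+ G) := DFunLike.finite _
  set a := p ^ (K + 1) with ha
  have ha0 : (0 : ℝ) < a := by exact_mod_cast Nat.pos_of_ne_zero (NeZero.ne a)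
  have hG0 : (0 : ℝ) < Nat.card G := by exact_mod_cast Nat.card_pos
  have hA0 : (0 : ℝ) < Nat.card (G ≃+ G) := by
    have : Nonempty (G ≃+ G) := ⟨AddEquiv.refl G⟩
    exact_mod_cast Nat.card_pos
  have : Fintype {f : Fin n → G // LinearMap.range
    (Fintype.linearCombination (ZMod a) f) = ⊤} := Fintype.ofFinite _
  set Q := ∏ i ∈ Finset.range n, (1 - ((p : ℝ) ^ (i + 1))⁻¹) with hQ
  have h1 : ∀ f : {f : Fin n → G // LinearMap.range (Fintype.linearCombination (ZMod a) f) = ⊤},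
      (genCount n (LinearMap.ker (Fintype.linearCombination (ZMod a) f.1)) : ℝ) =
      ((a : ℝ) ^ n / Nat.card G) ^ n * Q := by
    intro f
    set F := (Fintype.linearCombination (ZMod a) f.1).toAddMonoidHom with hF
    have hsurj : Function.Surjective F := LinearMap.range_eq_top.1 f.2
    have h2 := genCount_mul_eq (n := n) (K := K + 1) hp F.ker (fun x => by
      rw [← ha]
      refine Subtype.ext (funext fun i => ?_)
      change a • (x.1 i) = 0
      rw [nsmul_eq_mul, ZMod.natCast_self, zero_mul])
      (natCard_quotient_range_nsmul_ker hp hG F)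
    have h3 := AddSubgroup.card_eq_card_quotient_mul_card_addSubgroup F.ker
    rw [Nat.card_congr (QuotientAddGroup.quotientKerEquivOfSurjective F hsurj).toEquiv,
      Nat.card_fun, Nat.card_zmod, Nat.card_eq_fintype_card (α := Fin n), Fintype.card_fin] at h3
    have h4 : (Nat.card F.ker : ℝ) = (a : ℝ) ^ n / Nat.card G := by
      rw [eq_div_iff hG0.ne', mul_comm]
      exact_mod_cast h3.symm
    rw [h4] at h2
    exact h2
  have h5 : Nat.card {f : Fin n → G //
      LinearMap.range (Fintype.linearCombination (ZMod a) f) = (⊤ : Submodule (ZMod a) G)} =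
      genCount n G := by
    refine Nat.card_congr (Equiv.subtypeEquivRight fun f => ?_)
    rw [← range_linearCombination_eq_closure (a := a), LinearMap.range_eq_top]
    exact (AddMonoidHom.range_eq_top
      (f := (Fintype.linearCombination (ZMod a) f).toAddMonoidHom)).symm
  have h6 := congrArg (Nat.cast (R := ℝ)) (natCard_coker_equiv_mul (a := a) (n := n) G)
  rw [Nat.cast_sum, Finset.sum_congr rfl fun f _ => h1 f, Finset.sum_const, Finset.card_univ,
    ← Nat.card_eq_fintype_card, h5, nsmul_eq_mul, Nat.cast_mul, ← eq_div_iff hA0.ne'] at h6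
  rw [h6, div_pow, ← pow_mul]
  field_simp

lemma tendsto_prod_one_sub {p : ℕ} (hp : p.Prime) :
    Tendsto (fun n => ∏ i ∈ Finset.range n, (1 - ((p : ℝ) ^ (i + 1))⁻¹)) atTop
      (𝓝 (∏' k : ℕ, (1 - ((p : ℝ) ^ (k + 1))⁻¹))) := by
  have hp1 : (1 : ℝ) < p := by exact_mod_cast hp.one_lt
  have hs : Summable fun i : ℕ => -((p : ℝ) ^ (i + 1))⁻¹ := by
    refine Summable.neg ?_
    have := (summable_geometric_of_lt_one (r := (p : ℝ)⁻¹) (by positivity)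
      (inv_lt_one_of_one_lt₀ hp1))
    simpa only [inv_pow] using (summable_nat_add_iff 1).2 this
  have := (Real.multipliable_one_add_of_summable hs).hasProd.tendsto_prod_nat
  simpa only [← sub_eq_add_neg] using this

lemma tendsto_uniform_coker {p : ℕ} (hp : p.Prime) (K : ℕ) (G : Type*) [AddCommGroup G]
    [Finite G] (hG : ∀ x : G, p ^ K • x = 0) :
    Tendsto (fun n : ℕ => (((p ^ (K + 1) : ℕ) : ℝ) ^ (n * n))⁻¹ * (Nat.card
      {Y : Matrix (Fin n) (Fin n) (ZMod (p ^ (K + 1))) // Nonempty (Y.Coker ≃+ G)} : ℝ)) atTop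
      (𝓝 (cohenLenstraProb p G)) := by
  let _ : Module (ZMod (p ^ (K + 1))) G := AddCommGroup.zmodModule fun x => by
    rw [pow_succ', mul_smul, hG, smul_zero]
  simp_rw [natCard_coker_equiv_div hp K _ G hG]
  simpa [cohenLenstraProb] using
    ((tendsto_prod_one_sub hp).const_mul _).mul (tendsto_genCount_div G)

end UniformCokernel

/-! ### Tightness of the uniform cokernels and finiteness of small classes. -/

section CohenLenstra
open scoped Classical

/-- In a cyclic group a subgroup of order `p ^ j` is the whole set of elements killed by `p ^ j`,
hence is determined by `j`. -/
lemma natCard_addSubgroup_zmod_prime_pow_le {p : ℕ} (hp : p.Prime) (K : ℕ) :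
    Nat.card (AddSubgroup (ZMod (p ^ K))) ≤ K + 1 := by
  have : NeZero (p ^ K) := ⟨pow_ne_zero _ hp.ne_zero⟩
  have h : ∀ H : AddSubgroup (ZMod (p ^ K)), ∃ j ≤ K, Nat.card H = p ^ j := fun H =>
    (Nat.dvd_prime_pow hp).1 (by simpa using AddSubgroup.card_addSubgroup_dvd_card H)
  choose j hj hc using h
  have h1 : Function.Injective fun H : AddSubgroup (ZMod (p ^ K)) =>
      (⟨j H, Nat.lt_succ_of_le (hj H)⟩ : Fin (K + 1)) := by
    have key : ∀ H : AddSubgroup (ZMod (p ^ K)), (H : Set (ZMod (p ^ K))) =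
        (Finset.univ.filter fun x : ZMod (p ^ K) => (p ^ j H) • x = 0) := by
      intro H
      refine Set.eq_of_subset_of_ncard_le ?_ ?_ (Set.toFinite _)
      · intro x hx
        have h2 := (card_nsmul_eq_zero' (x := (⟨x, hx⟩ : H)))
        rw [hc] at h2
        simpa using congrArg Subtype.val h2
      · rw [Set.ncard_coe_finset]
        refine (IsAddCyclic.card_nsmul_eq_zero_le (pow_pos hp.pos _)).trans ?_
        rw [← hc, ← Nat.card_coe_set_eq]
        exact le_rfl
    intro H H' hH
    have h3 : j H = j H' := congrArg Fin.val hH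
    exact SetLike.coe_injective (by rw [key, key, h3])
  simpa using Nat.card_le_card_of_injective _ h1

/-- Kernel and cokernel of a square matrix over a finite ring have the same order. This turns the
mean order of the cokernel into the moment for `G = ZMod a`. -/
lemma Matrix.natCard_coker_transpose {a n : ℕ} [NeZero a] (Y : Matrix (Fin n) (Fin n) (ZMod a)) :
    Nat.card Yᵀ.Coker = solCount Y (ZMod a) := by
  have h1 := Submodule.card_eq_card_quotient_mul_card (LinearMap.range Yᵀ.mulVecLin)
  have h2 := Submodule.card_eq_card_quotient_mul_card (LinearMap.ker Yᵀ.mulVecLin)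
  rw [Nat.card_congr (LinearMap.quotKerEquivRange Yᵀ.mulVecLin).toEquiv] at h2
  rw [h1, mul_comm (Nat.card (LinearMap.ker _))] at h2
  rw [Nat.eq_of_mul_eq_mul_left Nat.card_pos h2, solCount]
  refine Nat.card_congr (Equiv.subtypeEquivRight fun f => ?_)
  rw [LinearMap.mem_ker, funext_iff]
  refine forall_congr' fun j => ?_
  simp [Matrix.vecMul, dotProduct, mul_comm]

lemma tendsto_sum_uniform_natCard_coker {a : ℕ} [NeZero a] :
    Tendsto (fun n => ∑ Y : Matrix (Fin n) (Fin n) (ZMod a),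
      ((a : ℝ) ^ (n * n))⁻¹ * (Nat.card Y.Coker : ℝ)) atTop
      (𝓝 (Nat.card (AddSubgroup (ZMod a)))) := by
  refine (tendsto_uniform_moment (a := a) (ZMod a)).congr fun n => ?_
  rw [← Equiv.sum_comp (Matrix.transposeAddEquiv (Fin n) (Fin n) (ZMod a)).toEquiv fun Y =>
    ((a : ℝ) ^ (n * n))⁻¹ * (Nat.card Y.Coker : ℝ)]
  refine Finset.sum_congr rfl fun Y _ => ?_
  rw [← Matrix.natCard_coker_transpose]
  rfl

lemma sum_uniform_weight {a : ℕ} [NeZero a] (n : ℕ) :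
    ∑ _Y : Matrix (Fin n) (Fin n) (ZMod a), ((a : ℝ) ^ (n * n))⁻¹ = 1 := by
  have ha : (a : ℝ) ≠ 0 := by exact_mod_cast NeZero.ne a
  have h : Fintype.card (Matrix (Fin n) (Fin n) (ZMod a)) = a ^ (n * n) := by
    rw [← Nat.card_eq_fintype_card]
    change Nat.card (Fin n → Fin n → ZMod a) = _
    rw [Nat.card_fun, Nat.card_fun, Nat.card_zmod, Nat.card_eq_fintype_card, Fintype.card_fin,
      pow_mul]
  rw [Finset.sum_const, Finset.card_univ, h, nsmul_eq_mul]
  push_cast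
  exact mul_inv_cancel₀ (pow_ne_zero _ ha)

/-- The isomorphism class of a finite abelian `p`-group. -/
def FinAbPGroupClass.ofGroup {p : ℕ} (A : Type) [AddCommGroup A] (hA : ∃ k, Nat.card A = p ^ k) :
    FinAbPGroupClass p := Quotient.mk _ ⟨A, hA⟩

lemma FinAbPGroupClass.nonempty_addEquiv_group_iff {p : ℕ} {A : Type} [AddCommGroup A]
    (hA : ∃ k, Nat.card A = p ^ k) (c : FinAbPGroupClass p) :
    Nonempty (A ≃+ c.group) ↔ ofGroup A hA = c := by
  conv_rhs => rw [← Quotient.out_eq c]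
  exact (Quotient.eq (r := FinAbPGroup.setoid p) (x := ⟨A, hA⟩) (y := Quotient.out c)).symm

lemma FinAbPGroupClass.exists_natCard_group {p : ℕ} (c : FinAbPGroupClass p) :
    ∃ k, Nat.card c.group = p ^ k := (Quotient.out c).card_eq

lemma FinAbPGroupClass.finite_group {p : ℕ} (hp : p.Prime) (c : FinAbPGroupClass p) :
    Finite c.group := by
  obtain ⟨k, hk⟩ := c.exists_natCard_group
  exact Nat.finite_of_card_ne_zero (hk ▸ pow_ne_zero _ hp.ne_zero)

lemma FinAbPGroupClass.eq_of_addEquiv {p : ℕ} {c c' : FinAbPGroupClass p}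
    (e : c.group ≃+ c'.group) : c = c' := by
  rw [← Quotient.out_eq c, ← Quotient.out_eq c']
  exact Quotient.sound ⟨e⟩

/-- A class of groups of order `m` is determined by an addition table transported to `Fin m`, and
there are finitely many tables. -/
lemma FinAbPGroupClass.finite_natCard_le {p : ℕ} (hp : p.Prime) (N : ℕ) :
    {c : FinAbPGroupClass p | Nat.card c.group ≤ N}.Finite := by
  have hfin := fun c : FinAbPGroupClass p => c.finite_group hp
  have h : {c : FinAbPGroupClass p | Nat.card c.group ≤ N} =
      ⋃ m ∈ Finset.range (N + 1), {c | Nat.card c.group = m} := by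
    ext c
    simp
  rw [h]
  refine (Finset.range (N + 1)).finite_toSet.biUnion fun m _ => ?_
  let b : ∀ c : {c : FinAbPGroupClass p | Nat.card c.group = m}, c.1.group ≃ Fin m :=
    fun c => (Finite.equivFin _).trans (finCongr c.2)
  let F : {c : FinAbPGroupClass p | Nat.card c.group = m} → Fin m → Fin m → Fin m := fun c x y =>
    b c ((b c).symm x + (b c).symm y)
  refine Set.finite_coe_iff.1 (Finite.of_injective F fun c c' hF => Subtype.ext (eq_of_addEquiv
    { toEquiv := (b c).trans (b c').symm, map_add' := fun x y => ?_ }))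
  have h1 := congrFun (congrFun hF (b c x)) (b c y)
  simp only [F, Equiv.symm_apply_apply] at h1
  simp [h1]

lemma cohenLenstraProb_nonneg {p : ℕ} (hp : p.Prime) (G : Type*) [AddCommGroup G] :
    0 ≤ cohenLenstraProb p G := by
  refine mul_nonneg (by positivity) (ge_of_tendsto' (tendsto_prod_one_sub hp) fun n =>
    Finset.prod_nonneg fun i _ => ?_)
  have hp1 : (1 : ℝ) ≤ p := by exact_mod_cast hp.one_lt.le
  exact sub_nonneg.2 (inv_le_one_of_one_le₀ (one_le_pow₀ hp1))

lemma cohenLenstraLaw_apply {p : ℕ} (s : Set (FinAbPGroupClass p)) :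
    cohenLenstraLaw p s = ∑' c, if c ∈ s then ENNReal.ofReal (cohenLenstraProb p c.group) else 0 := by
  rw [cohenLenstraLaw, Measure.sum_apply _ (MeasurableSpace.measurableSet_top)]
  refine tsum_congr fun c => ?_
  rw [Measure.smul_apply, Measure.dirac_apply' _ MeasurableSpace.measurableSet_top, smul_eq_mul,
    Set.indicator_apply]
  split_ifs <;> simp

lemma cohenLenstraLaw_finset {p : ℕ} (hp : p.Prime) (T : Finset (FinAbPGroupClass p)) :
    cohenLenstraLaw p T = ENNReal.ofReal (∑ c ∈ T, cohenLenstraProb p c.group) := by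
  rw [cohenLenstraLaw_apply, ENNReal.ofReal_sum_of_nonneg fun c _ => cohenLenstraProb_nonneg hp _]
  refine (tsum_eq_sum (s := T) fun c hc => if_neg (by exact_mod_cast hc)).trans ?_
  exact Finset.sum_congr rfl fun c hc => if_pos (by exact_mod_cast hc)

lemma Matrix.exists_natCard_coker {p n K : ℕ} (hp : p.Prime)
    (Y : Matrix (Fin n) (Fin n) (ZMod (p ^ K))) : ∃ k, Nat.card Y.Coker = p ^ k := by
  have h1 := Submodule.card_eq_card_quotient_mul_card (LinearMap.range Y.mulVecLin)
  rw [Nat.card_fun, Nat.card_zmod, ← pow_mul] at h1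
  obtain ⟨k, -, hk⟩ := (Nat.dvd_prime_pow hp).1 (Dvd.intro_left _ h1.symm)
  exact ⟨k, hk⟩

/-- The cokernel of a uniform matrix lies in a finite set of classes of small groups with the
limiting probability that the Cohen–Lenstra law gives to it. -/
lemma tendsto_uniform_coker_mem {p : ℕ} [Fact p.Prime] (K : ℕ) (T : Finset (FinAbPGroupClass p))
    (hT : ∀ c ∈ T, Nat.card c.group ≤ p ^ K) :
    Tendsto (fun n : ℕ => ∑ Y : Matrix (Fin n) (Fin n) (ZMod (p ^ (K + 1))),
      if FinAbPGroupClass.ofGroup Y.Coker (Y.exists_natCard_coker Fact.out) ∈ T then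
        (((p ^ (K + 1) : ℕ) : ℝ) ^ (n * n))⁻¹ else 0) atTop
      (𝓝 (∑ c ∈ T, cohenLenstraProb p c.group)) := by
  have hp := (Fact.out : p.Prime)
  have h1 : Tendsto (fun n : ℕ => ∑ c ∈ T, (((p ^ (K + 1) : ℕ) : ℝ) ^ (n * n))⁻¹ * (Nat.card
      {Y : Matrix (Fin n) (Fin n) (ZMod (p ^ (K + 1))) // Nonempty (Y.Coker ≃+ c.group)} : ℝ))
      atTop (𝓝 (∑ c ∈ T, cohenLenstraProb p c.group)) := by
    refine tendsto_finsetSum _ fun c hc => ?_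
    have := c.finite_group hp
    refine tendsto_uniform_coker hp K c.group fun x => ?_
    obtain ⟨j, hj⟩ := c.exists_natCard_group
    have h2 := hT c hc
    rw [hj, Nat.pow_le_pow_iff_right hp.one_lt] at h2
    obtain ⟨d, hd⟩ := pow_dvd_pow p h2
    rw [hd, ← hj, mul_comm, mul_smul, card_nsmul_eq_zero', smul_zero]
  refine h1.congr fun n => ?_
  simp_rw [FinAbPGroupClass.nonempty_addEquiv_group_iff (Matrix.exists_natCard_coker hp _),
    Nat.card_eq_fintype_card, Fintype.card_subtype, Finset.card_filter, Nat.cast_sum,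
    Finset.mul_sum]
  rw [Finset.sum_comm]
  refine Finset.sum_congr rfl fun Y _ => ?_
  simp

/-- Markov's inequality for the order of the cokernel. -/
lemma sum_uniform_coker_not_mem_le {p : ℕ} [Fact p.Prime] (K n : ℕ) :
    (∑ Y : Matrix (Fin n) (Fin n) (ZMod (p ^ (K + 1))),
      if Nat.card Y.Coker ≤ p ^ K then 0 else (((p ^ (K + 1) : ℕ) : ℝ) ^ (n * n))⁻¹) ≤
    (∑ Y : Matrix (Fin n) (Fin n) (ZMod (p ^ (K + 1))),
      (((p ^ (K + 1) : ℕ) : ℝ) ^ (n * n))⁻¹ * (Nat.card Y.Coker : ℝ)) / p ^ K := by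
  have hp0 : (0 : ℝ) < p := by exact_mod_cast (Fact.out : p.Prime).pos
  rw [Finset.sum_div]
  refine Finset.sum_le_sum fun Y _ => ?_
  split_ifs with h
  · positivity
  · rw [mul_div_assoc]
    refine le_mul_of_one_le_right (by positivity) ?_
    rw [one_le_div (by positivity)]
    exact_mod_cast (not_le.1 h).le

end CohenLenstra

/-! ### Total mass one, and identification of the limiting profile law. -/

section CohenLenstraLaw
open scoped Classical

/-- The isomorphism classes of `p`-groups of order at most `p ^ K`. -/
noncomputable def smallClasses (p : ℕ) [Fact p.Prime] (K : ℕ) : Finset (FinAbPGroupClass p) :=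
  (FinAbPGroupClass.finite_natCard_le (p := p) Fact.out (p ^ K)).toFinset

lemma mem_smallClasses {p : ℕ} [Fact p.Prime] {K : ℕ} {c : FinAbPGroupClass p} :
    c ∈ smallClasses p K ↔ Nat.card c.group ≤ p ^ K := by
  rw [smallClasses, Set.Finite.mem_toFinset]; rfl

lemma FinAbPGroupClass.natCard_group_ofGroup {p : ℕ} {A : Type} [AddCommGroup A]
    (hA : ∃ k, Nat.card A = p ^ k) : Nat.card (ofGroup A hA).group = Nat.card A := by
  obtain ⟨e⟩ := (nonempty_addEquiv_group_iff hA _).2 rfl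
  exact (Nat.card_congr e.toEquiv).symm

lemma homProfile_group_ofGroup {p k : ℕ} {A : Type} [AddCommGroup A]
    (hA : ∃ k, Nat.card A = p ^ k) :
    homProfile p k (FinAbPGroupClass.ofGroup A hA).group = homProfile p k A := by
  obtain ⟨e⟩ := (FinAbPGroupClass.nonempty_addEquiv_group_iff hA _).2 rfl
  exact (homProfile_congr p k e).symm

/-- A finite partial sum is a limit of probabilities for uniform matrices over `ZMod (p ^ (K + 1))`,
with `K` large enough for all classes in `T`. -/
lemma sum_cohenLenstraProb_le_one {p : ℕ} [Fact p.Prime] (T : Finset (FinAbPGroupClass p)) :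
    ∑ c ∈ T, cohenLenstraProb p c.group ≤ 1 := by
  have hp := (Fact.out : p.Prime)
  have hT : ∀ c ∈ T, Nat.card c.group ≤ p ^ ∑ c ∈ T, Nat.card c.group := fun c hc =>
    (Finset.single_le_sum (f := fun c : FinAbPGroupClass p => Nat.card c.group)
      (fun _ _ => Nat.zero_le _) hc).trans (Nat.lt_pow_self hp.one_lt).le
  refine le_of_tendsto' (tendsto_uniform_coker_mem _ T hT) fun n => ?_
  rw [← sum_uniform_weight (a := p ^ ((∑ c ∈ T, Nat.card c.group) + 1)) n]
  refine Finset.sum_le_sum fun Y _ => ?_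
  split_ifs
  · exact le_rfl
  · positivity

/-- A bound for the probability that the cokernel of a large uniform matrix over
`ZMod (p ^ (K + 1))` has order larger than `p ^ K`. -/
noncomputable def tailBound (p K : ℕ) : ℝ :=
  (Nat.card (AddSubgroup (ZMod (p ^ (K + 1)))) : ℝ) / (p : ℝ) ^ K

lemma tendsto_tailBound {p : ℕ} (hp : p.Prime) : Tendsto (tailBound p) atTop (𝓝 0) := by
  have hp1 : (1 : ℝ) < p := by exact_mod_cast hp.one_lt
  have h1 : Tendsto (fun K : ℕ => ((K : ℝ) ^ 1 / (p : ℝ) ^ K) + 2 * ((p : ℝ)⁻¹) ^ K) atTop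
      (𝓝 (0 + 2 * 0)) :=
    (tendsto_pow_const_div_const_pow_of_one_lt 1 hp1).add
      ((tendsto_pow_atTop_nhds_zero_of_lt_one (by positivity)
        (inv_lt_one_of_one_lt₀ hp1)).const_mul 2)
  rw [mul_zero, add_zero] at h1
  refine squeeze_zero (fun K => by unfold tailBound; positivity) (fun K => ?_) h1
  have h2 : (Nat.card (AddSubgroup (ZMod (p ^ (K + 1)))) : ℝ) ≤ K + 2 := by
    have := natCard_addSubgroup_zmod_prime_pow_le hp (K + 1)
    exact_mod_cast this
  rw [tailBound, inv_pow, ← div_eq_mul_inv, ← add_div, pow_one]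
  gcongr

/-- No mass escapes: uniform cokernels of order above `p ^ K` have asymptotic probability at most
`tailBound p K`. -/
lemma one_sub_tailBound_le_sum {p : ℕ} [Fact p.Prime] (K : ℕ) :
    1 - tailBound p K ≤ ∑ c ∈ smallClasses p K, cohenLenstraProb p c.group := by
  have hp := (Fact.out : p.Prime)
  refine le_of_tendsto_of_tendsto' (((tendsto_sum_uniform_natCard_coker
    (a := p ^ (K + 1))).div_const ((p : ℝ) ^ K)).const_sub 1)
    (tendsto_uniform_coker_mem K (smallClasses p K) fun c hc => mem_smallClasses.1 hc) fun n => ?_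
  have h1 := sum_uniform_coker_not_mem_le (p := p) K n
  rw [sub_le_comm]
  refine le_trans (le_of_eq ?_) h1
  rw [← sum_uniform_weight (a := p ^ (K + 1)) n, ← Finset.sum_sub_distrib]
  refine Finset.sum_congr rfl fun Y _ => ?_
  have h2 : FinAbPGroupClass.ofGroup Y.Coker (Y.exists_natCard_coker hp) ∈ smallClasses p K ↔
      Nat.card Y.Coker ≤ p ^ K := by
    rw [mem_smallClasses, FinAbPGroupClass.natCard_group_ofGroup]
  by_cases h : Nat.card Y.Coker ≤ p ^ K
  · rw [if_pos (h2.2 h), if_pos h, sub_self]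
  · rw [if_neg (mt h2.1 h), if_neg h, sub_zero]

/-- The identity of Hall and of Cohen and Lenstra. -/
lemma isProbabilityMeasure_cohenLenstraLaw {p : ℕ} [Fact p.Prime] :
    IsProbabilityMeasure (cohenLenstraLaw p) := by
  have hp := (Fact.out : p.Prime)
  constructor
  apply le_antisymm
  · rw [cohenLenstraLaw_apply]
    simp only [Set.mem_univ, if_true]
    rw [ENNReal.tsum_eq_iSup_sum]
    refine iSup_le fun T => ?_
    rw [← ENNReal.ofReal_sum_of_nonneg fun c _ => cohenLenstraProb_nonneg hp _]
    exact ENNReal.ofReal_le_one.2 (sum_cohenLenstraProb_le_one T)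
  · have h1 : Tendsto (fun K => ENNReal.ofReal (1 - tailBound p K)) atTop (𝓝 1) := by
      have := ENNReal.tendsto_ofReal ((tendsto_tailBound hp).const_sub 1)
      simpa using this
    refine le_of_tendsto' h1 fun K => ?_
    refine (ENNReal.ofReal_le_ofReal (one_sub_tailBound_le_sum K)).trans ?_
    rw [← cohenLenstraLaw_finset hp]
    exact measure_mono (Set.subset_univ _)

lemma abs_sum_cohenLenstraProb_sub_le {p : ℕ} [Fact p.Prime] (K : ℕ)
    (B : Set (FinAbPGroupClass p)) :
    |∑ c ∈ (smallClasses p K).filter (· ∈ B), cohenLenstraProb p c.group -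
      (cohenLenstraLaw p).real B| ≤ tailBound p K := by
  have hp := (Fact.out : p.Prime)
  have := isProbabilityMeasure_cohenLenstraLaw (p := p)
  have hreal : ∀ T : Finset (FinAbPGroupClass p), (cohenLenstraLaw p).real T =
      ∑ c ∈ T, cohenLenstraProb p c.group := fun T => by
    rw [measureReal_def, cohenLenstraLaw_finset hp, ENNReal.toReal_ofReal
      (Finset.sum_nonneg fun c _ => cohenLenstraProb_nonneg hp _)]
  have h1 := one_sub_tailBound_le_sum (p := p) K
  rw [← hreal] at h1 ⊢
  have hm : ∀ s : Set (FinAbPGroupClass p), MeasurableSet s := fun _ => trivial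
  have h2 : (cohenLenstraLaw p).real ((smallClasses p K : Set (FinAbPGroupClass p)))ᶜ ≤
      tailBound p K := by
    rw [probReal_compl_eq_one_sub (hm _)]
    linarith
  have h3 : ((((smallClasses p K).filter (· ∈ B) : Finset _)) : Set (FinAbPGroupClass p)) =
      B ∩ (smallClasses p K : Set (FinAbPGroupClass p)) := by
    ext c
    simp [and_comm]
  have h4 := measureReal_inter_add_sdiff (μ := cohenLenstraLaw p) (s := B)
    (hm (smallClasses p K : Set (FinAbPGroupClass p)))
  have h5 : (cohenLenstraLaw p).real (B \ (smallClasses p K : Set (FinAbPGroupClass p))) ≤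
      (cohenLenstraLaw p).real ((smallClasses p K : Set (FinAbPGroupClass p)))ᶜ :=
    measureReal_mono fun c hc => hc.2
  rw [h3, abs_sub_comm, abs_of_nonneg] <;> linarith [measureReal_nonneg (μ := cohenLenstraLaw p)
    (s := B \ (smallClasses p K : Set (FinAbPGroupClass p)))]

lemma smul_primePowerGroup {p k K : ℕ} (hk : k ≤ K) (m : Fin (k + 1) → ℕ)
    (x : PrimePowerGroup p k m) : p ^ (K + 1) • x = 0 := by
  funext i j
  have h := i.2
  have : ((p ^ (K + 1) : ℕ) : ZMod (p ^ ((i : ℕ) + 1))) = 0 := by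
    rw [ZMod.natCast_eq_zero_iff]
    exact pow_dvd_pow p (by omega)
  rw [Pi.smul_apply, Pi.smul_apply, nsmul_eq_mul, this, zero_mul]; rfl

lemma tendsto_uniform_profile_moment {p : ℕ} [Fact p.Prime] {k K : ℕ} (hk : k ≤ K)
    (m : Fin (k + 1) → ℕ) :
    Tendsto (fun n => ∑ Y : Matrix (Fin n) (Fin n) (ZMod (p ^ (K + 1))),
      (((p ^ (K + 1) : ℕ) : ℝ) ^ (n * n))⁻¹ * ∏ i, (homProfile p k Y.Coker i : ℝ) ^ m i) atTop
      (𝓝 (Nat.card (AddSubgroup (PrimePowerGroup p k m)))) := by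
  have hne : ∀ j, NeZero (p ^ j) := fun j => inferInstance
  let _ : Module (ZMod (p ^ (K + 1))) (PrimePowerGroup p k m) :=
    AddCommGroup.zmodModule (smul_primePowerGroup hk m)
  refine (tendsto_uniform_moment (a := p ^ (K + 1)) (PrimePowerGroup p k m)).congr fun n => ?_
  refine Finset.sum_congr rfl fun Y _ => ?_
  rw [solCount_eq_natCard_addMonoidHom, natCard_addMonoidHom_primePowerGroup]
  push_cast; rfl

/-- The comparison chain of `tendsto_sum_homProfile`: `a` is the given family, `v` the uniform one,
`i` the uniform one restricted to small groups, `s` the truncated Cohen–Lenstra sum and `μ` the full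
one. -/
lemma abs_sub_mul_le {a c v i s m t μ : ℝ} (hc : 0 ≤ c) (h1 : |v - i| ≤ m) (h2 : |s - μ| ≤ t) :
    |a - c * μ| ≤ |a - c * v| + c * m + c * |i - s| + c * t := by
  have h3 : a - c * μ = (a - c * v) + c * (v - i) + c * (i - s) + c * (s - μ) := by ring
  rw [h3]
  refine (abs_add_le _ _).trans (add_le_add ((abs_add_le _ _).trans (add_le_add
    ((abs_add_le _ _).trans (add_le_add le_rfl ?_)) ?_)) ?_)
  · rw [abs_mul, abs_of_nonneg hc]; gcongr
  · rw [abs_mul, abs_of_nonneg hc]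
  · rw [abs_mul, abs_of_nonneg hc]; gcongr

/-- The moments determine the limiting law of the profile: it is the Cohen–Lenstra law. -/
lemma tendsto_sum_homProfile {p : ℕ} [Fact p.Prime] {k : ℕ} {α : ℕ → Type} [∀ n, Fintype (α n)]
    {w : ∀ n, α n → ℝ} (hw : ∀ n ω, 0 ≤ w n ω) {x : ∀ n, α n → Fin (k + 1) → ℕ}
    (hx : ∀ n ω, IsProfile p (x n ω)) {c : ℝ} (hc : 0 ≤ c)
    (h : ∀ m : Fin (k + 1) → ℕ, Tendsto (fun n => ∑ ω, w n ω * ∏ i, (x n ω i : ℝ) ^ m i) atTop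
      (𝓝 (c * Nat.card (AddSubgroup (PrimePowerGroup p k m))))) (y : Fin (k + 1) → ℕ) :
    Tendsto (fun n => ∑ ω, if x n ω = y then w n ω else 0) atTop
      (𝓝 (c * (cohenLenstraLaw p).real {d | homProfile p k d.group = y})) := by
  have hp := (Fact.out : p.Prime)
  set B : Set (FinAbPGroupClass p) := {d | homProfile p k d.group = y} with hB
  -- A value that is not a profile is never attained, and both sides are zero.
  by_cases hy : IsProfile p y
  swap
  · have h1 : B = ∅ := by
      refine Set.eq_empty_of_forall_notMem fun d hd => hy ?_
      have := d.finite_group hp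
      have hd' : homProfile p k d.group = y := hd
      exact hd' ▸ isProfile_homProfile hp k d.group
    have h2 : ∀ n ω, x n ω ≠ y := fun n ω he => hy (he ▸ hx n ω)
    simp [h1, h2]
  rw [Metric.tendsto_nhds]
  intro δ hδ
  have htail := (tendsto_tailBound hp).const_mul (c * 2)
  rw [mul_zero] at htail
  -- The tail bound is paid twice, once for truncating the uniform cokernels and once for truncating
  -- the law. The condition `k ≤ K` makes the profile groups modules over `ZMod (p ^ (K + 1))`.
  obtain ⟨K, hK, hkK⟩ := ((htail.eventually_lt_const hδ).and (eventually_ge_atTop k)).exists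
  set T := (smallClasses p K).filter (· ∈ B) with hT
  set u : ℕ → ℝ := fun n => (((p ^ (K + 1) : ℕ) : ℝ) ^ (n * n))⁻¹ with hu
  have hV := tendsto_profile_sub hp.two_le w
    (fun n (_ : Matrix (Fin n) (Fin n) (ZMod (p ^ (K + 1)))) => u n) hw
    (fun n _ => by positivity) x (fun n Y => homProfile p k Y.Coker) hx
    (fun n Y => isProfile_homProfile hp k Y.Coker) hc
    (fun m => (Nat.card (AddSubgroup (PrimePowerGroup p k m)) : ℝ)) h
    (fun m => tendsto_uniform_profile_moment hkK m)
    (fun D => tendsto_prod_mul_natCard_addSubgroup hp k D) hy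
  have hI := tendsto_uniform_coker_mem K T
    fun d hd => mem_smallClasses.1 (Finset.mem_filter.1 hd).1
  have hM := (tendsto_sum_uniform_natCard_coker (a := p ^ (K + 1))).div_const ((p : ℝ) ^ K)
  have hlim := ((hV.abs.add (hM.const_mul c)).add ((hI.sub_const
    (∑ d ∈ T, cohenLenstraProb p d.group)).abs.const_mul c)).add_const
    (c * tailBound p K)
  rw [sub_self, abs_zero, mul_zero, add_zero, zero_add] at hlim
  have hlt : c * ((Nat.card (AddSubgroup (ZMod (p ^ (K + 1)))) : ℝ) / (p : ℝ) ^ K) +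
      c * tailBound p K < δ := by
    change c * tailBound p K + c * tailBound p K < δ
    linarith
  filter_upwards [hlim.eventually_lt_const hlt] with n hn
  rw [Real.dist_eq]
  refine lt_of_le_of_lt ?_ hn
  have h1 := sum_uniform_coker_not_mem_le (p := p) K n
  have h2 : |(∑ Y : Matrix (Fin n) (Fin n) (ZMod (p ^ (K + 1))),
      if homProfile p k Y.Coker = y then u n else 0) -
      ∑ Y : Matrix (Fin n) (Fin n) (ZMod (p ^ (K + 1))),
        if FinAbPGroupClass.ofGroup Y.Coker (Y.exists_natCard_coker hp) ∈ T then u n else 0| ≤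
      (∑ Y : Matrix (Fin n) (Fin n) (ZMod (p ^ (K + 1))), u n * (Nat.card Y.Coker : ℝ)) / p ^ K := by
    refine le_trans ?_ h1
    rw [← Finset.sum_sub_distrib]
    refine (Finset.abs_sum_le_sum_abs _ _).trans (Finset.sum_le_sum fun Y _ => ?_)
    have hmem : FinAbPGroupClass.ofGroup Y.Coker (Y.exists_natCard_coker hp) ∈ T ↔
        Nat.card Y.Coker ≤ p ^ K ∧ homProfile p k Y.Coker = y := by
      rw [hT, Finset.mem_filter, mem_smallClasses, FinAbPGroupClass.natCard_group_ofGroup, hB,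
        Set.mem_ofPred_eq, homProfile_group_ofGroup]
    have hu0 : 0 ≤ u n := by positivity
    by_cases h4 : homProfile p k Y.Coker = y
    · by_cases h3 : Nat.card Y.Coker ≤ p ^ K
      · rw [if_pos h4, if_pos (hmem.2 ⟨h3, h4⟩), if_pos h3, sub_self, abs_zero]
      · rw [if_pos h4, if_neg fun h => h3 (hmem.1 h).1, if_neg h3, sub_zero, abs_of_nonneg hu0]
    · rw [if_neg h4, if_neg fun h => h4 (hmem.1 h).2, sub_zero, abs_zero]
      split_ifs
      · exact le_rfl
      · exact hu0
  exact abs_sub_mul_le hc h2 (by convert abs_sum_cohenLenstraProb_sub_le K B)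

end CohenLenstraLaw

/-! ### Asymptotic independence over the primes dividing `a`. -/

section JointProfiles
open scoped Classical

lemma nonempty_addEquiv_iff_homProfile_eq {A B : Type*} [AddCommGroup A] [AddCommGroup B] [Finite A]
    [Finite B] {a : ℕ} (ha : a ≠ 0) (hA : ∀ x : A, a • x = 0) (hB : ∀ x : B, a • x = 0) :
    Nonempty (A ≃+ B) ↔ ∀ p ∈ a.primeFactors,
      homProfile p (a.factorization p - 1) A = homProfile p (a.factorization p - 1) B := by
  constructor
  · rintro ⟨e⟩ p -
    exact homProfile_congr _ _ e
  · intro h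
    refine nonempty_addEquiv_of_natCard_hom_eq hA hB fun p k hp hpk => ?_
    have h1 : k + 1 ≤ a.factorization p := (hp.pow_dvd_iff_le_factorization ha).1 hpk
    have hpa : p ∈ a.primeFactors :=
      Nat.mem_primeFactors.2 ⟨hp, (dvd_pow_self p (Nat.succ_ne_zero k)).trans hpk, ha⟩
    exact congrFun (h p hpa) ⟨k, by omega⟩

lemma smul_primePowerGroup_factorization {a p : ℕ} (ha : a ≠ 0) (hp : p ∈ a.primeFactors)
    (m : Fin (a.factorization p - 1 + 1) → ℕ)
    (x : PrimePowerGroup p (a.factorization p - 1) m) : a • x = 0 := by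
  have hpp := Nat.prime_of_mem_primeFactors hp
  have h1 : 1 ≤ a.factorization p :=
    (hpp.dvd_iff_one_le_factorization ha).1 (Nat.dvd_of_mem_primeFactors hp)
  have h2 : a.factorization p - 1 + 1 = a.factorization p := by omega
  obtain ⟨d, hd⟩ : p ^ (a.factorization p - 1 + 1) ∣ a := h2 ▸ Nat.ordProj_dvd a p
  have h3 := smul_primePowerGroup (p := p) le_rfl m x
  generalize a.factorization p - 1 = k at *
  rw [hd, mul_comm, mul_smul, h3, smul_zero]

/-- Induction on the set `T` of primes whose profiles are already prescribed. To add `q`, the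
indicator for `T` times the number of homomorphisms to `G` is taken as a weight. The moments of the
`q`-profile under this weight are given by the induction hypothesis for `G` times a `q`-group.
Subgroup counts multiply for coprime orders, so these moments are a constant times those of the
Cohen–Lenstra law, and `tendsto_sum_homProfile` applies. The auxiliary group `G` is there to make
this induction possible. -/
lemma tendsto_moment_homProfile {a : ℕ} [NeZero a] {ε : ℝ} (hε : 0 < ε)
    (C : ∀ n, Matrix (Fin n) (Fin n) (ZMod a)) (hC : ∀ n, (C n).IsAlternating)
    (hrank : ∀ p : ℕ, p.Prime → ∀ hpa : p ∣ a,
      Tendsto (fun n => ((C n).map (ZMod.castHom hpa (ZMod p))).rank) atTop atTop)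
    (μ : ∀ n, UpperPair n → ZMod a → ℝ) (hμ : ∀ n e, IsBalancedWeight ε (μ n e))
    (y : ∀ p : ℕ, Fin (a.factorization p - 1 + 1) → ℕ)
    (T : Finset ℕ) (hT : T ⊆ a.primeFactors) (G : Type) [AddCommGroup G] [Finite G]
    [Module (ZMod a) G] (hG : ∀ p ∈ T, (Nat.card G).Coprime p) :
    Tendsto (fun n => ∑ z : UpperPair n → ZMod a, if ∀ p ∈ T,
      homProfile p (a.factorization p - 1) (csymmMatrix (C n) z).Coker = y p then
        (∏ e, μ n e (z e)) * (Nat.card ((csymmMatrix (C n) z).Coker →+ G) : ℝ) else 0) atTop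
      (𝓝 ((∏ p ∈ T, (cohenLenstraLaw p).real
        {d | homProfile p (a.factorization p - 1) d.group = y p}) * Nat.card (AddSubgroup G))) := by
  induction T using Finset.induction_on generalizing G with
  | empty =>
    simp only [Finset.notMem_empty, false_imp_iff, implies_true, if_true, Finset.prod_empty, one_mul]
    simp_rw [← solCount_eq_natCard_addMonoidHom]
    exact tendsto_moment hε C hC hrank μ hμ G
  | insert q T hq ih =>
    have hqa := hT (Finset.mem_insert_self q T)
    have hqp := Nat.prime_of_mem_primeFactors hqa
    have := Fact.mk hqp
    have hTa : T ⊆ a.primeFactors := (Finset.subset_insert q T).trans hT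
    have key := tendsto_sum_homProfile (p := q) (k := a.factorization q - 1)
      (α := fun n => UpperPair n → ZMod a)
      (w := fun n z => if ∀ p ∈ T,
        homProfile p (a.factorization p - 1) (csymmMatrix (C n) z).Coker = y p then
        (∏ e, μ n e (z e)) * (Nat.card ((csymmMatrix (C n) z).Coker →+ G) : ℝ) else 0)
      (fun n z => by
        split_ifs
        · exact mul_nonneg (Finset.prod_nonneg fun e _ => (hμ n e).nonneg _) (by positivity)
        · exact le_rfl)
      (x := fun n z => homProfile q (a.factorization q - 1) (csymmMatrix (C n) z).Coker)
      (fun n z => isProfile_homProfile hqp _ _)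
      (c := (∏ p ∈ T, (cohenLenstraLaw p).real
        {d | homProfile p (a.factorization p - 1) d.group = y p}) * Nat.card (AddSubgroup G))
      (mul_nonneg (Finset.prod_nonneg fun _ _ => measureReal_nonneg) (by positivity))
      (fun m => ?_) (y q)
    · rw [Finset.prod_insert hq, mul_comm ((cohenLenstraLaw q).real _), mul_right_comm]
      refine key.congr fun n => Finset.sum_congr rfl fun z _ => ?_
      simp only [Finset.forall_mem_insert, ite_and]
    · let _ : Module (ZMod a) (PrimePowerGroup q (a.factorization q - 1) m) :=
        AddCommGroup.zmodModule (smul_primePowerGroup_factorization (NeZero.ne a) hqa m)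
      have hne : ∀ j, NeZero (q ^ j) := fun j => inferInstance
      have hcop : (Nat.card G).Coprime (Nat.card (PrimePowerGroup q (a.factorization q - 1) m)) := by
        rw [natCard_primePowerGroup]
        exact (hG q (Finset.mem_insert_self q T)).pow_right _
      have h1 := ih hTa (G × PrimePowerGroup q (a.factorization q - 1) m) fun p hp => by
        rw [Nat.card_prod, natCard_primePowerGroup]
        refine Nat.Coprime.mul_left (hG p (Finset.mem_insert_of_mem hp)) (Nat.Coprime.pow_left _ ?_)
        exact (Nat.coprime_primes hqp (Nat.prime_of_mem_primeFactors (hTa hp))).2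
          fun h => hq (h ▸ hp)
      rw [natCard_addSubgroup_prod _ _ hcop, Nat.cast_mul, ← mul_assoc] at h1
      refine h1.congr fun n => Finset.sum_congr rfl fun z _ => ?_
      rw [ite_mul, zero_mul, natCard_addMonoidHom_prod, natCard_addMonoidHom_primePowerGroup]
      push_cast
      rw [mul_assoc]

/-- The limiting law of the cokernels of random matrices over `ZMod a`. -/
lemma tendsto_sum_coker_equiv {a : ℕ} [NeZero a] {ε : ℝ} (hε : 0 < ε)
    (C : ∀ n, Matrix (Fin n) (Fin n) (ZMod a)) (hC : ∀ n, (C n).IsAlternating)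
    (hrank : ∀ p : ℕ, p.Prime → ∀ hpa : p ∣ a,
      Tendsto (fun n => ((C n).map (ZMod.castHom hpa (ZMod p))).rank) atTop atTop)
    (μ : ∀ n, UpperPair n → ZMod a → ℝ) (hμ : ∀ n e, IsBalancedWeight ε (μ n e))
    (H : Type) [AddCommGroup H] [Finite H] (hH : ∀ x : H, a • x = 0) :
    Tendsto (fun n => ∑ z : UpperPair n → ZMod a, if Nonempty ((csymmMatrix (C n) z).Coker ≃+ H) then
        ∏ e, μ n e (z e) else 0) atTop
      (𝓝 (∏ p ∈ a.primeFactors, (cohenLenstraLaw p).real {d | homProfile p (a.factorization p - 1)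
        d.group = homProfile p (a.factorization p - 1) H})) := by
  have h1 := tendsto_moment_homProfile hε C hC hrank μ hμ
    (fun p => homProfile p (a.factorization p - 1) H) a.primeFactors le_rfl PUnit
    fun p _ => by simp
  have h2 : Nat.card (AddSubgroup PUnit) = 1 := Nat.card_eq_one_iff_unique.2
    ⟨inferInstance, inferInstance⟩
  rw [h2, Nat.cast_one, mul_one] at h1
  refine h1.congr fun n => Finset.sum_congr rfl fun z _ => ?_
  have h3 : Nat.card ((csymmMatrix (C n) z).Coker →+ PUnit) = 1 := Nat.card_eq_one_iff_unique.2
    ⟨⟨fun f g => by ext⟩, ⟨0⟩⟩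
  have h4 : ∀ x : (csymmMatrix (C n) z).Coker, a • x = 0 := fun x => by
    rw [← Nat.cast_smul_eq_nsmul (ZMod a), ZMod.natCast_self, zero_smul]
  rw [h3, Nat.cast_one, mul_one]
  exact if_congr (nonempty_addEquiv_iff_homProfile_eq (NeZero.ne a) h4 hH).symm rfl rfl

end JointProfiles

/-! ### From random matrices to product weights on entries modulo `a`. -/

section RandomMatrices
open scoped Classical

lemma measureReal_eq_sum_of_finite {Ω S : Type*} [MeasurableSpace Ω] {P : Measure Ω}
    [IsFiniteMeasure P] [Fintype S] [MeasurableSpace S] [MeasurableSingletonClass S] {Y : Ω → S}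
    (hY : Measurable Y) (Q : S → Prop) [DecidablePred Q] :
    P.real {ω | Q (Y ω)} = ∑ s, if Q s then P.real {ω | Y ω = s} else 0 := by
  have h1 : {ω | Q (Y ω)} = ⋃ s ∈ Finset.univ.filter Q, {ω | Y ω = s} := by
    ext ω; simp
  rw [h1, measureReal_biUnion_finset, Finset.sum_filter]
  · intro s _ t _ hst
    exact Set.disjoint_left.2 fun ω hs ht => hst (hs.symm.trans ht)
  · intro s _
    exact hY (measurableSet_singleton s)

/-- A homomorphism to `ZMod p` is surjective, so its kernel is a maximal ideal with finite residue
field and its fibres are residue classes. -/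
lemma IsEpsBalanced.measureReal_le {Ω R : Type*} [MeasurableSpace Ω] [CommRing R] {ε : ℝ}
    {P : Measure Ω} {N : Ω → R} (h : IsEpsBalanced ε P N) {p : ℕ} [Fact p.Prime] (ψ : R →+* ZMod p)
    (r : ZMod p) : P.real {ω | ψ (N ω) = r} ≤ 1 - ε := by
  have hψ : Function.Surjective ψ := ZMod.ringHom_surjective ψ
  obtain ⟨x, rfl⟩ := hψ r
  have h1 : (RingHom.ker ψ).IsMaximal := RingHom.ker_isMaximal_of_surjective ψ hψ
  have h2 : Finite (R ⧸ RingHom.ker ψ) :=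
    Finite.of_equiv _ (RingHom.quotientKerEquivOfSurjective hψ).symm.toEquiv
  have h3 := h _ h1 h2 (Ideal.Quotient.mk _ x)
  have h4 : {ω | Ideal.Quotient.mk (RingHom.ker ψ) (N ω) = Ideal.Quotient.mk (RingHom.ker ψ) x} =
      {ω | ψ (N ω) = ψ x} := by
    ext ω
    rw [Set.mem_ofPred_eq, Set.mem_ofPred_eq, Ideal.Quotient.eq, RingHom.mem_ker, map_sub,
      sub_eq_zero]
  rwa [h4] at h3

lemma isBalancedWeight_measureReal {Ω R : Type*} [MeasurableSpace Ω] [CommRing R]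
    [MeasurableSpace R] {ε : ℝ} {P : Measure Ω} [IsProbabilityMeasure P] {a : ℕ} [NeZero a]
    {φ : R →+* ZMod a} (hφ : Measurable φ) {N : Ω → R} (hN : Measurable N)
    (h : IsEpsBalanced ε P N) : IsBalancedWeight ε fun x => P.real {ω | φ (N ω) = x} where
  nonneg := fun x => measureReal_nonneg
  sum_one := by
    have := measureReal_eq_sum_of_finite (P := P) (hφ.comp hN) fun _ => True
    simpa using this.symm
  balanced := fun p hp hpa r => by
    have := Fact.mk hp
    have h1 := measureReal_eq_sum_of_finite (P := P) (hφ.comp hN)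
      fun x => ZMod.castHom hpa (ZMod p) x = r
    exact h1.symm.trans_le (h.measureReal_le ((ZMod.castHom hpa (ZMod p)).comp φ) r)

lemma Matrix.IsCSymmetric.map_eq_csymmMatrix {R S : Type*} [CommRing R] [CommRing S] (φ : R →+* S)
    {n : ℕ} {C X : Matrix (Fin n) (Fin n) R} (h : Matrix.IsCSymmetric C X) :
    X.map φ = csymmMatrix (C.map φ) fun e => φ (X e.1.1 e.1.2) := by
  ext i j
  rw [csymmMatrix]
  by_cases hij : i ≤ j
  · simp [hij]
  · have h1 := congrFun (congrFun h j) i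
    rw [Matrix.sub_apply, Matrix.transpose_apply] at h1
    simp [hij, ← h1]

lemma IsEpsBalancedCSymmetric.measureReal_eq_sum {Ω R : Type*} [MeasurableSpace Ω] [CommRing R]
    [MeasurableSpace R] {ε : ℝ} {P : Measure Ω} [IsProbabilityMeasure P] {a : ℕ} [NeZero a]
    {φ : R →+* ZMod a} (hφ : Measurable φ) {n : ℕ} {C : Matrix (Fin n) (Fin n) R}
    {X : Ω → Matrix (Fin n) (Fin n) R} (h : IsEpsBalancedCSymmetric ε P C X)
    (Q : Matrix (Fin n) (Fin n) (ZMod a) → Prop) :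
    P.real {ω | Q ((X ω).map φ)} = ∑ z : UpperPair n → ZMod a,
      if Q (csymmMatrix (C.map φ) z) then
        ∏ e, P.real {ω | φ (X ω e.1.1 e.1.2) = z e} else 0 := by
  have hm : ∀ e : UpperPair n, Measurable fun ω => φ (X ω e.1.1 e.1.2) := fun e =>
    hφ.comp (h.measurable_entry _ _ e.2)
  have h1 : P.real {ω | Q ((X ω).map φ)} =
      P.real {ω | Q (csymmMatrix (C.map φ) fun e => φ (X ω e.1.1 e.1.2))} := by
    refine measureReal_congr ?_
    filter_upwards [h.csymmetric] with ω hω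
    have := hω.map_eq_csymmMatrix φ
    exact congrArg Q this
  have hmeas : Measurable fun ω (e : UpperPair n) => φ (X ω e.1.1 e.1.2) := measurable_pi_lambda _ hm
  rw [h1, measureReal_eq_sum_of_finite hmeas fun z => Q (csymmMatrix (C.map φ) z)]
  refine Finset.sum_congr rfl fun z _ => if_congr Iff.rfl ?_ rfl
  have hind : iIndepFun (fun (e : UpperPair n) ω => φ (X ω e.1.1 e.1.2)) P :=
    h.indep.comp (fun _ => φ) fun _ => hφ
  have h2 : {ω | (fun e : UpperPair n => φ (X ω e.1.1 e.1.2)) = z} =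
      ⋂ e ∈ (Finset.univ : Finset (UpperPair n)), (fun ω => φ (X ω e.1.1 e.1.2)) ⁻¹' {z e} := by
    ext ω; simp [funext_iff]
  rw [h2, measureReal_def, hind.measure_inter_preimage_eq_mul _ fun e _ => measurableSet_singleton _,
    ENNReal.toReal_prod]
  rfl

lemma Matrix.IsAlternating.map {R S : Type*} [CommRing R] [CommRing S] (φ : R →+* S) {n : ℕ}
    {C : Matrix (Fin n) (Fin n) R} (h : C.IsAlternating) : (C.map φ).IsAlternating := by
  refine ⟨?_, fun i => by rw [Matrix.map_apply, h.2, map_zero]⟩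
  rw [← Matrix.transpose_map, h.1]
  ext i j
  simp

/-- The limiting law of the reductions modulo `a` of the cokernels of random matrices. -/
lemma tendsto_measureReal_coker_map {Ω : ℕ → Type*} [∀ n, MeasurableSpace (Ω n)]
    (P : ∀ n, Measure (Ω n)) [∀ n, IsProbabilityMeasure (P n)] {ε : ℝ} (hε : 0 < ε) {R : Type*}
    [CommRing R] [MeasurableSpace R] {a : ℕ} [NeZero a] {φ : R →+* ZMod a} (hφ : Measurable φ)
    (C : ∀ n, Matrix (Fin n) (Fin n) R) (X : ∀ n, Ω n → Matrix (Fin n) (Fin n) R)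
    (hC : ∀ n, (C n).IsAlternating) (hX : ∀ n, IsEpsBalancedCSymmetric ε (P n) (C n) (X n))
    (hrank : ∀ p : ℕ, p.Prime → p ∣ a → ∀ ψ : R →+* ZMod p,
      Tendsto (fun n => ((C n).map ψ).rank) atTop atTop)
    (H : Type) [AddCommGroup H] [Finite H] (hH : ∀ x : H, a • x = 0) :
    Tendsto (fun n => (P n).real {ω | Nonempty (((X n ω).map φ).Coker ≃+ H)}) atTop
      (𝓝 (∏ p ∈ a.primeFactors, (cohenLenstraLaw p).real {d | homProfile p (a.factorization p - 1)
        d.group = homProfile p (a.factorization p - 1) H})) := by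
  have h1 := tendsto_sum_coker_equiv hε (fun n => (C n).map φ) (fun n => (hC n).map φ)
    (fun p hp hpa => by
      have := hrank p hp hpa ((ZMod.castHom hpa (ZMod p)).comp φ)
      simpa only [Matrix.map_map, RingHom.coe_comp] using this)
    (fun n e x => (P n).real {ω | φ (X n ω e.1.1 e.1.2) = x})
    (fun n e => isBalancedWeight_measureReal hφ ((hX n).measurable_entry _ _ e.2)
      ((hX n).balanced _ _ e.2)) H hH
  exact h1.congr fun n => ((hX n).measureReal_eq_sum hφ fun Y => Nonempty (Y.Coker ≃+ H)).symm

/-- Lifts of the generators, reduced modulo `p`, span `F_p^n` together with the column space of the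
reduced matrix. -/
lemma GeneratedBy.le_add_rank {R : Type*} [CommRing R] {n g : ℕ} {C : Matrix (Fin n) (Fin n) R}
    (h : GeneratedBy R C.Coker g) {p : ℕ} [Fact p.Prime] (ψ : R →+* ZMod p) :
    n ≤ g + (C.map ψ).rank := by
  obtain ⟨v, hv⟩ := h
  choose w hw using fun i => Submodule.mkQ_surjective _ (v i)
  have hψ : Function.Surjective ψ := ZMod.ringHom_surjective ψ
  have h1 : Submodule.span (ZMod p) (Set.range fun i => ψ ∘ w i) ⊔
      LinearMap.range (C.map ψ).mulVecLin = ⊤ := by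
    refine (Submodule.eq_top_iff').2 fun x => ?_
    obtain ⟨x, rfl⟩ : ∃ x' : Fin n → R, ψ ∘ x' = x :=
      ⟨fun i => Function.surjInv hψ (x i), funext fun i => Function.surjInv_eq hψ _⟩
    have h2 : Submodule.mkQ (LinearMap.range C.mulVecLin) x ∈ Submodule.span R (Set.range v) := by
      rw [hv]; trivial
    obtain ⟨c, hc⟩ := (Submodule.mem_span_range_iff_exists_fun R).1 h2
    have h3 : x - ∑ i, c i • w i ∈ LinearMap.range C.mulVecLin := by
      rw [← Submodule.ker_mkQ (LinearMap.range C.mulVecLin), LinearMap.mem_ker, map_sub, map_sum,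
        ← hc, sub_eq_zero]
      simp_rw [map_smul, hw]
    obtain ⟨z, hz⟩ := h3
    have h4 : ψ ∘ x = ∑ i, ψ (c i) • (ψ ∘ w i) + (C.map ψ).mulVecLin (ψ ∘ z) := by
      have h5 : x = ∑ i, c i • w i + C.mulVecLin z := by rw [hz]; abel
      funext j
      have h6 := congrArg ψ (congrFun h5 j)
      rw [Function.comp_apply, h6]
      simp [Matrix.mulVec, dotProduct, Finset.sum_apply]
    rw [h4]
    refine Submodule.add_mem_sup (Submodule.sum_mem _ fun i _ => Submodule.smul_mem _ _
      (Submodule.subset_span ⟨i, rfl⟩)) ⟨_, rfl⟩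
  have h2 := Submodule.finrank_add_le_finrank_add_finrank
    (Submodule.span (ZMod p) (Set.range fun i => ψ ∘ w i)) (LinearMap.range (C.map ψ).mulVecLin)
  rw [h1, finrank_top, Module.finrank_fintype_fun_eq_card, Fintype.card_fin] at h2
  have h3 := finrank_range_le_card (R := ZMod p) (fun i => ψ ∘ w i)
  rw [Fintype.card_fin] at h3
  exact h2.trans (Nat.add_le_add_right h3 _)

lemma tendsto_rank_of_generatedBy {R : Type*} [CommRing R] {C : ∀ n, Matrix (Fin n) (Fin n) R}
    {g : ℕ → ℕ} (h : ∀ n, GeneratedBy R (C n).Coker (g n))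
    (hg : Tendsto (fun n : ℕ => (n : ℤ) - (g n : ℤ)) atTop atTop) {p : ℕ} (hp : p.Prime)
    (ψ : R →+* ZMod p) : Tendsto (fun n => ((C n).map ψ).rank) atTop atTop := by
  have := Fact.mk hp
  rw [← tendsto_natCast_atTop_iff (R := ℤ)]
  refine tendsto_atTop_mono (fun n => ?_) hg
  have := (h n).le_add_rank ψ
  omega

end RandomMatrices

/-! ### Tensoring with `ZMod a`: cokernels and infinite products of `p`-groups. -/

section Reduction
open scoped Classical

/-- The quotient `M / aM`. -/
abbrev ModNat (a : ℕ) (M : Type*) [AddCommGroup M] : Type _ :=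
  M ⧸ (nsmulAddMonoidHom a : M →+ M).range

lemma nonempty_tensorProduct_zmod_addEquiv (a : ℕ) (M : Type*) [AddCommGroup M] :
    Nonempty ((M ⊗[ℤ] ZMod a) ≃+ ModNat a M) := by
  let e : (ℤ ⧸ Ideal.span {(a : ℤ)}) ≃ₗ[ℤ] ZMod a :=
    { (Int.quotientSpanNatEquivZMod a).toAddEquiv with
      map_smul' := fun z x => by
        simp }
  have h : (Ideal.span {(a : ℤ)} • (⊤ : Submodule ℤ M)).toAddSubgroup =
      (nsmulAddMonoidHom a : M →+ M).range := by
    ext x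
    rw [Submodule.ideal_span_singleton_smul, Submodule.mem_toAddSubgroup,
      Submodule.mem_smul_pointwise_iff_exists]
    simp [AddMonoidHom.mem_range]
  exact ⟨((TensorProduct.congr (LinearEquiv.refl ℤ M) e.symm).trans
    (TensorProduct.tensorQuotEquivQuotSMul M (Ideal.span {(a : ℤ)}))).toAddEquiv.trans
      (QuotientAddGroup.quotientAddEquivOfEq h)⟩

lemma smul_modNat {a : ℕ} {M : Type*} [AddCommGroup M] (x : ModNat a M) : a • x = 0 := by
  obtain ⟨x, rfl⟩ := QuotientAddGroup.mk_surjective x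
  rw [← QuotientAddGroup.mk_nsmul, QuotientAddGroup.eq_zero_iff]
  exact ⟨x, rfl⟩

/-- A surjection with kernel `aM` identifies its target with `M / aM`. -/
lemma nonempty_modNat_addEquiv_of_surjective {a : ℕ} {M N : Type*} [AddCommGroup M]
    [AddCommGroup N] (g : M →+ N) (hg : Function.Surjective g)
    (hker : ∀ x, g x = 0 ↔ ∃ y, a • y = x) : Nonempty (ModNat a M ≃+ N) := by
  have h : (nsmulAddMonoidHom a : M →+ M).range = g.ker := by
    ext x
    rw [AddMonoidHom.mem_ker, hker]; rfl
  exact ⟨(QuotientAddGroup.quotientAddEquivOfEq h).trans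
    (QuotientAddGroup.quotientKerEquivOfSurjective g hg)⟩

lemma natCard_modNat_addMonoidHom {a : ℕ} (M G : Type*) [AddCommGroup M] [AddCommGroup G]
    (hG : ∀ x : G, a • x = 0) : Nat.card (ModNat a M →+ G) = Nat.card (M →+ G) := by
  refine Nat.card_congr
    { toFun := fun f => f.comp (QuotientAddGroup.mk' _)
      invFun := fun f => QuotientAddGroup.lift _ f ?_
      left_inv := fun f => ?_
      right_inv := fun f => ?_ }
  · rintro _ ⟨y, rfl⟩
    exact (map_nsmul f a y).trans (hG _)
  · ext x; rfl
  · ext x; rfl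

lemma homProfile_modNat {a p : ℕ} (ha : a ≠ 0) (hp : p ∈ a.primeFactors) (M : Type*)
    [AddCommGroup M] : homProfile p (a.factorization p - 1) (ModNat a M) =
      homProfile p (a.factorization p - 1) M := by
  ext i
  refine natCard_modNat_addMonoidHom M _ fun x => ?_
  have hpp := Nat.prime_of_mem_primeFactors hp
  have h1 : 1 ≤ a.factorization p :=
    (hpp.dvd_iff_one_le_factorization ha).1 (Nat.dvd_of_mem_primeFactors hp)
  have h2 : p ^ ((i : ℕ) + 1) ∣ a :=
    (pow_dvd_pow p (by have := i.2; omega)).trans (Nat.ordProj_dvd a p)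
  rw [nsmul_eq_mul, (ZMod.natCast_eq_zero_iff _ _).2 h2, zero_mul]

/-- The modulus `b` need not be `a`: over `ℤ_[p]` the ideal generated by `a` has quotient `ZMod b`
with `b` the `p`-part of `a`. -/
lemma Matrix.exists_coker_map {R : Type*} [CommRing R] {a b n : ℕ} {φ : R →+* ZMod b}
    (hφ : RingHom.ker φ = Ideal.span {(a : R)}) (X : Matrix (Fin n) (Fin n) R) :
    ∃ g : X.Coker →+ (X.map φ).Coker, Function.Surjective g ∧
      ∀ x, g x = 0 ↔ ∃ y, a • y = x := by
  have hs : Function.Surjective φ := ZMod.ringHom_surjective φ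
  have hcomm : ∀ z : Fin n → R, φ ∘ (X.mulVecLin z) = (X.map φ).mulVecLin (φ ∘ z) := fun z => by
    funext j
    simp [Matrix.mulVec, dotProduct]
  let g0 : (Fin n → R) →+ (X.map φ).Coker :=
    (Submodule.mkQ (LinearMap.range (X.map φ).mulVecLin)).toAddMonoidHom.comp
      (φ.toAddMonoidHom.compLeft (Fin n))
  have hg0 : ∀ x, g0 x = Submodule.mkQ (LinearMap.range (X.map φ).mulVecLin) (φ ∘ x) := fun x => rfl
  have hle : (LinearMap.range X.mulVecLin).toAddSubgroup ≤ g0.ker := by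
    rintro _ ⟨z, rfl⟩
    rw [AddMonoidHom.mem_ker, hg0, hcomm, Submodule.mkQ_apply, Submodule.Quotient.mk_eq_zero]
    exact ⟨_, rfl⟩
  refine ⟨QuotientAddGroup.lift _ g0 hle, ?_, ?_⟩
  · intro y
    obtain ⟨y, rfl⟩ := Submodule.mkQ_surjective _ y
    refine ⟨Submodule.Quotient.mk fun i => Function.surjInv hs (y i), ?_⟩
    change g0 _ = _
    rw [hg0]
    congr 1
    funext i
    exact Function.surjInv_eq hs _
  · intro x
    obtain ⟨x, rfl⟩ := Submodule.mkQ_surjective _ x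
    change g0 x = 0 ↔ _
    rw [hg0, Submodule.mkQ_apply, Submodule.Quotient.mk_eq_zero]
    constructor
    · rintro ⟨z, hz⟩
      obtain ⟨z, rfl⟩ : ∃ z' : Fin n → R, φ ∘ z' = z :=
        ⟨fun i => Function.surjInv hs (z i), funext fun i => Function.surjInv_eq hs _⟩
      rw [← hcomm] at hz
      have h1 : ∀ i, ∃ w, (x - X.mulVecLin z) i = w * (a : R) := fun i => by
        have h2 : (x - X.mulVecLin z) i ∈ RingHom.ker φ := by
          have := congrFun hz i
          simp only [Function.comp_apply] at this
          rw [RingHom.mem_ker, Pi.sub_apply, map_sub, this, sub_self]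
        rw [hφ, Ideal.mem_span_singleton'] at h2
        obtain ⟨w, hw⟩ := h2
        exact ⟨w, hw.symm⟩
      choose w hw using h1
      refine ⟨Submodule.Quotient.mk w, ?_⟩
      rw [Submodule.mkQ_apply, ← Submodule.Quotient.mk_smul, eq_comm, Submodule.Quotient.eq]
      refine ⟨z, ?_⟩
      have h3 : x - X.mulVecLin z = a • w := by
        funext i
        rw [hw, Pi.smul_apply, nsmul_eq_mul, mul_comm]
      rw [← h3]; abel
    · rintro ⟨y, hy⟩
      obtain ⟨y, rfl⟩ := Submodule.mkQ_surjective _ y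
      rw [← map_nsmul, eq_comm, ← sub_eq_zero, ← map_sub, Submodule.mkQ_apply,
        Submodule.Quotient.mk_eq_zero] at hy
      obtain ⟨z, hz⟩ := hy
      refine ⟨φ ∘ z, ?_⟩
      rw [← hcomm, hz]
      funext i
      have ha : φ (a : R) = 0 := by
        rw [← RingHom.mem_ker, hφ]; exact Ideal.mem_span_singleton_self _
      simp [map_sub, map_mul, nsmul_eq_mul, ha]

lemma Matrix.nonempty_coker_tensor_iff {R : Type} [CommRing R] {a b n : ℕ} {φ : R →+* ZMod b}
    (hφ : RingHom.ker φ = Ideal.span {(a : R)}) (X : Matrix (Fin n) (Fin n) R) (H : Type*)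
    [AddCommGroup H] : Nonempty ((X.Coker ⊗[ℤ] ZMod a) ≃+ H) ↔ Nonempty ((X.map φ).Coker ≃+ H) := by
  obtain ⟨g, hg, hker⟩ := X.exists_coker_map hφ
  obtain ⟨e1⟩ := nonempty_modNat_addEquiv_of_surjective g hg hker
  obtain ⟨e2⟩ := nonempty_tensorProduct_zmod_addEquiv a X.Coker
  have e := e2.trans e1
  exact ⟨fun ⟨f⟩ => ⟨e.symm.trans f⟩, fun ⟨f⟩ => ⟨e.trans f⟩⟩

lemma nonempty_tensor_iff_homProfile_eq {a : ℕ} (ha : a ≠ 0) (M : Type*) [AddCommGroup M]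
    [Finite (ModNat a M)] (H : Type*) [AddCommGroup H] [Finite H] (hH : ∀ x : H, a • x = 0) :
    Nonempty ((M ⊗[ℤ] ZMod a) ≃+ H) ↔ ∀ p ∈ a.primeFactors,
      homProfile p (a.factorization p - 1) M = homProfile p (a.factorization p - 1) H := by
  obtain ⟨e⟩ := nonempty_tensorProduct_zmod_addEquiv a M
  have h1 : Nonempty ((M ⊗[ℤ] ZMod a) ≃+ H) ↔ Nonempty (ModNat a M ≃+ H) :=
    ⟨fun ⟨f⟩ => ⟨e.symm.trans f⟩, fun ⟨f⟩ => ⟨e.trans f⟩⟩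
  rw [h1, nonempty_addEquiv_iff_homProfile_eq ha smul_modNat hH]
  exact forall₂_congr fun p hp => by rw [homProfile_modNat ha hp]

lemma exists_smul_eq_of_coprime {A : Type*} [AddCommGroup A] [Finite A] {a : ℕ}
    (h : (Nat.card A).Coprime a) (x : A) : ∃ y, a • y = x := by
  refine ⟨(nsmulCoprime h).symm x, ?_⟩
  exact (nsmulCoprime h).apply_symm_apply x

lemma FinAbPGroupClass.coprime_natCard_group {p a : ℕ} (hp : p.Prime) (h : ¬ p ∣ a)
    (c : FinAbPGroupClass p) : (Nat.card c.group).Coprime a := by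
  obtain ⟨k, hk⟩ := c.exists_natCard_group
  rw [hk]
  exact Nat.Coprime.pow_left k ((Nat.Prime.coprime_iff_not_dvd hp).2 h)

/-- Multiplication by `a` is bijective on the factors at primes not dividing `a`, so only finitely
many finite factors survive in the quotient. -/
lemma finite_modNat_primeProductGroup {a : ℕ} (ha : a ≠ 0)
    (c : ∀ p : Nat.Primes, FinAbPGroupClass p) : Finite (ModNat a (primeProductGroup c)) := by
  have hfin := fun p : Nat.Primes => (c p).finite_group p.2
  let S : Finset Nat.Primes := Finset.subtype Nat.Prime a.primeFactors
  let F : (∀ p : S, (c p.1).group) → ModNat a (primeProductGroup c) := fun x =>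
    QuotientAddGroup.mk (show ∀ p : Nat.Primes, (c p).group from
      fun p => if hp : p ∈ S then x ⟨p, hp⟩ else 0)
  refine Finite.of_surjective F fun y => ?_
  obtain ⟨y, rfl⟩ := QuotientAddGroup.mk_surjective y
  change ∀ p : Nat.Primes, (c p).group at y
  have h1 : ∀ p : Nat.Primes, p ∉ S → ∃ z : (c p).group, a • z = y p := fun p hp => by
    refine exists_smul_eq_of_coprime ((c p).coprime_natCard_group p.2 fun h => hp ?_) _
    exact Finset.mem_subtype.2 (Nat.mem_primeFactors.2 ⟨p.2, h, ha⟩)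
  refine ⟨fun p => y p.1, QuotientAddGroup.eq.2 ?_⟩
  refine ⟨(show ∀ p : Nat.Primes, (c p).group from
    fun p => if hp : p ∈ S then 0 else (h1 p hp).choose), ?_⟩
  funext p
  change a • (if hp : p ∈ S then (0 : (c p).group) else (h1 p hp).choose) =
    -(if hp : p ∈ S then y p else 0) + y p
  by_cases hp : p ∈ S
  · rw [dif_pos hp, dif_pos hp, smul_zero, neg_add_cancel]
  · rw [dif_neg hp, dif_neg hp, (h1 p hp).choose_spec, neg_zero, zero_add]

/-- An element of the full product with trivial `p`-coordinate is divisible by every power of `p`,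
so a homomorphism to a cyclic `p`-group factors through that coordinate. -/
lemma homProfile_primeProductGroup (k : ℕ) (c : ∀ p : Nat.Primes, FinAbPGroupClass p)
    (p : Nat.Primes) : homProfile p k (primeProductGroup c) = homProfile p k (c p).group := by
  have hfin := fun p : Nat.Primes => (c p).finite_group p.2
  ext i
  change Nat.card ((∀ q : Nat.Primes, (c q).group) →+ ZMod ((p : ℕ) ^ ((i : ℕ) + 1))) = _
  have key : ∀ (f : (∀ q : Nat.Primes, (c q).group) →+ ZMod ((p : ℕ) ^ ((i : ℕ) + 1))) x,
      x p = 0 → f x = 0 := by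
    intro f x hx
    have h1 : ∀ q : Nat.Primes, ∃ z : (c q).group, (p : ℕ) ^ ((i : ℕ) + 1) • z = x q := fun q => by
      rcases eq_or_ne q p with rfl | hq
      · exact ⟨0, by rw [smul_zero, hx]⟩
      · refine exists_smul_eq_of_coprime ((c q).coprime_natCard_group q.2 fun h => hq ?_) _
        exact Subtype.ext ((Nat.prime_dvd_prime_iff_eq q.2 p.2).1 (q.2.dvd_of_dvd_pow h))
    choose z hz using h1
    have h2 : x = (p : ℕ) ^ ((i : ℕ) + 1) • z := funext fun q => (hz q).symm
    rw [h2, map_nsmul, nsmul_eq_mul, ZMod.natCast_self, zero_mul]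
  refine Nat.card_congr
    { toFun := fun f => f.comp (AddMonoidHom.single (fun q : Nat.Primes => ((c q).group : Type)) p)
      invFun := fun g => g.comp (Pi.evalAddMonoidHom (fun q : Nat.Primes => ((c q).group : Type)) p)
      left_inv := fun f => ?_
      right_inv := fun g => ?_ }
  · ext x
    have := key f (x - Pi.single p (x p)) (by simp)
    rw [map_sub, sub_eq_zero] at this
    simp [this]
  · ext x
    simp

lemma cohenLenstraProductLaw_eq [h : ∀ p : Nat.Primes, IsProbabilityMeasure (cohenLenstraLaw p)] :
    cohenLenstraProductLaw = Measure.infinitePi fun p : Nat.Primes => cohenLenstraLaw p := by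
  rw [cohenLenstraProductLaw, dif_pos h]

/-- The event depends only on the profiles at the primes dividing `a`, so it is a finite cylinder
and the product measure factors. -/
lemma cohenLenstraProductLaw_tensor {a : ℕ} (ha : a ≠ 0) (H : Type) [AddCommGroup H] [Finite H]
    (hH : ∀ x : H, a • x = 0) :
    cohenLenstraProductLaw {c | Nonempty ((primeProductGroup c ⊗[ℤ] ZMod a) ≃+ H)} =
      ENNReal.ofReal (∏ p ∈ a.primeFactors, (cohenLenstraLaw p).real
        {d | homProfile p (a.factorization p - 1) d.group =
          homProfile p (a.factorization p - 1) H}) := by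
  have hprob : ∀ p : Nat.Primes, IsProbabilityMeasure (cohenLenstraLaw p) := fun p => by
    have := Fact.mk p.2
    exact isProbabilityMeasure_cohenLenstraLaw
  obtain ⟨S, hS⟩ : ∃ S : Finset Nat.Primes, S = Finset.subtype Nat.Prime a.primeFactors := ⟨_, rfl⟩
  have hmem : ∀ p : Nat.Primes, p ∈ S ↔ (p : ℕ) ∈ a.primeFactors := fun p => by
    rw [hS]; exact Finset.mem_subtype
  have h1 : {c | Nonempty ((primeProductGroup c ⊗[ℤ] ZMod a) ≃+ H)} =
      Set.pi (S : Set Nat.Primes) fun p : Nat.Primes =>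
        {d : FinAbPGroupClass p | homProfile p (a.factorization p - 1) d.group =
          homProfile p (a.factorization p - 1) H} := by
    ext c
    have := finite_modNat_primeProductGroup ha c
    rw [Set.mem_ofPred_eq, nonempty_tensor_iff_homProfile_eq ha _ H hH, Set.mem_pi]
    constructor
    · intro h p hp
      have := h p ((hmem p).1 (Finset.mem_coe.1 hp))
      rwa [homProfile_primeProductGroup] at this
    · intro h p hp
      have := h ⟨p, Nat.prime_of_mem_primeFactors hp⟩ 
        (Finset.mem_coe.2 ((hmem _).2 hp))
      rw [Set.mem_ofPred_eq] at this
      rw [← this]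
      exact homProfile_primeProductGroup _ c ⟨p, Nat.prime_of_mem_primeFactors hp⟩
  rw [h1, cohenLenstraProductLaw_eq, Measure.infinitePi_pi _ fun _ _ => MeasurableSpace.measurableSet_top,
    ENNReal.ofReal_prod_of_nonneg fun _ _ => measureReal_nonneg]
  rw [hS, ← Finset.prod_subtype_of_mem (p := Nat.Prime) _ fun p => Nat.prime_of_mem_primeFactors]
  refine Finset.prod_congr rfl fun p _ => ?_
  have := hprob p
  rw [ofReal_measureReal]

end Reduction

/-! ### Reduction maps of the profinite and the `p`-adic integers. -/

section CoefficientRings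
open scoped Classical

namespace ProfiniteInt

/-- The reduction of profinite integers modulo `n`. -/
def reduction (n : ℕ+) : ProfiniteInt →+* ZMod (n : ℕ) :=
  (Pi.evalRingHom (fun n : ℕ+ => ZMod (n : ℕ)) n).comp ProfiniteInt.subtype

lemma measurable_reduction (n : ℕ+) : Measurable (reduction n) :=
  (measurable_pi_apply n).comp measurable_subtype_coe

lemma castHom_reduction {m n : ℕ+} (h : (m : ℕ) ∣ (n : ℕ)) (x : ProfiniteInt) :
    ZMod.castHom h (ZMod (m : ℕ)) (reduction n x) = reduction m x := x.2 m n h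

lemma natCast_val_reduction {m n : ℕ+} (h : (m : ℕ) ∣ (n : ℕ)) (x : ProfiniteInt) :
    (((reduction n x).val : ℕ) : ZMod (m : ℕ)) = reduction m x := by
  rw [← castHom_reduction h, ZMod.castHom_apply, ZMod.natCast_val]

/-- If `x` vanishes modulo `a`, its representative modulo `a * n` is `a * t n`. The numbers `t n`
modulo `n` are compatible and define the quotient of `x` by `a`. -/
lemma ker_reduction (a : ℕ+) :
    RingHom.ker (reduction a) = Ideal.span {((a : ℕ) : ProfiniteInt)} := by
  apply le_antisymm
  · intro x hx
    rw [RingHom.mem_ker] at hx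
    rw [Ideal.mem_span_singleton']
    have hdvd : ∀ n : ℕ+, (a : ℕ) ∣ (reduction (a * n) x).val := fun n => by
      rw [← ZMod.natCast_eq_zero_iff, natCast_val_reduction
        (by rw [PNat.mul_coe]; exact dvd_mul_right _ _), hx]
    choose t ht using hdvd
    refine ⟨⟨fun n => (t n : ZMod (n : ℕ)), ?_⟩, ?_⟩
    · intro m n h
      rw [map_natCast, ZMod.natCast_eq_natCast_iff]
      have h1 : ((a * m : ℕ+) : ℕ) ∣ ((a * n : ℕ+) : ℕ) := by
        rw [PNat.mul_coe, PNat.mul_coe]; exact Nat.mul_dvd_mul_left _ h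
      have h2 := natCast_val_reduction h1 x
      rw [← ZMod.natCast_zmod_val (reduction (a * m) x), ZMod.natCast_eq_natCast_iff, ht, ht,
        PNat.mul_coe] at h2
      exact Nat.ModEq.mul_left_cancel' a.ne_zero h2
    · apply Subtype.ext
      funext n
      change (t n : ZMod (n : ℕ)) * ((a : ℕ) : ProfiniteInt).1 n = reduction n x
      have h1 : (((a : ℕ) : ProfiniteInt)).1 n = ((a : ℕ) : ZMod (n : ℕ)) :=
        map_natCast (reduction n) _
      rw [h1, ← natCast_val_reduction (m := n) (n := a * n)
        (by rw [PNat.mul_coe]; exact dvd_mul_left _ _), ht, Nat.cast_mul, mul_comm]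
  · rw [Ideal.span_singleton_le_iff_mem, RingHom.mem_ker, map_natCast, ZMod.natCast_self]

end ProfiniteInt

lemma PadicInt.measurable_toZModPow {p : ℕ} [Fact p.Prime] [MeasurableSpace ℤ_[p]]
    [BorelSpace ℤ_[p]] (n : ℕ) : Measurable (PadicInt.toZModPow (p := p) n) := by
  have : NeZero (p ^ n) := ⟨pow_ne_zero _ (Fact.out : p.Prime).ne_zero⟩
  refine measurable_to_countable' fun y => ?_
  obtain ⟨x, rfl⟩ := ZMod.ringHom_surjective (PadicInt.toZModPow (p := p) n) y
  have h : (PadicInt.toZModPow (p := p) n) ⁻¹' {PadicInt.toZModPow n x} =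
      Metric.closedBall x ((p : ℝ) ^ (-n : ℤ)) := by
    ext z
    rw [Set.mem_preimage, Set.mem_singleton_iff, Metric.mem_closedBall, dist_eq_norm,
      PadicInt.norm_le_pow_iff_mem_span_pow, ← PadicInt.ker_toZModPow, RingHom.mem_ker, map_sub,
      sub_eq_zero]
  rw [h]
  exact Metric.isClosed_closedBall.measurableSet

lemma PadicInt.ringHom_zmod_eq_toZMod {p : ℕ} [Fact p.Prime] (ψ : ℤ_[p] →+* ZMod p) :
    ψ = PadicInt.toZMod := by
  refine ZMod.ringHom_eq_of_ker_eq _ _ ?_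
  rw [PadicInt.ker_toZMod]
  exact IsLocalRing.eq_maximalIdeal
    (RingHom.ker_isMaximal_of_surjective ψ (ZMod.ringHom_surjective ψ))

/-- The part of `a` prime to `p` is a unit in `ℤ_[p]`. -/
lemma PadicInt.ker_toZModPow_factorization {p : ℕ} [Fact p.Prime] {a : ℕ} (ha : a ≠ 0) :
    RingHom.ker (PadicInt.toZModPow (p := p) (a.factorization p)) =
      Ideal.span {(a : ℤ_[p])} := by
  rw [PadicInt.ker_toZModPow, Ideal.span_singleton_eq_span_singleton]
  have hp := (Fact.out : p.Prime)
  have hu : IsUnit ((ordCompl[p] a : ℕ) : ℤ_[p]) := by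
    rw [PadicInt.isUnit_iff, PadicInt.norm_natCast_eq_one_iff]
    exact Nat.coprime_ordCompl hp ha
  obtain ⟨u, hu⟩ := hu
  refine ⟨u, ?_⟩
  rw [hu]
  exact_mod_cast congrArg (Nat.cast (R := ℤ_[p])) (Nat.ordProj_mul_ordCompl_eq_self a p)

/-- Nakayama's lemma for the finitely generated module of multiples of `p ^ K`, which by assumption
equals `p` times itself. -/
lemma Matrix.smul_coker_padicInt_eq_zero {p : ℕ} [Fact p.Prime] {K n : ℕ}
    (X : Matrix (Fin n) (Fin n) ℤ_[p])
    (h : ∀ x : X.Coker, ∃ y : X.Coker, p ^ (K + 1) • y = p ^ K • x) (x : X.Coker) :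
    p ^ K • x = 0 := by
  set N := LinearMap.range (LinearMap.lsmul ℤ_[p] X.Coker ((p ^ K : ℕ) : ℤ_[p])) with hN
  have hJ : Ideal.span {(p : ℤ_[p])} ≤ Ideal.jacobson ⊥ := by
    rw [IsLocalRing.jacobson_eq_maximalIdeal ⊥ bot_ne_top, PadicInt.maximalIdeal_eq_span_p]
  have h1 : N = ⊥ := by
    refine Submodule.eq_bot_of_le_smul_of_le_jacobson_bot (Ideal.span {(p : ℤ_[p])}) N
      (IsNoetherian.noetherian N) ?_ hJ
    rintro _ ⟨y, rfl⟩
    obtain ⟨z, hz⟩ := h y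
    rw [LinearMap.lsmul_apply, Nat.cast_smul_eq_nsmul, ← hz, pow_succ', mul_smul,
      ← Nat.cast_smul_eq_nsmul ℤ_[p] p]
    refine Submodule.smul_mem_smul (Ideal.mem_span_singleton_self _) ⟨z, ?_⟩
    rw [LinearMap.lsmul_apply, Nat.cast_smul_eq_nsmul]
  have h2 : p ^ K • x ∈ N := ⟨x, by rw [LinearMap.lsmul_apply, Nat.cast_smul_eq_nsmul]⟩
  rwa [h1, Submodule.mem_bot] at h2

/-- The extra power of `p` is decisive: a quotient modulo `p ^ (K + 1)` killed by `p ^ K` forces the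
whole cokernel to be killed by `p ^ K`, and then the reduction map is injective. -/
lemma Matrix.nonempty_coker_padicInt_addEquiv_iff {p : ℕ} [Fact p.Prime] {K n : ℕ}
    (X : Matrix (Fin n) (Fin n) ℤ_[p]) (G : Type*) [AddCommGroup G] (hG : ∀ x : G, p ^ K • x = 0) :
    Nonempty (X.Coker ≃+ G) ↔
      Nonempty ((X.map (PadicInt.toZModPow (p := p) (K + 1))).Coker ≃+ G) := by
  have hφ : RingHom.ker (PadicInt.toZModPow (p := p) (K + 1)) =
      Ideal.span {((p ^ (K + 1) : ℕ) : ℤ_[p])} := by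
    rw [PadicInt.ker_toZModPow]; push_cast; rfl
  obtain ⟨g, hg, hker⟩ := X.exists_coker_map hφ
  have key : (∀ x : X.Coker, p ^ K • x = 0) → Function.Injective g := fun h => by
    rw [injective_iff_map_eq_zero]
    intro x hx
    obtain ⟨y, rfl⟩ := (hker x).1 hx
    rw [pow_succ', mul_smul, h, smul_zero]
  constructor
  · rintro ⟨e⟩
    have h : ∀ x : X.Coker, p ^ K • x = 0 := fun x => e.injective (by
      rw [map_nsmul, hG, map_zero])
    exact ⟨(AddEquiv.ofBijective g ⟨key h, hg⟩).symm.trans e⟩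
  · rintro ⟨e⟩
    have h : ∀ x : X.Coker, p ^ K • x = 0 := X.smul_coker_padicInt_eq_zero fun x =>
      (hker _).1 (e.injective (by rw [map_nsmul, map_nsmul, hG, map_zero]))
    exact ⟨(AddEquiv.ofBijective g ⟨key h, hg⟩).trans e⟩

end CoefficientRings

/-! ### Weak convergence over each ring and pointwise convergence over `ℤ_[p]`. -/

section Convergence
open scoped Classical

lemma tendsto_measure_coker_tensor {Ω : ℕ → Type*} [∀ n, MeasurableSpace (Ω n)]
    (P : ∀ n, Measure (Ω n)) [∀ n, IsProbabilityMeasure (P n)] {ε : ℝ} (hε : 0 < ε) {R : Type}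
    [CommRing R] [MeasurableSpace R] {a b : ℕ} [NeZero b] {φ : R →+* ZMod b} (hφ : Measurable φ)
    (hker : RingHom.ker φ = Ideal.span {(a : R)})
    (C : ∀ n, Matrix (Fin n) (Fin n) R) (X : ∀ n, Ω n → Matrix (Fin n) (Fin n) R) (g : ℕ → ℕ)
    (hC : ∀ n, (C n).IsAlternating) (hg : ∀ n, GeneratedBy R (C n).Coker (g n))
    (hX : ∀ n, IsEpsBalancedCSymmetric ε (P n) (C n) (X n))
    (hng : Tendsto (fun n : ℕ => (n : ℤ) - (g n : ℤ)) atTop atTop)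
    (H : Type) [AddCommGroup H] [Finite H] (hH : ∀ x : H, b • x = 0) :
    Tendsto (fun n => P n {ω | Nonempty (((X n ω).Coker ⊗[ℤ] ZMod a) ≃+ H)}) atTop
      (𝓝 (ENNReal.ofReal (∏ p ∈ b.primeFactors, (cohenLenstraLaw p).real
        {d | homProfile p (b.factorization p - 1) d.group =
          homProfile p (b.factorization p - 1) H}))) := by
  have h1 := tendsto_measureReal_coker_map P hε hφ C X hC hX
    (fun p hp _ ψ => tendsto_rank_of_generatedBy hg hng hp ψ) H hH
  refine (ENNReal.tendsto_ofReal h1).congr fun n => ?_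
  rw [ofReal_measureReal]
  congr 1
  ext ω
  exact (Matrix.nonempty_coker_tensor_iff hker (X n ω) H).symm

lemma nonempty_tensor_mul_addEquiv {b u : ℕ} (M : Type*) [AddCommGroup M] [Finite M]
    (h : (Nat.card M).Coprime u) : Nonempty ((M ⊗[ℤ] ZMod (b * u)) ≃+ (M ⊗[ℤ] ZMod b)) := by
  obtain ⟨e1⟩ := nonempty_tensorProduct_zmod_addEquiv (b * u) M
  obtain ⟨e2⟩ := nonempty_tensorProduct_zmod_addEquiv b M
  obtain ⟨e3⟩ := nonempty_modNat_addEquiv_of_surjective (a := b * u)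
    (QuotientAddGroup.mk' (nsmulAddMonoidHom b : M →+ M).range)
    (QuotientAddGroup.mk'_surjective _) fun x => by
      rw [QuotientAddGroup.mk'_apply, QuotientAddGroup.eq_zero_iff]
      constructor
      · rintro ⟨y, rfl⟩
        obtain ⟨z, rfl⟩ := exists_smul_eq_of_coprime h y
        exact ⟨z, mul_smul _ _ _⟩
      · rintro ⟨y, rfl⟩
        exact ⟨u • y, (mul_smul _ _ _).symm⟩
  exact ⟨e1.trans (e3.trans e2.symm)⟩

lemma cohenLenstraLaw_tensor {p : ℕ} [Fact p.Prime] {a : ℕ} (ha : a ≠ 0) (H : Type)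
    [AddCommGroup H] [Finite H] (hH : ∀ x : H, p ^ a.factorization p • x = 0) :
    cohenLenstraLaw p {d | Nonempty ((d.group ⊗[ℤ] ZMod a) ≃+ H)} =
      ENNReal.ofReal (∏ q ∈ (p ^ a.factorization p).primeFactors, (cohenLenstraLaw q).real
        {d | homProfile q ((p ^ a.factorization p).factorization q - 1) d.group =
          homProfile q ((p ^ a.factorization p).factorization q - 1) H}) := by
  have hp := (Fact.out : p.Prime)
  have := isProbabilityMeasure_cohenLenstraLaw (p := p)
  set b := p ^ a.factorization p with hb
  have hb0 : b ≠ 0 := pow_ne_zero _ hp.ne_zero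
  have h1 : ∀ d : FinAbPGroupClass p, Nonempty ((d.group ⊗[ℤ] ZMod a) ≃+ H) ↔
      ∀ q ∈ b.primeFactors, homProfile q (b.factorization q - 1) d.group =
        homProfile q (b.factorization q - 1) H := by
    intro d
    have := d.finite_group hp
    obtain ⟨j, hj⟩ := d.exists_natCard_group
    obtain ⟨e⟩ := nonempty_tensor_mul_addEquiv (b := b) (u := ordCompl[p] a) d.group
      (hj ▸ Nat.Coprime.pow_left j (Nat.coprime_ordCompl hp ha))
    rw [hb, Nat.ordProj_mul_ordCompl_eq_self] at e
    rw [← nonempty_tensor_iff_homProfile_eq hb0 d.group H hH]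
    exact ⟨fun ⟨f⟩ => ⟨e.symm.trans f⟩, fun ⟨f⟩ => ⟨e.trans f⟩⟩
  simp_rw [h1]
  rcases Nat.eq_zero_or_pos (a.factorization p) with h0 | h0
  · have : b.primeFactors = ∅ := by rw [hb, h0, pow_zero, Nat.primeFactors_one]
    simp [this]
  · have : b.primeFactors = {p} := by rw [hb, Nat.primeFactors_prime_pow h0.ne' hp]
    simp only [this, Finset.mem_singleton, forall_eq, Finset.prod_singleton]
    rw [ofReal_measureReal]

lemma convergesWeakly_padicInt {Ω : ℕ → Type*} [∀ n, MeasurableSpace (Ω n)]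
    (P : ∀ n, Measure (Ω n)) [∀ n, IsProbabilityMeasure (P n)] {ε : ℝ} (hε : 0 < ε)
    (p : ℕ) [Fact p.Prime] [MeasurableSpace ℤ_[p]] [BorelSpace ℤ_[p]]
    (C : ∀ n, Matrix (Fin n) (Fin n) ℤ_[p]) (X : ∀ n, Ω n → Matrix (Fin n) (Fin n) ℤ_[p])
    (g : ℕ → ℕ) (hC : ∀ n, (C n).IsAlternating) (hg : ∀ n, GeneratedBy ℤ_[p] (C n).Coker (g n))
    (hX : ∀ n, IsEpsBalancedCSymmetric ε (P n) (C n) (X n))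
    (hng : Tendsto (fun n : ℕ => (n : ℤ) - (g n : ℤ)) atTop atTop) :
    ConvergesWeakly P (fun n ω => AddCommGrpCat.of (X n ω).Coker)
      (cohenLenstraLaw p) FinAbPGroupClass.group := by
  intro a ha H _ _ hH
  have hp := (Fact.out : p.Prime)
  have : NeZero (p ^ a.factorization p) := ⟨pow_ne_zero _ hp.ne_zero⟩
  have hker := PadicInt.ker_toZModPow_factorization (p := p) ha.ne'
  by_cases hb : ∀ x : H, p ^ a.factorization p • x = 0
  · rw [cohenLenstraLaw_tensor ha.ne' H hb]
    exact tendsto_measure_coker_tensor P hε (PadicInt.measurable_toZModPow _) hker C X g hC hg hX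
      hng H hb
  -- Tensoring with `ZMod a` sees only the `p`-part of `a`, for cokernels over `ℤ_[p]` and for
  -- `p`-groups alike. A group `H` not killed by it occurs on neither side.
  · have h1 : ∀ n, {ω | Nonempty (((X n ω).Coker ⊗[ℤ] ZMod a) ≃+ H)} = ∅ := fun n => by
      refine Set.eq_empty_of_forall_notMem fun ω hω => hb fun x => ?_
      obtain ⟨e⟩ := (Matrix.nonempty_coker_tensor_iff hker (X n ω) H).1 hω
      apply e.symm.injective
      rw [map_nsmul, map_zero, ← Nat.cast_smul_eq_nsmul (ZMod (p ^ a.factorization p)),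
        ZMod.natCast_self, zero_smul]
    have h2 : {d : FinAbPGroupClass p | Nonempty ((d.group ⊗[ℤ] ZMod a) ≃+ H)} = ∅ := by
      refine Set.eq_empty_of_forall_notMem fun d hd => hb fun x => ?_
      obtain ⟨e⟩ := hd
      have := d.finite_group hp
      obtain ⟨j, hj⟩ := d.exists_natCard_group
      obtain ⟨e1⟩ := nonempty_tensor_mul_addEquiv (b := p ^ a.factorization p)
        (u := ordCompl[p] a) d.group
        (hj ▸ Nat.Coprime.pow_left j (Nat.coprime_ordCompl hp ha.ne'))
      rw [Nat.ordProj_mul_ordCompl_eq_self] at e1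
      obtain ⟨e2⟩ := nonempty_tensorProduct_zmod_addEquiv (p ^ a.factorization p) d.group
      apply ((e.symm.trans e1).trans e2).injective
      rw [map_nsmul, map_zero, smul_modNat]
    rw [h2, measure_empty]
    exact tendsto_const_nhds.congr fun n => by
      rw [← measure_empty (μ := P n), ← h1 n]

lemma convergesWeakly_int {Ω : ℕ → Type*} [∀ n, MeasurableSpace (Ω n)]
    (P : ∀ n, Measure (Ω n)) [∀ n, IsProbabilityMeasure (P n)] {ε : ℝ} (hε : 0 < ε)
    (C : ∀ n, Matrix (Fin n) (Fin n) ℤ) (X : ∀ n, Ω n → Matrix (Fin n) (Fin n) ℤ)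
    (g : ℕ → ℕ) (hC : ∀ n, (C n).IsAlternating) (hg : ∀ n, GeneratedBy ℤ (C n).Coker (g n))
    (hX : ∀ n, IsEpsBalancedCSymmetric ε (P n) (C n) (X n))
    (hng : Tendsto (fun n : ℕ => (n : ℤ) - (g n : ℤ)) atTop atTop) :
    ConvergesWeakly P (fun n ω => AddCommGrpCat.of (X n ω).Coker)
      cohenLenstraProductLaw primeProductGroup := by
  intro a ha H _ _ hH
  have : NeZero a := ⟨ha.ne'⟩
  rw [cohenLenstraProductLaw_tensor ha.ne' H hH]
  exact tendsto_measure_coker_tensor P hε (φ := Int.castRingHom (ZMod a)) measurable_from_top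
    (ZMod.ker_intCastRingHom a) C X g hC hg hX hng H hH

lemma convergesWeakly_profiniteInt {Ω : ℕ → Type*} [∀ n, MeasurableSpace (Ω n)]
    (P : ∀ n, Measure (Ω n)) [∀ n, IsProbabilityMeasure (P n)] {ε : ℝ} (hε : 0 < ε)
    (C : ∀ n, Matrix (Fin n) (Fin n) ProfiniteInt)
    (X : ∀ n, Ω n → Matrix (Fin n) (Fin n) ProfiniteInt) (g : ℕ → ℕ)
    (hC : ∀ n, (C n).IsAlternating) (hg : ∀ n, GeneratedBy ProfiniteInt (C n).Coker (g n))
    (hX : ∀ n, IsEpsBalancedCSymmetric ε (P n) (C n) (X n))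
    (hng : Tendsto (fun n : ℕ => (n : ℤ) - (g n : ℤ)) atTop atTop) :
    ConvergesWeakly P (fun n ω => AddCommGrpCat.of (X n ω).Coker)
      cohenLenstraProductLaw primeProductGroup := by
  intro a ha H _ _ hH
  obtain ⟨b, rfl⟩ : ∃ b : ℕ+, (b : ℕ) = a := ⟨⟨a, ha⟩, rfl⟩
  rw [cohenLenstraProductLaw_tensor ha.ne' H hH]
  exact tendsto_measure_coker_tensor P hε (ProfiniteInt.measurable_reduction b)
    (ProfiniteInt.ker_reduction b) C X g hC hg hX hng H hH

lemma smul_eq_zero_of_forall_exists {M : Type*} [AddCommGroup M] {p K j : ℕ}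
    (hM : ∀ x : M, p ^ j • x = 0) (h : ∀ x : M, ∃ y, p ^ (K + 1) • y = p ^ K • x) (x : M) :
    p ^ K • x = 0 := by
  have key : ∀ m, ∃ y, p ^ (K + m) • y = p ^ K • x := by
    intro m
    induction m with
    | zero => exact ⟨x, rfl⟩
    | succ m ih =>
      obtain ⟨y, hy⟩ := ih
      obtain ⟨z, hz⟩ := h y
      refine ⟨z, ?_⟩
      rw [show K + (m + 1) = m + (K + 1) by omega, pow_add, mul_smul, hz, ← mul_smul, ← pow_add,
        add_comm m K, hy]
  obtain ⟨y, hy⟩ := key j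
  rw [← hy, pow_add, mul_smul, hM, smul_zero]

lemma cohenLenstraProb_congr (p : ℕ) {G H : Type*} [AddCommGroup G] [AddCommGroup H] (e : G ≃+ H) :
    cohenLenstraProb p G = cohenLenstraProb p H := by
  have : Nat.card (G ≃+ G) = Nat.card (H ≃+ H) := Nat.card_congr
    { toFun := fun f => (e.symm.trans f).trans e
      invFun := fun f => (e.trans f).trans e.symm
      left_inv := fun f => by ext; simp
      right_inv := fun f => by ext; simp }
  rw [cohenLenstraProb, cohenLenstraProb, this]

/-- The profile up to `p ^ (K + 1)` determines the group modulo `p ^ (K + 1)`. That quotient is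
killed by `p ^ K`, so the whole `p`-group is, and it equals its quotient. The event is therefore a
single class. -/
lemma cohenLenstraLaw_real_homProfile {p : ℕ} [Fact p.Prime] {K : ℕ} (G : Type) [AddCommGroup G]
    (hcard : ∃ k, Nat.card G = p ^ k) (hG : ∀ x : G, p ^ K • x = 0) :
    (cohenLenstraLaw p).real {d | homProfile p K d.group = homProfile p K G} =
      cohenLenstraProb p G := by
  have hp := (Fact.out : p.Prime)
  have hfinG : Finite G := by
    obtain ⟨k, hk⟩ := hcard
    exact Nat.finite_of_card_ne_zero (hk ▸ pow_ne_zero _ hp.ne_zero)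
  have h1 : {d : FinAbPGroupClass p | homProfile p K d.group = homProfile p K G} =
      (({FinAbPGroupClass.ofGroup G hcard} : Finset (FinAbPGroupClass p)) :
        Set (FinAbPGroupClass p)) := by
    ext d
    rw [Finset.coe_singleton, Set.mem_singleton_iff, eq_comm,
      ← FinAbPGroupClass.nonempty_addEquiv_group_iff hcard, Set.mem_ofPred_eq]
    constructor
    · intro h
      have hfin := d.finite_group hp
      obtain ⟨j, hj⟩ := d.exists_natCard_group
      have hpf : (p ^ (K + 1)).primeFactors = {p} := Nat.primeFactors_prime_pow K.succ_ne_zero hp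
      have hfac : (p ^ (K + 1)).factorization p - 1 = K := by
        rw [hp.factorization_pow, Finsupp.single_eq_same, Nat.add_sub_cancel]
      obtain ⟨e1⟩ := (nonempty_tensor_iff_homProfile_eq (pow_ne_zero (K + 1) hp.ne_zero) d.group G
        (fun x => by rw [pow_succ', mul_smul, hG, smul_zero])).2 fun q hq => by
          rw [hpf, Finset.mem_singleton] at hq
          subst hq
          rwa [hfac]
      obtain ⟨e2⟩ := nonempty_tensorProduct_zmod_addEquiv (p ^ (K + 1)) d.group
      have e3 := e2.symm.trans e1
      have h2 : ∀ x : d.group, p ^ K • x = 0 := smul_eq_zero_of_forall_exists (j := j)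
        (fun x => by rw [← hj, card_nsmul_eq_zero']) fun x => by
          have h3 : (QuotientAddGroup.mk (p ^ K • x) : ModNat (p ^ (K + 1)) d.group) = 0 :=
            e3.injective (by rw [QuotientAddGroup.mk_nsmul, map_nsmul, hG, map_zero])
          exact (QuotientAddGroup.eq_zero_iff _).1 h3
      obtain ⟨e4⟩ := nonempty_modNat_addEquiv_of_surjective (a := p ^ (K + 1))
        (AddMonoidHom.id d.group) Function.surjective_id fun x => by
          constructor
          · rintro rfl
            exact ⟨0, smul_zero _⟩
          · rintro ⟨y, rfl⟩
            rw [AddMonoidHom.id_apply, pow_succ', mul_smul, h2, smul_zero]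
      exact ⟨e3.symm.trans e4⟩
    · rintro ⟨e⟩
      exact (homProfile_congr p K e).symm
  rw [h1, measureReal_def, cohenLenstraLaw_finset hp, Finset.sum_singleton,
    ENNReal.toReal_ofReal (cohenLenstraProb_nonneg hp _)]
  obtain ⟨e⟩ := (FinAbPGroupClass.nonempty_addEquiv_group_iff hcard _).2 rfl
  exact (cohenLenstraProb_congr p e).symm

lemma tendsto_measureReal_coker_padicInt {Ω : ℕ → Type*} [∀ n, MeasurableSpace (Ω n)]
    (P : ∀ n, Measure (Ω n)) [∀ n, IsProbabilityMeasure (P n)] {ε : ℝ} (hε : 0 < ε)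
    (p : ℕ) [Fact p.Prime] [MeasurableSpace ℤ_[p]] [BorelSpace ℤ_[p]]
    (C : ∀ n, Matrix (Fin n) (Fin n) ℤ_[p]) (X : ∀ n, Ω n → Matrix (Fin n) (Fin n) ℤ_[p])
    (hC : ∀ n, (C n).IsAlternating)
    (hX : ∀ n, IsEpsBalancedCSymmetric ε (P n) (C n) (X n))
    (hrank : Tendsto (fun n => ((C n).map (PadicInt.toZMod (p := p))).rank) atTop atTop)
    (G : Type) [AddCommGroup G] (hG : ∃ k : ℕ, Nat.card G = p ^ k) :
    Tendsto (fun n => (P n).real {ω | Nonempty ((X n ω).Coker ≃+ G)}) atTop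
      (𝓝 (cohenLenstraProb p G)) := by
  have hp := (Fact.out : p.Prime)
  obtain ⟨K, hK⟩ := hG
  have hfinG : Finite G := Nat.finite_of_card_ne_zero (hK ▸ pow_ne_zero _ hp.ne_zero)
  have hGK : ∀ x : G, p ^ K • x = 0 := fun x => by rw [← hK, card_nsmul_eq_zero']
  have : NeZero (p ^ (K + 1)) := ⟨pow_ne_zero _ hp.ne_zero⟩
  -- The modulus exceeds the exponent bound `p ^ K` of `G` by one power of `p`, so that the reduced
  -- cokernel recognizes `G`.
  have h1 := tendsto_measureReal_coker_map P hε (PadicInt.measurable_toZModPow (p := p) (K + 1))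
    C X hC hX (fun q hq hqp ψ => by
      obtain rfl : q = p := (Nat.prime_dvd_prime_iff_eq hq hp).1 (hq.dvd_of_dvd_pow hqp)
      rwa [PadicInt.ringHom_zmod_eq_toZMod ψ]) G
    (fun x => by rw [pow_succ', mul_smul, hGK, smul_zero])
  have hfac : (p ^ (K + 1)).factorization p - 1 = K := by
    rw [hp.factorization_pow, Finsupp.single_eq_same, Nat.add_sub_cancel]
  rw [Nat.primeFactors_prime_pow K.succ_ne_zero hp, Finset.prod_singleton, hfac,
    cohenLenstraLaw_real_homProfile G ⟨K, hK⟩ hGK] at h1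
  refine h1.congr fun n => ?_
  congr 1
  ext ω
  exact ((X n ω).nonempty_coker_padicInt_addEquiv_iff G hGK).symm

end Convergence

/-! ### The theorem for the three coefficient rings. -/

theorem mainTheorem1 {Ω : ℕ → Type*} [∀ n, MeasurableSpace (Ω n)]
    (P : ∀ n, Measure (Ω n)) [∀ n, IsProbabilityMeasure (P n)] (ε : ℝ) (hε : 0 < ε) :
    -- pointwise convergence over the `p`-adic integers
    (∀ (p : ℕ) [Fact p.Prime] [MeasurableSpace ℤ_[p]] [BorelSpace ℤ_[p]]
      (C : ∀ n, Matrix (Fin n) (Fin n) ℤ_[p]) (X : ∀ n, Ω n → Matrix (Fin n) (Fin n) ℤ_[p]),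
      (∀ n, (C n).IsAlternating) →
      (∀ n, IsEpsBalancedCSymmetric ε (P n) (C n) (X n)) →
      Tendsto (fun n => ((C n).map (PadicInt.toZMod (p := p))).rank) atTop atTop →
      ∀ (G : Type*) [AddCommGroup G], (∃ k : ℕ, Nat.card G = p ^ k) →
        Tendsto (fun n => (P n).real {ω | Nonempty ((X n ω).Coker ≃+ G)}) atTop
          (𝓝 ((Nat.card (G ≃+ G) : ℝ)⁻¹ * ∏' k : ℕ, (1 - ((p : ℝ) ^ (k + 1))⁻¹)))) ∧
    -- weak convergence over the `p`-adic integers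
    (∀ (p : ℕ) [Fact p.Prime] [MeasurableSpace ℤ_[p]] [BorelSpace ℤ_[p]]
      (C : ∀ n, Matrix (Fin n) (Fin n) ℤ_[p]) (X : ∀ n, Ω n → Matrix (Fin n) (Fin n) ℤ_[p])
      (g : ℕ → ℕ),
      (∀ n, (C n).IsAlternating) →
      (∀ n, GeneratedBy ℤ_[p] (C n).Coker (g n)) →
      (∀ n, IsEpsBalancedCSymmetric ε (P n) (C n) (X n)) →
      Tendsto (fun n : ℕ => (n : ℤ) - (g n : ℤ)) atTop atTop →
      ConvergesWeakly P (fun n ω => AddCommGrpCat.of (X n ω).Coker)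
        (cohenLenstraLaw p) FinAbPGroupClass.group) ∧
    -- weak convergence over the integers
    (∀ (C : ∀ n, Matrix (Fin n) (Fin n) ℤ) (X : ∀ n, Ω n → Matrix (Fin n) (Fin n) ℤ)
      (g : ℕ → ℕ),
      (∀ n, (C n).IsAlternating) →
      (∀ n, GeneratedBy ℤ (C n).Coker (g n)) →
      (∀ n, IsEpsBalancedCSymmetric ε (P n) (C n) (X n)) →
      Tendsto (fun n : ℕ => (n : ℤ) - (g n : ℤ)) atTop atTop →
      ConvergesWeakly P (fun n ω => AddCommGrpCat.of (X n ω).Coker)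
        cohenLenstraProductLaw primeProductGroup) ∧
    -- weak convergence over the profinite integers
    (∀ (C : ∀ n, Matrix (Fin n) (Fin n) ProfiniteInt)
      (X : ∀ n, Ω n → Matrix (Fin n) (Fin n) ProfiniteInt) (g : ℕ → ℕ),
      (∀ n, (C n).IsAlternating) →
      (∀ n, GeneratedBy ProfiniteInt (C n).Coker (g n)) →
      (∀ n, IsEpsBalancedCSymmetric ε (P n) (C n) (X n)) →
      Tendsto (fun n : ℕ => (n : ℤ) - (g n : ℤ)) atTop atTop →
      ConvergesWeakly P (fun n ω => AddCommGrpCat.of (X n ω).Coker)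
        cohenLenstraProductLaw primeProductGroup) := by
  refine ⟨?_, ?_, ?_, ?_⟩
  · intro p _ _ _ C X hC hX hrank G _ hG
    have hp := (Fact.out : p.Prime)
    have hfinG : Finite G := by
      obtain ⟨k, hk⟩ := hG
      exact Nat.finite_of_card_ne_zero (hk ▸ pow_ne_zero _ hp.ne_zero)
    -- The classes of `p`-groups are built from `Type`, so a finite `G` in any universe is first
    -- replaced by a copy there.
    have e : Shrink.{0} G ≃+ G := Shrink.addEquiv
    have h1 := tendsto_measureReal_coker_padicInt P hε p C X hC hX hrank (Shrink.{0} G)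
      (by rwa [Nat.card_congr e.toEquiv])
    rw [cohenLenstraProb_congr p e] at h1
    refine h1.congr fun n => ?_
    congr 1
    ext ω
    exact ⟨fun ⟨f⟩ => ⟨f.trans e⟩, fun ⟨f⟩ => ⟨f.trans e.symm⟩⟩
  · intro p _ _ _ C X g hC hg hX hng
    exact convergesWeakly_padicInt P hε p C X g hC hg hX hng
  · exact fun C X g hC hg hX hng => convergesWeakly_int P hε C X g hC hg hX hng
  · exact fun C X g hC hg hX hng => convergesWeakly_profiniteInt P hε C X g hC hg hX hng
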